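/- **Setting.** Let $d\ge 1$, $1<p<\infty$, $T>0$. Let $b\in L^1((0,T);W^{1,p}(\mathbb R^d))\cap L^\infty((0,T)\times\mathbb R^d)$ be a divergence-free vector field with values in $\mathbb R^d$, and let $X$ be its regular Lagrangian flow: $X(t,\cdot)$ is measurable for every $t\in[0,T]$; for a.e. $x$ the function $s\mapsto b(s,X(s,x))$ is integrable on $(0,T)$ and $X(t,x)=x+\int_0^t b(s,X(s,x))\,ds$ for all $t\in[0,T]$; and there is a constant $L$ with $\mathcal L^d(X(t,\cdot)^{-1}(A))\le L\,\mathcal L^d(A)$ for all $t\in(0,T)$ and all open $A\subset\mathbb R^d$. Let $C_0,C_1,C_2,C_3,\alpha,\beta>0$ and let $\{b_\varepsilon\}_{0<\varepsilon\le 1}$ be an approximating sequence for $b$, that is, a family of measurable vector fields, continuous in space for a.e. time and weakly differentiable in space, with $$\|b_\varepsilon-b\|_{L^1_tL^1_x}\le C_0\varepsilon^\alpha,\quad \|\nabla b_\varepsilon\|_{L^\infty_{t,x}}\le C_1\varepsilon^{-\beta},\quad \|\operatorname{div} b_\varepsilon\|_{L^\infty_{t,x}}\le C_2,\quad \|b_\varepsilon\|_{L^\infty_{t,x}}\le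 C_3 .$$ Given $\theta\in[0,1]$, $N\ge 1$, $h=T/N$, $t_i=ih$, let the maps $X_i^{\theta,\varepsilon}:\mathbb R^d\to\mathbb R^d$, $0\le i\le N$, satisfy $X_0^{\theta,\varepsilon}(x)=x$ and, for $0\le i<N$ and all $x$, $$\frac{X_{i+1}^{\theta,\varepsilon}-X_i^{\theta,\varepsilon}}{h}=\frac{1-\theta}{h}\int_{t_i}^{t_{i+1}}b_\varepsilon(s,X_i^{\theta,\varepsilon})\,ds+\frac{\theta}{h}\int_{t_i}^{t_{i+1}}b_\varepsilon(s,X_{i+1}^{\theta,\varepsilon})\,ds .$$ Let $\tilde X^{h,\theta,\varepsilon}(t,x)=X_i^{\theta,\varepsilon}(x)+\frac{t-t_i}{h}\bigl(X_{i+1}^{\theta,\varepsilon}(x)-X_i^{\theta,\varepsilon}(x)\bigr)$ for $t\in[t_i,t_{i+1})$, and $\tilde X^{h,\theta,\varepsilon}(T,x)=X_N^{\theta,\varepsilon}(x)$. For $r,\delta>0$ put $$Q_{\delta,N,r}(t)=\int_{B_r}\log\Bigl(1+\frac{|\tilde X^{h,\theta,\varepsilon}(t,x)-X(t,x)|}{\delta}\Bigr)\,dx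 .$$ **Claim.** There is $h_0>0$, depending only on $d,C_1,C_2$, such that if $0<h\le h_0$ and $\varepsilon=h^{1/(2\beta)}$, then the integrand of $Q_{\delta,N,r}(t)$ is integrable on $B_r$ for every $t\in[0,T]$ and $$\sup_{t\in[0,T]}Q_{\delta,N,r}(t)\le K\left(\frac{h^{\alpha/(2\beta)}}{\delta}+1+\frac h\delta\right)\qquad\text{for all }\delta>0,$$ where $K$ depends only on $d,p,r,T$, on upper bounds for $\|b\|_{L^\infty}$ and $\|\nabla b\|_{L^1_tL^p_x}$, and on $C_0,C_1,C_2,C_3,\alpha,\beta$ (in particular not on $L,\delta,\theta,N$). -/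

import Mathlib

open MeasureTheory Set
open scoped ENNReal NNReal ContDiff

namespace ThetaFlow

/-- The space `ℝ^d` with its Euclidean norm. -/
abbrev Rd (d : ℕ) : Type := EuclideanSpace ℝ (Fin d)

/-- The product of Lebesgue measures on `(0,T) × ℝ^d`. -/
noncomputable def slab (d : ℕ) (T : ℝ) : Measure (ℝ × Rd d) :=
  (volume.restrict (Ioo 0 T)).prod volume

/-- The norm of `L^1((0,T); L^p(ℝ^d))`. -/
noncomputable def normL1Lp {d : ℕ} {F : Type*} [NormedAddCommGroup F]
    (T : ℝ) (p : ℝ≥0∞) (f : ℝ → Rd d → F) : ℝ≥0∞ :=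
  ∫⁻ t in Ioo 0 T, eLpNorm (fun x => ‖f t x‖) p volume

/-- The norm of `L^∞((0,T) × ℝ^d)`. -/
noncomputable def normLinf {d : ℕ} {F : Type*} [NormedAddCommGroup F]
    (T : ℝ) (f : ℝ → Rd d → F) : ℝ≥0∞ :=
  eLpNorm (fun z : ℝ × Rd d => ‖f z.1 z.2‖) ⊤ (slab d T)

/-- `G` is the gradient of the vector field `u` in the sense of distributions; `G x v` is the
weak derivative of `u` at `x` in the direction `v`. -/
structure HasWeakGradient {d : ℕ} (u : Rd d → Rd d) (G : Rd d → Rd d →L[ℝ] Rd d) : Prop where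
  locallyIntegrable : LocallyIntegrable u volume
  locallyIntegrable_grad : ∀ v : Rd d, LocallyIntegrable (fun x => G x v) volume
  integral_eq : ∀ φ : Rd d → ℝ, ContDiff ℝ ∞ φ → HasCompactSupport φ → ∀ v : Rd d,
    ∫ x, fderiv ℝ φ x v • u x = - ∫ x, φ x • G x v

/-- The divergence of a time dependent field whose spatial weak gradient is `G`:
the trace of `G`. -/
noncomputable def divOfGrad {d : ℕ} (G : ℝ → Rd d → Rd d →L[ℝ] Rd d) (t : ℝ) (x : Rd d) : ℝ :=
  LinearMap.trace ℝ (Rd d) (G t x : Rd d →ₗ[ℝ] Rd d)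

/-- `b ∈ L^1((0,T); W^{1,p}(ℝ^d))`, with spatial weak gradient `G`. -/
structure MemL1W1p {d : ℕ} (T : ℝ) (p : ℝ≥0∞) (b : ℝ → Rd d → Rd d)
    (G : ℝ → Rd d → Rd d →L[ℝ] Rd d) : Prop where
  aestronglyMeasurable : AEStronglyMeasurable (Function.uncurry b) (slab d T)
  aestronglyMeasurable_grad : AEStronglyMeasurable (Function.uncurry G) (slab d T)
  hasWeakGradient : ∀ᵐ t ∂volume.restrict (Ioo 0 T), HasWeakGradient (b t) (G t)
  norm_lt_top : normL1Lp T p b < ⊤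
  norm_grad_lt_top : normL1Lp T p G < ⊤

/-- The field with spatial weak gradient `G` is divergence-free on `(0,T) × ℝ^d`. -/
def IsDivFree {d : ℕ} (T : ℝ) (G : ℝ → Rd d → Rd d →L[ℝ] Rd d) : Prop :=
  ∀ᵐ z ∂slab d T, divOfGrad G z.1 z.2 = 0

/-- `X` is a regular Lagrangian flow of `b` on `[0,T]`: almost every trajectory is an absolutely
continuous solution of the ordinary differential equation (in integral form), and Lebesgue
measure is compressed by at most a constant factor. -/
structure IsRegularLagrangianFlow {d : ℕ} (T : ℝ) (b : ℝ → Rd d → Rd d)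
    (X : ℝ → Rd d → Rd d) : Prop where
  aemeasurable : ∀ t ∈ Icc 0 T, AEMeasurable (X t) volume
  integral_eq : ∀ᵐ x : Rd d, IntervalIntegrable (fun s => b s (X s x)) volume 0 T ∧
    ∀ t ∈ Icc 0 T, X t x = x + ∫ s in (0 : ℝ)..t, b s (X s x)
  compress : ∃ L : ℝ≥0, ∀ t ∈ Ioo 0 T, ∀ A : Set (Rd d), IsOpen A →
    volume (X t ⁻¹' A) ≤ L * volume A

/-- `bε` (a family indexed by `ε ∈ (0,1]`) is an approximating sequence for `b` with
constants `C₀, C₁, C₂, C₃, α, β`. Each `bε ε t` has an essentially bounded gradient, and is taken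
to be its continuous representative in space, as the numerical scheme evaluates it at points. -/
def IsApproximatingSequence {d : ℕ} (T : ℝ) (b : ℝ → Rd d → Rd d)
    (C₀ C₁ C₂ C₃ α β : ℝ) (bε : ℝ → ℝ → Rd d → Rd d) : Prop :=
  ∀ ε ∈ Ioc (0 : ℝ) 1,
    AEStronglyMeasurable (Function.uncurry (bε ε)) (slab d T) ∧
    (∀ᵐ t ∂volume.restrict (Ioo 0 T), Continuous (bε ε t)) ∧
    normL1Lp T 1 (fun t x => bε ε t x - b t x) ≤ ENNReal.ofReal (C₀ * ε ^ α) ∧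
    normLinf T (bε ε) ≤ ENNReal.ofReal C₃ ∧
    ∃ G : ℝ → Rd d → Rd d →L[ℝ] Rd d,
      AEStronglyMeasurable (Function.uncurry G) (slab d T) ∧
      (∀ᵐ t ∂volume.restrict (Ioo 0 T), HasWeakGradient (bε ε t) (G t)) ∧
      normLinf T G ≤ ENNReal.ofReal (C₁ / ε ^ β) ∧
      normLinf T (divOfGrad G) ≤ ENNReal.ofReal C₂

/-- The maps `Y 0, …, Y N` solve the `θ`-method for the field `c` on `[0,T]`, with time step
`h = T / N`, nodes `t_i = i h`, and with the field averaged in time over each step. -/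
structure IsThetaScheme {d : ℕ} (T : ℝ) (N : ℕ) (θ : ℝ) (c : ℝ → Rd d → Rd d)
    (Y : ℕ → Rd d → Rd d) : Prop where
  init : ∀ x, Y 0 x = x
  step : ∀ i < N, ∀ x,
    (T / N)⁻¹ • (Y (i + 1) x - Y i x) =
      (1 - θ) • (⨍ s in (i * (T / N))..((i + 1) * (T / N)), c s (Y i x)) +
        θ • (⨍ s in (i * (T / N))..((i + 1) * (T / N)), c s (Y (i + 1) x))

/-- The piecewise affine interpolation in time of `Y 0, …, Y N` at the nodes `t_i = i T / N`,
on `[t_i, t_{i+1})`, extended by continuity with the value `Y N` at the final time `T`. -/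
noncomputable def interpolant {d : ℕ} (T : ℝ) (N : ℕ) (Y : ℕ → Rd d → Rd d)
    (t : ℝ) (x : Rd d) : Rd d :=
  if t = T then Y N x else
    ∑ i ∈ Finset.range N, (Ico (i * (T / N)) ((i + 1) * (T / N))).indicator
      (fun s : ℝ => Y i x + ((s - i * (T / N)) / (T / N)) • (Y (i + 1) x - Y i x)) t

/-- The functional `Q(t) = ∫_{B_r} log(1 + |Z(t,x) - X(t,x)| / δ) dx`. -/
noncomputable def logFunctional {d : ℕ} (δ r : ℝ) (Z X : ℝ → Rd d → Rd d) (t : ℝ) : ℝ :=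
  ∫ x in Metric.ball (0 : Rd d) r, Real.log (1 + ‖Z t x - X t x‖ / δ)

end ThetaFlow

/-! The argument follows Crippa and De Lellis: the logarithm of the distance between two flows grows
at a rate controlled by the maximal function of `∇b`, and this rate is integrable as soon as both
flows compress volumes by a bounded factor.

The piecewise affine interpolant is not compared with `X` directly. Since each step averages the
field in time, the curve `stepFlow`, whose velocity at time `s` is `(1 - θ) b_ε(s, Y_i) + θ b_ε(s,
Y_{i+1})`, passes through the same nodes (`stepFlow_node`) and stays within `C₃ h` of the
interpolant. Its velocity and that of `X` use fields at the same time, so no regularity of `b` in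
time is needed. By `ofReal_log_le_lintegral` the logarithm is at most the time integral of the
velocity difference divided by `δ` plus the distance. This difference splits into `(b_ε - b)(Y_i)`,
which gives `C₀ h^(α/(2β)) / δ` after a change of variables, and `b(Y_i) - b(X)`, which
`HasWeakGradient.exists_enorm_sub_le_maximal` bounds by `|Y_i - X|` times maximal functions. As
`|Y_i - X| ≤ |W - X| + C₃ h` with `W` the step flow, the quotient costs only `1 + C₃ h / δ`. The
maximal functions composed with `Y_i` and `X` are integrated by `setLIntegral_maximal_comp_le`. The
outcome is `lintegral_log_stepFlow_le`.

The scheme compresses volumes boundedly because of the choice of `ε`: the Lipschitz constant of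
`b_ε` is `C₁ h^(-1/2)`, so `det (1 + s ∇b_ε) = 1 + s div b_ε + O(s² |∇b_ε|²)` is `1 + O(h)` for `s ≤
h`, and at most `T / h` steps multiply to a bounded factor (`volume_preimage_step_le`,
`IsThetaScheme.map_le`).

The constant must not see the compression constant `L` of `X`. For this the estimate is used twice.
With the given `L`, applied to explicit Euler schemes with `δ` a power of `h`, it shows that these
converge to `X` locally in measure, so `X` inherits the compression bound of the schemes
(`IsRegularLagrangianFlow.map_le`). The second application uses that bound in place of `L`. -/

namespace ThetaFlow

open Metric

variable {d : ℕ}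

/-! ### Maximal function: weak type estimates and composition with compressing maps -/

/-- The volume of the unit ball of `ℝ^d`. -/
noncomputable def unitBallVol (d : ℕ) : ℝ≥0∞ := volume (ball (0 : Rd d) 1)

lemma unitBallVol_ne_top : unitBallVol d ≠ ⊤ := measure_ball_lt_top.ne

lemma volume_ball_eq (x : Rd d) {r : ℝ} (hr : 0 < r) :
    volume (ball x r) = ENNReal.ofReal (r ^ d) * unitBallVol d := by
  rw [Measure.addHaar_ball_of_pos volume x hr, finrank_euclideanSpace_fin, unitBallVol]

/-- The Hardy–Littlewood maximal function over balls of dyadic radius, normalised by the power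
of the radius instead of the volume of the ball. -/
noncomputable def maximal (g : Rd d → ℝ≥0∞) (x : Rd d) : ℝ≥0∞ :=
  ⨆ k : ℤ, (∫⁻ y in ball x ((2 : ℝ) ^ k), g y) / ENNReal.ofReal (((2 : ℝ) ^ k) ^ d)

lemma measurable_setLIntegral_ball {g : Rd d → ℝ≥0∞} (hg : Measurable g) (r : ℝ) :
    Measurable fun x : Rd d => ∫⁻ y in ball x r, g y := by
  have h : ∀ x : Rd d, ∫⁻ y in ball x r, g y =
      ∫⁻ y, ({z : Rd d × Rd d | dist z.2 z.1 < r}.indicator (fun z => g z.2)) (x, y) := by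
    intro x
    rw [← lintegral_indicator measurableSet_ball]
    rfl
  simp_rw [h]
  have hm : Measurable
      ({z : Rd d × Rd d | dist z.2 z.1 < r}.indicator (fun z => g z.2)) :=
    (hg.comp measurable_snd).indicator
      (measurableSet_lt (measurable_snd.dist measurable_fst) measurable_const)
  exact hm.lintegral_prod_right'

lemma measurable_maximal {g : Rd d → ℝ≥0∞} (hg : Measurable g) : Measurable (maximal g) :=
  Measurable.iSup fun _ => (measurable_setLIntegral_ball hg _).div_const _

lemma ofReal_two_zpow_pow_pos (k : ℤ) : ENNReal.ofReal (((2 : ℝ) ^ k) ^ d) ≠ 0 := by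
  have : (0 : ℝ) < ((2 : ℝ) ^ k) ^ d := by positivity
  simpa using this

/-- Dyadic radii keep the supremum countable, hence measurable; passing from an arbitrary radius to
the next dyadic one costs the factor `2 ^ d`. -/
lemma setLIntegral_ball_le (g : Rd d → ℝ≥0∞) (x : Rd d) {r : ℝ} (hr : 0 < r) :
    ∫⁻ y in ball x r, g y ≤ ENNReal.ofReal ((2 * r) ^ d) * maximal g x := by
  obtain ⟨k, hk1, hk2⟩ := exists_mem_Ioc_zpow (y := (2 : ℝ)) hr one_lt_two
  have h2 : ((2 : ℝ) ^ (k + 1)) ≤ 2 * r := by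
    rw [zpow_add_one₀ two_ne_zero]; linarith
  calc ∫⁻ y in ball x r, g y ≤ ∫⁻ y in ball x ((2 : ℝ) ^ (k + 1)), g y :=
        lintegral_mono_set (ball_subset_ball hk2)
    _ ≤ maximal g x * ENNReal.ofReal (((2 : ℝ) ^ (k + 1)) ^ d) := by
        rw [← ENNReal.div_le_iff (ofReal_two_zpow_pow_pos _) ENNReal.ofReal_ne_top]
        exact le_iSup (fun k : ℤ =>
          (∫⁻ y in ball x ((2 : ℝ) ^ k), g y) / ENNReal.ofReal (((2 : ℝ) ^ k) ^ d)) (k + 1)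
    _ ≤ ENNReal.ofReal ((2 * r) ^ d) * maximal g x := by
        rw [mul_comm]
        gcongr

/-- The weak type `(1,1)` estimate for the maximal function. -/
lemma mul_volume_lt_maximal_le (hd : 0 < d) (g : Rd d → ℝ≥0∞) {l : ℝ≥0∞} (hl : l ≠ 0)
    (hl' : l ≠ ⊤) :
    l * volume {x | l < maximal g x} ≤ 5 ^ d * unitBallVol d * ∫⁻ y, g y := by
  by_cases hI : ∫⁻ y, g y = ⊤
  · have : (5 ^ d * unitBallVol d : ℝ≥0∞) ≠ 0 := by
      have := (measure_ball_pos (volume : Measure (Rd d)) 0 one_pos).ne'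
      simp [unitBallVol, this]
    rw [hI, ENNReal.mul_top this]
    exact le_top
  have hk : ∀ x : Rd d, l < maximal g x → ∃ k : ℤ,
      l * ENNReal.ofReal (((2 : ℝ) ^ k) ^ d) < ∫⁻ y in ball x ((2 : ℝ) ^ k), g y := by
    intro x hx
    obtain ⟨k, hk⟩ := lt_iSup_iff.1 hx
    refine ⟨k, ?_⟩
    rwa [ENNReal.lt_div_iff_mul_lt (Or.inl (ofReal_two_zpow_pow_pos _))
      (Or.inl ENNReal.ofReal_ne_top)] at hk
  choose! k hk using hk
  set t : Set (Rd d) := {x | l < maximal g x} with ht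
  -- Vitali's covering lemma needs bounded radii. A radius `ρ` selected at height `l` has `ρ ^ d <
  -- (∫ g) / l`, and `ρ ≤ ρ ^ d` when `ρ > 1` because `d > 0`.
  have hbound : ∀ x ∈ t, (2 : ℝ) ^ k x ≤ max 1 ((∫⁻ y, g y) / l).toReal := by
    intro x hx
    by_contra! hlt
    obtain ⟨h1, h2⟩ := max_lt_iff.1 hlt
    have h3 : ((2 : ℝ) ^ k x) ≤ ((2 : ℝ) ^ k x) ^ d := le_self_pow₀ h1.le hd.ne'
    have h4 : ENNReal.ofReal (((2 : ℝ) ^ k x) ^ d) < (∫⁻ y, g y) / l := by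
      rw [ENNReal.lt_div_iff_mul_lt (Or.inl hl) (Or.inl hl'), mul_comm]
      exact (hk x hx).trans_le (setLIntegral_le_lintegral _ _)
    have h5 := (ENNReal.ofReal_lt_iff_lt_toReal (by positivity)
      (ENNReal.div_ne_top hI hl)).1 h4
    linarith
  obtain ⟨u, hut, hdisj, hcov⟩ := Vitali.exists_disjoint_subfamily_covering_enlargement_ball t
    (fun x => x) (fun x => (2 : ℝ) ^ k x) _ hbound 5 (by norm_num)
  have hu : u.Countable := hdisj.countable_of_isOpen (fun _ _ => isOpen_ball)
    (fun a _ => nonempty_ball.2 (by positivity))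
  have hsub : t ⊆ ⋃ b ∈ u, ball b (5 * (2 : ℝ) ^ k b) := by
    intro x hx
    obtain ⟨b, hb, hxb⟩ := hcov x hx
    exact mem_biUnion hb (hxb (mem_ball_self (by positivity)))
  have := hu.to_subtype
  calc l * volume t ≤ l * ∑' b : u, volume (ball (b : Rd d) (5 * (2 : ℝ) ^ k b)) := by
        gcongr
        exact (measure_mono hsub).trans (measure_biUnion_le _ hu _)
    _ = ∑' b : u, 5 ^ d * unitBallVol d * (l * ENNReal.ofReal (((2 : ℝ) ^ k b) ^ d)) := by
        rw [← ENNReal.tsum_mul_left]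
        congr 1 with b
        rw [volume_ball_eq _ (by positivity), mul_pow, ENNReal.ofReal_mul (by positivity),
          ENNReal.ofReal_pow (by norm_num : (0 : ℝ) ≤ 5), ENNReal.ofReal_ofNat]
        ring
    _ ≤ ∑' b : u, 5 ^ d * unitBallVol d * ∫⁻ y in ball (b : Rd d) ((2 : ℝ) ^ k b), g y := by
        gcongr with b
        exact (hk b (hut b.2)).le
    _ = 5 ^ d * unitBallVol d * ∫⁻ y in ⋃ b ∈ u, ball b ((2 : ℝ) ^ k b), g y := by
        rw [ENNReal.tsum_mul_left,
          lintegral_biUnion hu (fun _ _ => measurableSet_ball) hdisj]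
    _ ≤ _ := by
        gcongr
        exact Measure.restrict_le_self

lemma maximal_mono {f g : Rd d → ℝ≥0∞} (h : ∀ x, f x ≤ g x) (x : Rd d) :
    maximal f x ≤ maximal g x :=
  iSup_mono fun _ => ENNReal.div_le_div_right (lintegral_mono fun y => h y) _

lemma maximal_const_add_mul_le (f : Rd d → ℝ≥0∞) (c : ℝ≥0∞) {a : ℝ≥0∞} (ha : a ≠ ⊤)
    (x : Rd d) : maximal (fun y => c + a * f y) x ≤ unitBallVol d * c + a * maximal f x := by
  refine iSup_le fun k => ?_
  rw [lintegral_add_left measurable_const, lintegral_const_mul' _ _ ha, setLIntegral_const,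
    volume_ball_eq _ (by positivity), ENNReal.add_div]
  gcongr
  · rw [mul_comm, mul_assoc, mul_div_assoc, ENNReal.mul_div_cancel (ofReal_two_zpow_pow_pos _)
      ENNReal.ofReal_ne_top]
  · rw [mul_div_assoc]
    gcongr
    exact le_iSup (fun k : ℤ =>
          (∫⁻ y in ball x ((2 : ℝ) ^ k), f y) / ENNReal.ofReal (((2 : ℝ) ^ k) ^ d)) k

/-- For `a ≥ l` the factor `a ^ (1 - p)` is at most `l ^ (1 - p)`. Averaged over balls, this deduces
the weak `(p,p)` estimate from the weak `(1,1)` estimate for `g ^ p`. -/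
lemma le_add_rpow_mul_rpow {p : ℝ} (hp : 1 ≤ p) {l : ℝ≥0∞} (hl : l ≠ 0) (hl' : l ≠ ⊤)
    (a : ℝ≥0∞) : a ≤ l + l ^ (1 - p) * a ^ p := by
  rcases le_total a l with h | h
  · exact h.trans le_self_add
  · refine le_trans ?_ le_add_self
    by_cases ha : a = ⊤
    · rw [ha, ENNReal.top_rpow_of_pos (by linarith), ENNReal.mul_top]
      simp [ENNReal.rpow_eq_zero_iff, hl, hl']
    have ha0 : a ≠ 0 := fun h0 => hl (le_antisymm (h0 ▸ h) zero_le)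
    calc a = l ^ (1 - p) * l ^ (p - 1) * a := by
          rw [← ENNReal.rpow_add _ _ hl hl']; simp
      _ ≤ l ^ (1 - p) * a ^ (p - 1) * a := by
          gcongr
      _ = l ^ (1 - p) * a ^ p := by
          rw [mul_assoc]
          nth_rewrite 2 [← ENNReal.rpow_one a]
          rw [← ENNReal.rpow_add _ _ ha0 ha]; simp

/-- A weak type `(p,p)` estimate for the maximal function. -/
lemma rpow_mul_volume_lt_maximal_le (hd : 0 < d) (g : Rd d → ℝ≥0∞) {p : ℝ} (hp : 1 ≤ p)
    {l : ℝ≥0∞} (hl : l ≠ 0) (hl' : l ≠ ⊤) :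
    l ^ p * volume {x | (unitBallVol d + 1) * l < maximal g x} ≤
      5 ^ d * unitBallVol d * ∫⁻ y, g y ^ p := by
  have h0 : l ^ p ≠ 0 := by simp [ENNReal.rpow_eq_zero_iff, hl, hl']
  have h1 : l ^ p ≠ ⊤ := ENNReal.rpow_ne_top_of_nonneg (by linarith) hl'
  have h2 : l ^ (1 - p) ≠ ⊤ := by simp [ENNReal.rpow_eq_top_iff, hl, hl']
  refine le_trans ?_ (mul_volume_lt_maximal_le hd (fun y => g y ^ p) h0 h1)
  refine mul_le_mul_right (measure_mono fun x hx => ?_) _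
  have hx' : (unitBallVol d + 1) * l < maximal g x := hx
  by_contra hn
  have hn' : maximal (fun y => g y ^ p) x ≤ l ^ p := not_lt.1 hn
  -- Where the maximal function of `g ^ p` is at most `l ^ p`, the two terms are at most
  -- `unitBallVol d * l` and `l`; hence the threshold `(unitBallVol d + 1) * l`.
  have h3 : maximal g x ≤ unitBallVol d * l + l ^ (1 - p) * maximal (fun y => g y ^ p) x :=
    (maximal_mono (fun y => le_add_rpow_mul_rpow hp hl hl' (g y)) x).trans
      (maximal_const_add_mul_le _ _ h2 x)
  have h4 : l ^ (1 - p) * maximal (fun y => g y ^ p) x ≤ l := by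
    calc _ ≤ l ^ (1 - p) * l ^ p := by gcongr
      _ = l := by rw [← ENNReal.rpow_add _ _ hl hl']; simp
  refine absurd hx' (not_lt.2 (h3.trans ?_))
  rw [add_mul, one_mul]
  gcongr

/-- A dyadic layer-cake inequality. If `m` is the first level with `b ≤ a * 2 ^ m`, then `a * 2 ^ m`
telescopes into `a` plus the lower levels; if there is none, the series diverges. -/
lemma le_add_tsum_levels (a : ℝ≥0∞) (ha : a ≠ 0) (b : ℝ≥0∞) :
    b ≤ a + ∑' k : ℕ, (if a * 2 ^ k < b then a * 2 ^ k else 0) := by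
  by_cases hall : ∀ k : ℕ, a * 2 ^ k < b
  · have : ∑' k : ℕ, (if a * 2 ^ k < b then a * 2 ^ k else 0) = ⊤ := by
      refine top_le_iff.1 ?_
      calc (⊤ : ℝ≥0∞) = ∑' _ : ℕ, a := (ENNReal.tsum_const_eq_top_of_ne_zero ha).symm
        _ ≤ _ := by
          refine ENNReal.tsum_le_tsum fun k => ?_
          rw [if_pos (hall k)]
          exact le_mul_of_one_le_right zero_le (one_le_pow₀ one_le_two)
    simp [this]
  · push Not at hall
    classical
    let m := Nat.find hall
    have hm : b ≤ a * 2 ^ m := Nat.find_spec hall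
    have hlt : ∀ k < m, a * 2 ^ k < b := fun k hk => not_le.1 (Nat.find_min hall hk)
    calc b ≤ a * 2 ^ m := hm
      _ = a + ∑ k ∈ Finset.range m, a * 2 ^ k := by
          clear_value m
          clear hm hlt
          induction m with
          | zero => simp
          | succ n ih => rw [Finset.sum_range_succ, ← add_assoc, ← ih]; ring
      _ = a + ∑ k ∈ Finset.range m, (if a * 2 ^ k < b then a * 2 ^ k else 0) := by
          congr 1
          exact Finset.sum_congr rfl fun k hk => (if_pos (hlt k (Finset.mem_range.1 hk))).symm
      _ ≤ _ := by
          gcongr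
          exact ENNReal.sum_le_tsum _

/-- The constant in the `L^1` bound for the maximal function along a map of compression `L`, on
a set of volume `v`. -/
noncomputable def maximalConst (d : ℕ) (p : ℝ) (L v : ℝ≥0∞) : ℝ≥0∞ :=
  (unitBallVol d + 1) *
    (v + 1 + L * (5 ^ d * unitBallVol d) * ∑' k : ℕ, ((2 : ℝ≥0∞) ^ (1 - p)) ^ k)

lemma maximalConst_ne_top {p : ℝ} (hp : 1 < p) {L v : ℝ≥0∞} (hL : L ≠ ⊤) (hv : v ≠ ⊤) :
    maximalConst d p L v ≠ ⊤ := by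
  have h1 : (2 : ℝ≥0∞) ^ (1 - p) < 1 :=
    ENNReal.rpow_lt_one_of_one_lt_of_neg ENNReal.one_lt_two (by linarith)
  have h2 : ∑' k : ℕ, ((2 : ℝ≥0∞) ^ (1 - p)) ^ k ≠ ⊤ := by
    rw [ENNReal.tsum_geometric]
    exact ENNReal.inv_ne_top.2 (tsub_pos_of_lt h1).ne'
  have h3 := unitBallVol_ne_top (d := d)
  unfold maximalConst
  finiteness

lemma maximal_eq_zero {g : Rd d → ℝ≥0∞} (hg : g =ᵐ[volume] 0) (x : Rd d) :
    maximal g x = 0 := by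
  refine le_antisymm (iSup_le fun k => ?_) zero_le
  rw [lintegral_congr_ae (ae_restrict_of_ae hg)]
  simp

/-- The maximal function of an `L^p` function, composed with a map which compresses volumes by at
most `L`, is integrable on sets of finite volume. -/
lemma setLIntegral_maximal_comp_le (hd : 0 < d) {g : Rd d → ℝ≥0∞} (hg : Measurable g) {p : ℝ}
    (hp : 1 < p) {Φ : Rd d → Rd d} (hΦ : AEMeasurable Φ) {L : ℝ≥0∞}
    (hL : Measure.map Φ volume ≤ L • volume) (s : Set (Rd d)) :
    ∫⁻ x in s, maximal g (Φ x) ≤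
      maximalConst d p L (volume s) * (∫⁻ y, g y ^ p) ^ (1 / p) := by
  have hp0 : 0 < p := by linarith
  set A : ℝ≥0∞ := (∫⁻ y, g y ^ p) ^ (1 / p) with hA
  have hAp : ∫⁻ y, g y ^ p = A ^ p := by
    rw [hA, ← ENNReal.rpow_mul, one_div_mul_cancel hp0.ne', ENNReal.rpow_one]
  set w := unitBallVol d
  by_cases hA0 : A = 0
  · have : g =ᵐ[volume] 0 := by
      rw [hA0, ENNReal.zero_rpow_of_pos hp0, lintegral_eq_zero_iff (hg.pow_const p)] at hAp
      filter_upwards [hAp] with x hx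
      simpa [hp0, hp0.not_gt] using hx
    simp [maximal_eq_zero this]
  by_cases hAt : A = ⊤
  -- The summand `1` in `maximalConst` keeps the constant nonzero even when `s` is null and `L = 0`.
  · rw [hAt, ENNReal.mul_top]
    · exact le_top
    · simp [maximalConst]
  set a : ℝ≥0∞ := (w + 1) * A with ha
  have ha0 : a ≠ 0 := by simp [ha, hA0]
  have hMm := measurable_maximal hg
  -- At height `A * 2 ^ k` the powers of `A` cancel. The remaining decay `2 ^ (-k p)` beats the
  -- height `2 ^ k` since `p > 1`, so on a set of finite volume the weak estimate suffices for
  -- integrability.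
  have hlevel : ∀ k : ℕ, volume {x | a * 2 ^ k < maximal g (Φ x)} ≤
      L * (5 ^ d * w) * (2 ^ k) ^ (-p) := by
    intro k
    have h2k : (2 : ℝ≥0∞) ^ k ≠ ⊤ := by finiteness
    have h2k0 : (2 : ℝ≥0∞) ^ k ≠ 0 := by positivity
    have hl0 : A * 2 ^ k ≠ 0 := mul_ne_zero hA0 h2k0
    have hlt : A * 2 ^ k ≠ ⊤ := ENNReal.mul_ne_top hAt h2k
    have h1 := rpow_mul_volume_lt_maximal_le hd g hp.le hl0 hlt
    rw [hAp, ENNReal.mul_rpow_of_nonneg _ _ hp0.le, mul_assoc,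
      mul_comm _ (A ^ p), ENNReal.mul_le_mul_iff_right (by simp [hA0, hAt, hp0.not_gt])
        (ENNReal.rpow_ne_top_of_nonneg hp0.le hAt)] at h1
    have h2 : volume {x | a * 2 ^ k < maximal g (Φ x)} ≤
        L * volume {y | a * 2 ^ k < maximal g y} := by
      have hms : MeasurableSet {y | a * 2 ^ k < maximal g y} :=
        measurableSet_lt measurable_const hMm
      calc _ = Measure.map Φ volume {y | a * 2 ^ k < maximal g y} :=
            (Measure.map_apply_of_aemeasurable hΦ hms).symm
        _ ≤ _ := hL _
    refine h2.trans ?_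
    rw [mul_assoc L]
    gcongr
    rw [ha, mul_assoc (w + 1), ENNReal.rpow_neg, ← div_eq_mul_inv, ENNReal.le_div_iff_mul_le]
    · rwa [mul_comm]
    · left; simp [ENNReal.rpow_eq_zero_iff, h2k0, h2k]
    · left; exact ENNReal.rpow_ne_top_of_nonneg hp0.le h2k
  have hmeas : ∀ k : ℕ, NullMeasurableSet {x | a * 2 ^ k < maximal g (Φ x)} volume :=
    fun k => nullMeasurableSet_lt aemeasurable_const (hMm.comp_aemeasurable hΦ)
  have hind : ∀ k : ℕ, ∀ x, (if a * 2 ^ k < maximal g (Φ x) then a * 2 ^ k else 0) =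
      {x | a * 2 ^ k < maximal g (Φ x)}.indicator (fun _ => a * 2 ^ k) x := fun k x => by
    simp [indicator_apply]
  calc ∫⁻ x in s, maximal g (Φ x)
      ≤ ∫⁻ x in s, (a + ∑' k : ℕ, {x | a * 2 ^ k < maximal g (Φ x)}.indicator
          (fun _ => a * 2 ^ k) x) := by
        refine lintegral_mono fun x => ?_
        simp_rw [← hind]
        exact le_add_tsum_levels a ha0 _
    _ = a * volume s + ∑' k : ℕ, ∫⁻ x in s, {x | a * 2 ^ k < maximal g (Φ x)}.indicator
          (fun _ => a * 2 ^ k) x := by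
        rw [lintegral_add_left measurable_const, setLIntegral_const, lintegral_tsum]
        exact fun k => (aemeasurable_const.indicator₀ (hmeas k)).restrict
    _ ≤ a * volume s + ∑' k : ℕ, a * (L * (5 ^ d * w)) * ((2 : ℝ≥0∞) ^ (1 - p)) ^ k := by
        gcongr with k
        calc _ ≤ ∫⁻ x, {x | a * 2 ^ k < maximal g (Φ x)}.indicator (fun _ => a * 2 ^ k) x :=
              setLIntegral_le_lintegral _ _
          _ = a * 2 ^ k * volume {x | a * 2 ^ k < maximal g (Φ x)} := by
              rw [lintegral_indicator_const₀ (hmeas k)]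
          _ ≤ a * 2 ^ k * (L * (5 ^ d * w) * (2 ^ k) ^ (-p)) := by
              gcongr; exact hlevel k
          _ = a * (L * (5 ^ d * w)) * (2 ^ k * (2 ^ k) ^ (-p)) := by ring
          _ = _ := by
              congr 1
              have h2 : (2 : ℝ≥0∞) ^ k ≠ ⊤ := by finiteness
              have h20 : (2 : ℝ≥0∞) ^ k ≠ 0 := by positivity
              nth_rewrite 1 [← ENNReal.rpow_one ((2 : ℝ≥0∞) ^ k)]
              rw [← ENNReal.rpow_add _ _ h20 h2, ← ENNReal.rpow_natCast, ← ENNReal.rpow_natCast,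
                ← ENNReal.rpow_mul, ← ENNReal.rpow_mul]
              ring_nf
    _ ≤ _ := by
        rw [ENNReal.tsum_mul_left, maximalConst, ha]
        calc _ = (w + 1) * (volume s + 0 + L * (5 ^ d * w) *
              ∑' k : ℕ, ((2 : ℝ≥0∞) ^ (1 - p)) ^ k) * A := by ring
          _ ≤ _ := by gcongr; exact zero_le

end ThetaFlow

namespace ThetaFlow

open Metric

variable {d : ℕ}

/-! ### Pointwise estimates for continuously differentiable fields -/

lemma lintegral_ball_comp_contraction (f : Rd d → ℝ≥0∞) (hf : Measurable f) (x : Rd d) {s R : ℝ}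
    (hs : 0 < s) :
    ∫⁻ z in ball x R, f (x + s • (z - x)) =
      ENNReal.ofReal ((s ^ d)⁻¹) * ∫⁻ z in ball x (s * R), f z := by
  set h : Rd d → ℝ≥0∞ := (ball (0 : Rd d) (s * R)).indicator fun v => f (x + v) with hh
  have hhm : Measurable h := (hf.comp (measurable_const_add x)).indicator measurableSet_ball
  have h1 : ∫⁻ z in ball x R, f (x + s • (z - x)) = ∫⁻ w, h (s • w) := by
    rw [← lintegral_indicator measurableSet_ball, ← lintegral_add_left_eq_self _ x]
    refine lintegral_congr fun w => ?_
    have : (x + w ∈ ball x R) ↔ (s • w ∈ ball (0 : Rd d) (s * R)) := by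
      simp [norm_smul, abs_of_pos hs, hs]
    by_cases hw : x + w ∈ ball x R
    · rw [indicator_of_mem hw, hh, indicator_of_mem (this.1 hw), add_sub_cancel_left]
    · rw [indicator_of_notMem hw, hh, indicator_of_notMem (fun h => hw (this.2 h))]
  have h2 : ∫⁻ z in ball x (s * R), f z = ∫⁻ w, h w := by
    rw [← lintegral_indicator measurableSet_ball, ← lintegral_add_left_eq_self _ x]
    refine lintegral_congr fun w => ?_
    have : (x + w ∈ ball x (s * R)) ↔ (w ∈ ball (0 : Rd d) (s * R)) := by simp
    by_cases hw : x + w ∈ ball x (s * R)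
    · rw [indicator_of_mem hw, hh, indicator_of_mem (this.1 hw)]
    · rw [indicator_of_notMem hw, hh, indicator_of_notMem (fun h => hw (this.2 h))]
  rw [h1, h2, ← lintegral_map hhm (measurable_const_smul s), Measure.map_addHaar_smul _ hs.ne',
    lintegral_smul_measure, finrank_euclideanSpace_fin, abs_of_pos (by positivity), smul_eq_mul]

lemma enorm_sub_le_lintegral_fderiv {u : Rd d → Rd d} (hu : ContDiff ℝ 1 u) (x z : Rd d) :
    ‖u z - u x‖ₑ ≤ ∫⁻ s in Ioo (0 : ℝ) 1, ‖fderiv ℝ u (x + s • (z - x))‖ₑ * ‖z - x‖ₑ := by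
  have hc : Continuous (fderiv ℝ u) := hu.continuous_fderiv one_ne_zero
  have hd : ∀ s : ℝ, HasDerivAt (fun s : ℝ => u (x + s • (z - x)))
      (fderiv ℝ u (x + s • (z - x)) (z - x)) s := by
    intro s
    have h1 : HasDerivAt (fun s : ℝ => x + s • (z - x)) (z - x) s := by
      simpa using ((hasDerivAt_id s).smul_const (z - x)).const_add x
    exact ((hu.differentiable one_ne_zero) _).hasFDerivAt.comp_hasDerivAt s h1
  have hint := intervalIntegral.integral_eq_sub_of_hasDerivAt (a := 0) (b := 1)
    (fun s _ => hd s) (Continuous.intervalIntegrable (by fun_prop) _ _)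
  simp only [one_smul, zero_smul, add_zero, add_sub_cancel] at hint
  rw [← hint, intervalIntegral.integral_of_le zero_le_one, integral_Ioc_eq_integral_Ioo]
  refine (enorm_integral_le_lintegral_enorm _).trans (lintegral_mono fun s => ?_)
  exact ContinuousLinearMap.le_opENorm _ _

/-- Integrate the gradient along the segment from `x` to `z` and exchange integrals. The contraction
by `s` has Jacobian factor `s ^ (-d)`, which cancels the `s ^ d` in the bound for the ball of radius
`s * R`, so the integrand in `s` is bounded by a constant. -/
lemma setLIntegral_ball_enorm_sub_le {u : Rd d → Rd d} (hu : ContDiff ℝ 1 u) (x : Rd d) {R : ℝ}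
    (hR : 0 < R) :
    ∫⁻ z in ball x R, ‖u z - u x‖ₑ ≤
      ENNReal.ofReal (R * (2 * R) ^ d) * maximal (fun y => ‖fderiv ℝ u y‖ₑ) x := by
  have hc : Continuous (fderiv ℝ u) := hu.continuous_fderiv one_ne_zero
  set g : Rd d → ℝ≥0∞ := fun y => ‖fderiv ℝ u y‖ₑ with hg
  have hgm : Measurable g := hc.enorm.measurable
  calc ∫⁻ z in ball x R, ‖u z - u x‖ₑ
      ≤ ∫⁻ z in ball x R, ∫⁻ s in Ioo (0 : ℝ) 1, g (x + s • (z - x)) * ENNReal.ofReal R := by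
        refine setLIntegral_mono' measurableSet_ball fun z hz => ?_
        refine (enorm_sub_le_lintegral_fderiv hu x z).trans (lintegral_mono fun s => ?_)
        have : ‖z - x‖ₑ ≤ ENNReal.ofReal R := by
          rw [← ofReal_norm]
          exact ENNReal.ofReal_le_ofReal (by simpa [dist_eq_norm] using hz.le)
        dsimp only
        gcongr
    _ = ∫⁻ s in Ioo (0 : ℝ) 1, ∫⁻ z in ball x R, g (x + s • (z - x)) * ENNReal.ofReal R := by
        refine lintegral_lintegral_swap (Measurable.aemeasurable ?_)
        refine Measurable.mul_const (hgm.comp ?_) _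
        fun_prop
    _ ≤ ∫⁻ _ in Ioo (0 : ℝ) 1, ENNReal.ofReal (R * (2 * R) ^ d) * maximal g x := by
        refine setLIntegral_mono' measurableSet_Ioo fun s hs => ?_
        rw [lintegral_mul_const' _ _ ENNReal.ofReal_ne_top,
          lintegral_ball_comp_contraction g hgm x hs.1]
        calc _ ≤ ENNReal.ofReal ((s ^ d)⁻¹) * (ENNReal.ofReal ((2 * (s * R)) ^ d) * maximal g x) *
              ENNReal.ofReal R := by
              gcongr
              exact setLIntegral_ball_le g x (mul_pos hs.1 hR)
          _ = ENNReal.ofReal ((s ^ d)⁻¹ * (2 * (s * R)) ^ d * R) * maximal g x := by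
              have := hs.1
              rw [ENNReal.ofReal_mul (by positivity), ENNReal.ofReal_mul (by positivity)]
              ring
          _ = _ := by
              have : s ^ d ≠ 0 := (pow_pos hs.1 d).ne'
              congr 2
              rw [show 2 * (s * R) = s * (2 * R) by ring, mul_pow s, inv_mul_cancel_left₀ this]
              ring
    _ = _ := by simp

/-- Average `|u x - u y| ≤ |u z - u x| + |u z - u y|` over `z` in the ball about the midpoint of
radius half the distance; it lies in both balls of radius `|x - y|` about `x` and `y`. The ratio of
the radii `2 R` and `R / 2` produces `4 ^ d`. -/
lemma enorm_sub_le_maximal_of_contDiff {u : Rd d → Rd d} (hu : ContDiff ℝ 1 u) (x y : Rd d) :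
    ‖u x - u y‖ₑ ≤ 4 ^ d * (unitBallVol d)⁻¹ * ‖x - y‖ₑ *
      (maximal (fun y => ‖fderiv ℝ u y‖ₑ) x + maximal (fun y => ‖fderiv ℝ u y‖ₑ) y) := by
  rcases eq_or_ne x y with rfl | hxy
  · simp
  set g : Rd d → ℝ≥0∞ := fun y => ‖fderiv ℝ u y‖ₑ with hg
  set R : ℝ := ‖x - y‖ with hRdef
  have hR : 0 < R := norm_sub_pos_iff.2 hxy
  set m : Rd d := midpoint ℝ x y
  have hmx : ball m (R / 2) ⊆ ball x R := by
    refine ball_subset_ball' ?_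
    rw [dist_midpoint_left, dist_eq_norm, ← hRdef]
    norm_num; linarith
  have hmy : ball m (R / 2) ⊆ ball y R := by
    refine ball_subset_ball' ?_
    rw [dist_midpoint_right, dist_eq_norm, ← hRdef]
    norm_num; linarith
  have huc := hu.continuous
  have hw0 : unitBallVol d ≠ 0 := (measure_ball_pos (volume : Measure (Rd d)) 0 one_pos).ne'
  have hvol : volume (ball m (R / 2)) = ENNReal.ofReal ((R / 2) ^ d) * unitBallVol d :=
    volume_ball_eq _ (by positivity)
  have hkey : ‖u x - u y‖ₑ * (ENNReal.ofReal ((R / 2) ^ d) * unitBallVol d) ≤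
      ENNReal.ofReal (R * (2 * R) ^ d) * (maximal g x + maximal g y) := by
    calc _ = ∫⁻ _ in ball m (R / 2), ‖u x - u y‖ₑ := by rw [setLIntegral_const, hvol]
      _ ≤ ∫⁻ z in ball m (R / 2), (‖u z - u x‖ₑ + ‖u z - u y‖ₑ) := by
          refine lintegral_mono fun z => ?_
          have : u x - u y = (u z - u y) - (u z - u x) := by abel
          rw [this, add_comm]
          exact enorm_sub_le
      _ = (∫⁻ z in ball m (R / 2), ‖u z - u x‖ₑ) + ∫⁻ z in ball m (R / 2), ‖u z - u y‖ₑ :=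
          lintegral_add_left
            (huc.sub continuous_const).enorm.measurable _
      _ ≤ (∫⁻ z in ball x R, ‖u z - u x‖ₑ) + ∫⁻ z in ball y R, ‖u z - u y‖ₑ := by
          exact add_le_add (lintegral_mono_set hmx) (lintegral_mono_set hmy)
      _ ≤ _ := by
          rw [mul_add]
          gcongr
          · exact setLIntegral_ball_enorm_sub_le hu x hR
          · exact setLIntegral_ball_enorm_sub_le hu y hR
  have hc0 : ENNReal.ofReal ((R / 2) ^ d) * unitBallVol d ≠ 0 :=
    mul_ne_zero (by have : 0 < (R / 2) ^ d := by positivity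
                    simpa using this) hw0
  have hct : ENNReal.ofReal ((R / 2) ^ d) * unitBallVol d ≠ ⊤ :=
    ENNReal.mul_ne_top ENNReal.ofReal_ne_top unitBallVol_ne_top
  rw [← ENNReal.le_div_iff_mul_le (Or.inl hc0) (Or.inl hct)] at hkey
  refine hkey.trans (le_of_eq ?_)
  have hR4 : R * (2 * R) ^ d = (R / 2) ^ d * (4 ^ d * R) := by
    rw [← mul_assoc, ← mul_pow]; ring_nf
  have hRe : ‖x - y‖ₑ = ENNReal.ofReal R := by rw [hRdef, ofReal_norm]
  have hp0 : ENNReal.ofReal ((R / 2) ^ d) ≠ 0 := left_ne_zero_of_mul hc0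
  rw [hR4, ENNReal.ofReal_mul (by positivity), ENNReal.ofReal_mul (by positivity),
    mul_assoc, ENNReal.mul_div_mul_left _ _ hp0 ENNReal.ofReal_ne_top, hRe,
    ENNReal.ofReal_pow (by norm_num), ENNReal.ofReal_ofNat, div_eq_mul_inv]
  ring

/-! ### Mollification -/

open ContinuousLinearMap in
/-- The convolution of a vector field with a scalar kernel. -/
noncomputable def mollify (ψ : Rd d → ℝ) (u : Rd d → Rd d) : Rd d → Rd d :=
  convolution ψ u (lsmul ℝ ℝ) volume

section mollify

variable {ψ : Rd d → ℝ}

lemma contDiff_mollify (hψc : HasCompactSupport ψ) (hψ : ContDiff ℝ ∞ ψ) {u : Rd d → Rd d}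
    (hu : LocallyIntegrable u volume) : ContDiff ℝ ∞ (mollify ψ u) :=
  hψc.contDiff_convolution_left _ hψ hu

lemma integrable_fderiv_smulRight (hψc : HasCompactSupport ψ) (hψ : ContDiff ℝ ∞ ψ)
    {u : Rd d → Rd d} (hu : LocallyIntegrable u volume) (x : Rd d) :
    Integrable (fun y => (fderiv ℝ ψ (x - y)).smulRight (u y)) := by
  have h := (hψc.fderiv (𝕜 := ℝ)).convolutionExists_left
    ((ContinuousLinearMap.lsmul ℝ ℝ : ℝ →L[ℝ] Rd d →L[ℝ] Rd d).precompL (Rd d))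
    (hψ.continuous_fderiv (by simp)) hu x
  have h' := (integrable_comp_sub_left _ x).2 h
  refine h'.congr (Filter.Eventually.of_forall fun y => ?_)
  ext v
  simp

lemma hasFDerivAt_mollify (hψc : HasCompactSupport ψ) (hψ : ContDiff ℝ ∞ ψ)
    {u : Rd d → Rd d} (hu : LocallyIntegrable u volume) (x : Rd d) :
    HasFDerivAt (mollify ψ u) (∫ y, (fderiv ℝ ψ (x - y)).smulRight (u y)) x := by
  have h := hψc.hasFDerivAt_convolution_left
    (ContinuousLinearMap.lsmul ℝ ℝ : ℝ →L[ℝ] Rd d →L[ℝ] Rd d) (hψ.of_le (by simp)) hu x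
  rw [convolution_eq_swap] at h
  refine h.congr_fderiv (integral_congr_ae (Filter.Eventually.of_forall fun y => ?_))
  ext v
  simp

lemma fderiv_mollify_apply (hψc : HasCompactSupport ψ) (hψ : ContDiff ℝ ∞ ψ)
    {u : Rd d → Rd d} (hu : LocallyIntegrable u volume) (x v : Rd d) :
    fderiv ℝ (mollify ψ u) x v = ∫ y, fderiv ℝ ψ (x - y) v • u y := by
  rw [(hasFDerivAt_mollify hψc hψ hu x).fderiv,
    ContinuousLinearMap.integral_apply (integrable_fderiv_smulRight hψc hψ hu x)]
  rfl

lemma contDiff_comp_const_sub (hψ : ContDiff ℝ ∞ ψ) (x : Rd d) :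
    ContDiff ℝ ∞ (fun y => ψ (x - y)) :=
  hψ.comp (contDiff_const.sub contDiff_id)

lemma hasCompactSupport_comp_const_sub (hψc : HasCompactSupport ψ) (x : Rd d) :
    HasCompactSupport (fun y => ψ (x - y)) :=
  hψc.comp_homeomorph (Homeomorph.subLeft x)

lemma fderiv_comp_const_sub (hψ : ContDiff ℝ ∞ ψ) (x y v : Rd d) :
    fderiv ℝ (fun y => ψ (x - y)) y v = - fderiv ℝ ψ (x - y) v := by
  have h1 : HasFDerivAt (fun y : Rd d => x - y) (-ContinuousLinearMap.id ℝ (Rd d)) y :=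
    (hasFDerivAt_id y).const_sub x
  have h2 := ((hψ.differentiable (by simp)) (x - y)).hasFDerivAt.comp y h1
  have h3 := h2.fderiv
  rw [show (fun y => ψ (x - y)) = ψ ∘ (fun y => x - y) from rfl, h3]
  simp

lemma HasWeakGradient.fderiv_mollify_apply {u : Rd d → Rd d} {G : Rd d → Rd d →L[ℝ] Rd d}
    (h : HasWeakGradient u G) (hψc : HasCompactSupport ψ) (hψ : ContDiff ℝ ∞ ψ) (x v : Rd d) :
    fderiv ℝ (mollify ψ u) x v = ∫ y, ψ (x - y) • G y v := by
  rw [ThetaFlow.fderiv_mollify_apply hψc hψ h.locallyIntegrable]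
  have h1 := h.integral_eq _ (contDiff_comp_const_sub hψ x)
    (hasCompactSupport_comp_const_sub hψc x) v
  simp_rw [fderiv_comp_const_sub hψ, neg_smul, integral_neg, neg_inj] at h1
  exact h1

/-- The derivative of the mollified field is the convolution of the kernel with `G`. The majorant
`g` allows both a measurable version of the norm of `G`, for the maximal estimate, and a constant,
for the Lipschitz bound. -/
lemma HasWeakGradient.enorm_fderiv_mollify_le {u : Rd d → Rd d} {G : Rd d → Rd d →L[ℝ] Rd d}
    (h : HasWeakGradient u G) (hψc : HasCompactSupport ψ) (hψ : ContDiff ℝ ∞ ψ)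
    (hψ0 : ∀ x, 0 ≤ ψ x) {g : Rd d → ℝ≥0∞} (hg : ∀ᵐ y, ‖G y‖ₑ ≤ g y) (x : Rd d) :
    ‖fderiv ℝ (mollify ψ u) x‖ₑ ≤ ∫⁻ y, ENNReal.ofReal (ψ (x - y)) * g y := by
  set I := ∫⁻ y, ENNReal.ofReal (ψ (x - y)) * g y with hI
  by_cases hIt : I = ⊤
  · rw [hIt]; exact le_top
  rw [← ofReal_norm, ← ENNReal.ofReal_toReal hIt]
  refine ENNReal.ofReal_le_ofReal (ContinuousLinearMap.opNorm_le_bound _ ENNReal.toReal_nonneg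
    fun v => ?_)
  rw [h.fderiv_mollify_apply hψc hψ, ← ENNReal.ofReal_le_ofReal_iff (by positivity), ofReal_norm,
    ENNReal.ofReal_mul ENNReal.toReal_nonneg, ENNReal.ofReal_toReal hIt, hI, ofReal_norm,
    ← lintegral_mul_const' _ _ (by simp)]
  refine (enorm_integral_le_lintegral_enorm _).trans (lintegral_mono_ae ?_)
  filter_upwards [hg] with y hy
  rw [enorm_smul, Real.enorm_eq_ofReal (hψ0 _), mul_assoc]
  gcongr
  exact (ContinuousLinearMap.le_opENorm _ _).trans (by gcongr)

end mollify

/-! ### Mollifying kernels and the passage from smooth to Sobolev fields -/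

/-- A bump function supported in the closed ball of radius `2 / (n + 1)`. -/
noncomputable def bump (d : ℕ) (n : ℕ) : ContDiffBump (0 : Rd d) :=
  ⟨1 / (n + 1), 2 / (n + 1), by positivity, by gcongr; norm_num⟩

lemma tendsto_bump_rOut : Filter.Tendsto (fun n => (bump d n).rOut) Filter.atTop (nhds 0) := by
  have h := (tendsto_one_div_add_atTop_nhds_zero_nat (𝕜 := ℝ)).const_mul 2
  rw [mul_zero] at h
  refine h.congr fun n => ?_
  simp [bump, div_eq_mul_inv]

lemma bump_rOut_le (n : ℕ) : (bump d n).rOut ≤ 2 * (bump d n).rIn := by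
  simp [bump, div_eq_mul_inv]

/-- The standard mollifying kernels. -/
noncomputable def kernel (d n : ℕ) : Rd d → ℝ := (bump d n).normed volume

lemma kernel_nonneg (n : ℕ) (x : Rd d) : 0 ≤ kernel d n x := (bump d n).nonneg_normed x

lemma hasCompactSupport_kernel (n : ℕ) : HasCompactSupport (kernel d n) :=
  (bump d n).hasCompactSupport_normed

lemma contDiff_kernel (n : ℕ) : ContDiff ℝ ∞ (kernel d n) := (bump d n).contDiff_normed

lemma integral_kernel_sub (n : ℕ) (x : Rd d) : ∫ y, kernel d n (x - y) = 1 := by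
  rw [integral_sub_left_eq_self (kernel d n) volume x]
  exact (bump d n).integral_normed

lemma integrable_kernel (n : ℕ) : Integrable (kernel d n) := (bump d n).integrable_normed

lemma lintegral_kernel (n : ℕ) : ∫⁻ y, ENNReal.ofReal (kernel d n y) = 1 := by
  rw [← ofReal_integral_eq_lintegral_ofReal (integrable_kernel n)
    (Filter.Eventually.of_forall (kernel_nonneg n))]
  have : ∫ y, kernel d n y = 1 := (bump d n).integral_normed
  simp [this]

lemma kernel_eq_zero {n : ℕ} {x : Rd d} (hx : (bump d n).rOut ≤ ‖x‖) : kernel d n x = 0 := by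
  have h := (bump d n).support_normed_eq (μ := volume)
  by_contra hne
  have : x ∈ Function.support ((bump d n).normed volume) := hne
  rw [h, mem_ball_zero_iff] at this
  linarith

lemma ofReal_kernel_mul_le (n : ℕ) (x : Rd d) :
    ENNReal.ofReal (kernel d n x) * (ENNReal.ofReal ((bump d n).rOut ^ d) * unitBallVol d) ≤
      2 ^ d := by
  have h := (bump d n).normed_le_div_measure_closedBall_rOut (μ := volume) 2 (bump_rOut_le n) x
  have hpos := (bump d n).rOut_pos
  have hv : volume (closedBall (0 : Rd d) (bump d n).rOut) =
      ENNReal.ofReal ((bump d n).rOut ^ d) * unitBallVol d := by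
    rw [Measure.addHaar_closedBall _ _ hpos.le, finrank_euclideanSpace_fin, unitBallVol]
  have hv0 : 0 < volume.real (closedBall (0 : Rd d) (bump d n).rOut) :=
    ENNReal.toReal_pos (measure_closedBall_pos _ _ hpos).ne' measure_closedBall_lt_top.ne
  rw [le_div_iff₀ hv0, finrank_euclideanSpace_fin] at h
  rw [← hv, ← ofReal_measureReal measure_closedBall_lt_top.ne,
    ← ENNReal.ofReal_mul (kernel_nonneg n x)]
  refine (ENNReal.ofReal_le_ofReal h).trans (le_of_eq ?_)
  rw [ENNReal.ofReal_pow (by norm_num), ENNReal.ofReal_ofNat]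

/-- Makes the estimate for mollified fields uniform in `n`. For balls of radius `R` at least the
kernel radius `ρ`, Fubini and the unit mass of the kernel leave the integral of `g` over a ball of
radius `2 R`. For smaller balls the kernel is at most `2 ^ d` over the volume of its support ball,
so `f` is pointwise bounded by an average of `g` at scale `2 ρ`; this case gives `2 ^ d * 4 ^ d`. -/
lemma maximal_le_of_le_kernel_convolution {f g : Rd d → ℝ≥0∞} (hg : Measurable g) (n : ℕ)
    (hf : ∀ z, f z ≤ ∫⁻ y, ENNReal.ofReal (kernel d n (z - y)) * g y) (x : Rd d) :
    maximal f x ≤ 8 ^ d * maximal g x := by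
  have hw0 : unitBallVol d ≠ 0 := (measure_ball_pos (volume : Measure (Rd d)) 0 one_pos).ne'
  have hkm : Measurable (kernel d n) := (contDiff_kernel n).continuous.measurable
  set ρ := (bump d n).rOut with hρdef
  have hρ : 0 < ρ := (bump d n).rOut_pos
  refine iSup_le fun k => ?_
  set R : ℝ := (2 : ℝ) ^ k with hRdef
  have hR : 0 < R := by positivity
  refine ENNReal.div_le_of_le_mul ?_
  rcases le_total ρ R with hρR | hρR
  · calc ∫⁻ z in ball x R, f z
        ≤ ∫⁻ z in ball x R, ∫⁻ y, ENNReal.ofReal (kernel d n (z - y)) * g y :=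
          lintegral_mono fun z => hf z
      _ = ∫⁻ y, ∫⁻ z in ball x R, ENNReal.ofReal (kernel d n (z - y)) * g y := by
          refine lintegral_lintegral_swap (Measurable.aemeasurable ?_)
          refine Measurable.mul (hkm.comp (by fun_prop)).ennreal_ofReal (hg.comp measurable_snd)
      _ ≤ ∫⁻ y, (ball x (2 * R)).indicator g y := by
          refine lintegral_mono fun y => ?_
          by_cases hy : y ∈ ball x (2 * R)
          · rw [indicator_of_mem hy]
            have hky : Measurable fun z => ENNReal.ofReal (kernel d n (z - y)) :=
              (hkm.comp (measurable_sub_const y)).ennreal_ofReal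
            calc _ ≤ ∫⁻ z, ENNReal.ofReal (kernel d n (z - y)) * g y :=
                  setLIntegral_le_lintegral _ _
              _ = g y := by
                  rw [lintegral_mul_const _ hky,
                    lintegral_sub_right_eq_self (fun z => ENNReal.ofReal (kernel d n z)) y,
                    lintegral_kernel, one_mul]
          · rw [indicator_of_notMem hy]
            refine le_of_eq (setLIntegral_eq_zero measurableSet_ball fun z hz => ?_)
            have : kernel d n (z - y) = 0 := by
              refine kernel_eq_zero ?_
              have h1 : 2 * R ≤ dist y x := by simpa using hy
              have h2 : dist z x < R := hz
              have h3 := dist_triangle_left y x z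
              rw [← dist_eq_norm]
              linarith
            simp [this]
      _ = ∫⁻ y in ball x (2 * R), g y := lintegral_indicator measurableSet_ball _
      _ ≤ ENNReal.ofReal ((2 * (2 * R)) ^ d) * maximal g x :=
          setLIntegral_ball_le g x (by positivity)
      _ ≤ ENNReal.ofReal ((8 * R) ^ d) * maximal g x := by
          gcongr ENNReal.ofReal (?_ ^ d) * _; linarith
      _ = _ := by
          rw [mul_pow, ENNReal.ofReal_mul (by positivity), ENNReal.ofReal_pow (by norm_num),
            ENNReal.ofReal_ofNat]
          ring
  · have hpt : ∀ z ∈ ball x R, f z * (ENNReal.ofReal (ρ ^ d) * unitBallVol d) ≤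
        2 ^ d * (ENNReal.ofReal ((2 * (2 * ρ)) ^ d) * maximal g x) := by
      intro z hz
      have hct : ENNReal.ofReal (ρ ^ d) * unitBallVol d ≠ ⊤ :=
        ENNReal.mul_ne_top ENNReal.ofReal_ne_top unitBallVol_ne_top
      calc _ ≤ (∫⁻ y, ENNReal.ofReal (kernel d n (z - y)) * g y) *
            (ENNReal.ofReal (ρ ^ d) * unitBallVol d) := by gcongr; exact hf z
        _ = ∫⁻ y, ENNReal.ofReal (kernel d n (z - y)) * g y *
            (ENNReal.ofReal (ρ ^ d) * unitBallVol d) := (lintegral_mul_const' _ _ hct).symm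
        _ ≤ ∫⁻ y, (ball x (2 * ρ)).indicator (fun y => 2 ^ d * g y) y := by
            refine lintegral_mono fun y => ?_
            by_cases hy : y ∈ ball x (2 * ρ)
            · rw [indicator_of_mem hy, mul_right_comm]
              gcongr
              exact ofReal_kernel_mul_le n _
            · have : kernel d n (z - y) = 0 := by
                refine kernel_eq_zero ?_
                have h1 : 2 * ρ ≤ dist y x := by simpa using hy
                have h2 : dist z x < R := hz
                have h3 := dist_triangle_left y x z
                rw [← dist_eq_norm]
                linarith
              simp [this]
        _ = 2 ^ d * ∫⁻ y in ball x (2 * ρ), g y := by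
            rw [lintegral_indicator measurableSet_ball,
              lintegral_const_mul' _ _ (by finiteness)]
        _ ≤ _ := by
            gcongr
            exact setLIntegral_ball_le g x (by positivity)
    have hρ0 : ENNReal.ofReal (ρ ^ d) ≠ 0 := by
      have : 0 < ρ ^ d := by positivity
      simpa using this
    have hpt' : ∀ z ∈ ball x R, f z ≤ 8 ^ d * maximal g x * (unitBallVol d)⁻¹ := by
      intro z hz
      have h1 := hpt z hz
      rw [show 2 * (2 * ρ) = 4 * ρ by ring, mul_pow, ENNReal.ofReal_mul (by positivity),
        ENNReal.ofReal_pow (by norm_num : (0 : ℝ) ≤ 4), ENNReal.ofReal_ofNat,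
        show (2 : ℝ≥0∞) ^ d * (4 ^ d * ENNReal.ofReal (ρ ^ d) * maximal g x) =
          ENNReal.ofReal (ρ ^ d) * ((2 ^ d * 4 ^ d) * maximal g x) by ring,
        mul_left_comm, ENNReal.mul_le_mul_iff_right hρ0 ENNReal.ofReal_ne_top, ← mul_pow] at h1
      rw [← div_eq_mul_inv, ENNReal.le_div_iff_mul_le (Or.inl hw0) (Or.inl unitBallVol_ne_top)]
      norm_num at h1 ⊢
      exact h1
    calc ∫⁻ z in ball x R, f z
        ≤ ∫⁻ _ in ball x R, 8 ^ d * maximal g x * (unitBallVol d)⁻¹ :=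
          setLIntegral_mono' measurableSet_ball hpt'
      _ = 8 ^ d * maximal g x * ENNReal.ofReal (R ^ d) *
            ((unitBallVol d)⁻¹ * unitBallVol d) := by
          rw [setLIntegral_const, volume_ball_eq _ hR]; ring
      _ = _ := by rw [ENNReal.inv_mul_cancel hw0 unitBallVol_ne_top, mul_one]

/-- The constant in the pointwise estimate of a Sobolev field by the maximal function of its
gradient. -/
noncomputable def sobolevConst (d : ℕ) : ℝ≥0∞ := 4 ^ d * (unitBallVol d)⁻¹ * 8 ^ d

lemma sobolevConst_ne_top : sobolevConst d ≠ ⊤ := by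
  have hw0 : unitBallVol d ≠ 0 := (measure_ball_pos (volume : Measure (Rd d)) 0 one_pos).ne'
  have := ENNReal.inv_ne_top.2 hw0
  unfold sobolevConst
  finiteness

/-- Differences of a Sobolev field are controlled, outside of a null set, by the maximal function
of its gradient. -/
lemma HasWeakGradient.exists_enorm_sub_le_maximal {u : Rd d → Rd d}
    {G : Rd d → Rd d →L[ℝ] Rd d} (h : HasWeakGradient u G) {g : Rd d → ℝ≥0∞} (hgm : Measurable g)
    (hg : ∀ᵐ y, ‖G y‖ₑ ≤ g y) :
    ∃ S : Set (Rd d), (∀ᵐ x, x ∈ S) ∧ ∀ x ∈ S, ∀ y ∈ S,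
      ‖u x - u y‖ₑ ≤ sobolevConst d * ‖x - y‖ₑ * (maximal g x + maximal g y) := by
  -- The good points are those where the mollifications converge to `u`; they have full measure by
  -- Lebesgue differentiation, and the smooth estimate passes to the limit there.
  refine ⟨{x | Filter.Tendsto (fun n => mollify (kernel d n) u x) Filter.atTop (nhds (u x))},
    ContDiffBump.ae_convolution_tendsto_right_of_locallyIntegrable (K := 2) tendsto_bump_rOut
      (Filter.Eventually.of_forall bump_rOut_le) h.locallyIntegrable, fun x hx y hy => ?_⟩
  refine le_of_tendsto (hx.sub hy).enorm (Filter.Eventually.of_forall fun n => ?_)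
  have hM := maximal_le_of_le_kernel_convolution hgm n
    (h.enorm_fderiv_mollify_le (hasCompactSupport_kernel n) (contDiff_kernel n)
      (kernel_nonneg n) hg)
  refine (enorm_sub_le_maximal_of_contDiff
    ((contDiff_mollify (hasCompactSupport_kernel n) (contDiff_kernel n)
      h.locallyIntegrable).of_le (by simp)) x y).trans ?_
  calc _ ≤ 4 ^ d * (unitBallVol d)⁻¹ * ‖x - y‖ₑ *
        (8 ^ d * maximal g x + 8 ^ d * maximal g y) := by
        gcongr
        · exact hM x
        · exact hM y
    _ = _ := by rw [sobolevConst]; ring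

/-- A continuous field whose weak gradient is bounded is Lipschitz. -/
lemma HasWeakGradient.lipschitzWith {u : Rd d → Rd d} {G : Rd d → Rd d →L[ℝ] Rd d}
    (h : HasWeakGradient u G) (hu : Continuous u) {Λ : ℝ≥0} (hG : ∀ᵐ y, ‖G y‖ₑ ≤ Λ) :
    LipschitzWith Λ u := by
  have hn : ∀ n, LipschitzWith Λ (mollify (kernel d n) u) := by
    intro n
    refine lipschitzWith_of_nnnorm_fderiv_le (𝕜 := ℝ)
      ((contDiff_mollify (hasCompactSupport_kernel n) (contDiff_kernel n)
        h.locallyIntegrable).differentiable (by simp)) fun x => ?_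
    have h1 := h.enorm_fderiv_mollify_le (hasCompactSupport_kernel n) (contDiff_kernel n)
      (kernel_nonneg n) hG x
    rw [lintegral_mul_const' _ _ (by simp),
      lintegral_sub_left_eq_self (fun z => ENNReal.ofReal (kernel d n z)) x, lintegral_kernel,
      one_mul] at h1
    exact ENNReal.coe_le_coe.1 h1
  intro x y
  have ht : ∀ x, Filter.Tendsto (fun n => mollify (kernel d n) u x) Filter.atTop (nhds (u x)) :=
    ContDiffBump.convolution_tendsto_right_of_continuous tendsto_bump_rOut hu
  exact le_of_tendsto ((ht x).edist (ht y)) (Filter.Eventually.of_forall fun n => hn n x y)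

end ThetaFlow

namespace ThetaFlow

open Metric

variable {d : ℕ}

/-! ### The determinant of a perturbation of the identity -/

/-- The trace as a continuous linear form on the continuous endomorphisms of `ℝ^d`. -/
noncomputable def traceCLM (d : ℕ) : (Rd d →L[ℝ] Rd d) →L[ℝ] ℝ :=
  LinearMap.toContinuousLinearMap
    (LinearMap.trace ℝ (Rd d) ∘ₗ ContinuousLinearMap.coeLM ℝ)

lemma traceCLM_apply (A : Rd d →L[ℝ] Rd d) :
    traceCLM d A = LinearMap.trace ℝ (Rd d) (A : Rd d →ₗ[ℝ] Rd d) := rfl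

/-- The Leibniz formula writes the determinant as a polynomial in the matrix entries. -/
lemma contDiff_det {n : WithTop ℕ∞} :
    ContDiff ℝ n (fun A : Rd d →L[ℝ] Rd d => A.det) := by
  have h : (fun A : Rd d →L[ℝ] Rd d => A.det) = fun A => ∑ σ : Equiv.Perm (Fin d),
      (Equiv.Perm.sign σ : ℤ) • ∏ i, A (EuclideanSpace.basisFun (Fin d) ℝ i) (σ i) := by
    ext A
    rw [ContinuousLinearMap.det,
      ← LinearMap.det_toMatrix (EuclideanSpace.basisFun (Fin d) ℝ).toBasis, Matrix.det_apply]
    refine Finset.sum_congr rfl fun σ _ => ?_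
    congr 1
    refine Finset.prod_congr rfl fun i _ => ?_
    simp [LinearMap.toMatrix_apply]
  rw [h]
  refine ContDiff.sum fun σ _ => ContDiff.const_smul _ (contDiff_prod fun i _ => ?_)
  have h1 : ContDiff ℝ n (fun A : Rd d →L[ℝ] Rd d => A (EuclideanSpace.basisFun (Fin d) ℝ i)) :=
    (ContinuousLinearMap.apply ℝ (Rd d) (EuclideanSpace.basisFun (Fin d) ℝ i)).contDiff
  exact (EuclideanSpace.proj (𝕜 := ℝ) (ι := Fin d) (σ i)).contDiff.comp h1

lemma hasDerivAt_det_one_add_smul (A : Rd d →L[ℝ] Rd d) :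
    HasDerivAt (fun t : ℝ => (1 + t • A).det) (traceCLM d A) 0 := by
  set b := (EuclideanSpace.basisFun (Fin d) ℝ).toBasis
  set M := LinearMap.toMatrix b b (A : Rd d →ₗ[ℝ] Rd d) with hM
  have h : ∀ t : ℝ, (1 + t • A).det = (1 + t • M).det := by
    intro t
    rw [ContinuousLinearMap.det, ← LinearMap.det_toMatrix b]
    congr 1
    rw [show ((1 + t • A : Rd d →L[ℝ] Rd d) : Rd d →ₗ[ℝ] Rd d) =
      LinearMap.id + t • (A : Rd d →ₗ[ℝ] Rd d) from rfl, map_add, map_smul, LinearMap.toMatrix_id]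
  set q : Polynomial ℝ := (1 + (Polynomial.X : Polynomial ℝ) • M.map ⇑Polynomial.C).det.divX.divX
  have h' : (fun t : ℝ => (1 + t • A).det) = fun t => 1 + M.trace * t + q.eval t * t ^ 2 :=
    funext fun t => (h t).trans (Matrix.det_one_add_smul t M)
  rw [h']
  have h1 : HasDerivAt (fun t : ℝ => 1 + M.trace * t + q.eval t * t ^ 2)
      (M.trace * 1 + (q.derivative.eval 0 * 0 ^ 2 + q.eval 0 * (2 * 0 ^ (2 - 1) * 1))) 0 := by
    refine HasDerivAt.add (((hasDerivAt_id (0 : ℝ)).const_mul M.trace).const_add 1) ?_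
    exact (q.hasDerivAt 0).mul ((hasDerivAt_id (0 : ℝ)).pow 2)
  convert h1 using 1
  rw [traceCLM_apply, LinearMap.trace_eq_matrix_trace ℝ b]
  simp only [hM, mul_one]
  ring

/-- The remainder is smooth and vanishes at `0` together with its derivative, since the derivative
of the determinant at the identity is the trace. The mean value inequality, applied to the
derivative and then to the remainder, needs only a bound for the second derivative on the compact
unit ball. -/
lemma exists_abs_det_one_add_sub_le (d : ℕ) :
    ∃ c : ℝ, 0 ≤ c ∧ ∀ A : Rd d →L[ℝ] Rd d, ‖A‖ ≤ 1 →
      |(1 + A).det - 1 - traceCLM d A| ≤ c * ‖A‖ ^ 2 := by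
  set ψ : (Rd d →L[ℝ] Rd d) → ℝ := fun A => (1 + A).det - 1 - traceCLM d A with hψ
  have hψs : ContDiff ℝ 2 ψ :=
    ((contDiff_det.comp (contDiff_const.add contDiff_id)).sub contDiff_const).sub
      (traceCLM d).contDiff
  have hψd : Differentiable ℝ ψ := hψs.differentiable two_ne_zero
  have hD : ContDiff ℝ 1 (fderiv ℝ ψ) := hψs.fderiv_right (by norm_num)
  have hDd : Differentiable ℝ (fderiv ℝ ψ) := hD.differentiable one_ne_zero
  have h0 : ψ 0 = 0 := by
    simp [hψ, ContinuousLinearMap.det]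
  have hD0 : fderiv ℝ ψ 0 = 0 := by
    ext A
    have h1 : HasDerivAt (fun t : ℝ => ψ (t • A)) (fderiv ℝ ψ 0 A) 0 := by
      have h2 : HasDerivAt (fun t : ℝ => t • A) A 0 := by
        simpa using (hasDerivAt_id (0 : ℝ)).smul_const A
      have h3 : HasFDerivAt ψ (fderiv ℝ ψ 0) ((0 : ℝ) • A) := by
        have := zero_smul ℝ A
        rw [this]; exact (hψd 0).hasFDerivAt
      exact h3.comp_hasDerivAt (0 : ℝ) h2
    have h4 : HasDerivAt (fun t : ℝ => ψ (t • A)) 0 0 := by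
      have h5 := ((hasDerivAt_det_one_add_smul A).sub_const 1).fun_sub
        ((hasDerivAt_id (0 : ℝ)).mul_const (traceCLM d A))
      simpa [hψ] using h5
    simpa using h1.unique h4
  obtain ⟨c, hc⟩ := (isCompact_closedBall (0 : Rd d →L[ℝ] Rd d) 1).exists_bound_of_continuousOn
    (hD.continuous_fderiv one_ne_zero).continuousOn
  have hc0 : 0 ≤ c := (norm_nonneg _).trans (hc 0 (mem_closedBall_self zero_le_one))
  refine ⟨c, hc0, fun A hA => ?_⟩
  have h1 : ∀ B ∈ closedBall (0 : Rd d →L[ℝ] Rd d) ‖A‖, ‖fderiv ℝ ψ B‖ ≤ c * ‖A‖ := by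
    intro B hB
    have hB' : ‖B‖ ≤ ‖A‖ := by simpa using hB
    have := (convex_closedBall (0 : Rd d →L[ℝ] Rd d) 1).norm_image_sub_le_of_norm_fderiv_le
      (fun x _ => hDd x) hc (mem_closedBall_self zero_le_one)
      (by simpa using hB'.trans hA : B ∈ closedBall (0 : Rd d →L[ℝ] Rd d) 1)
    rw [hD0, sub_zero (fderiv ℝ ψ B), sub_zero B] at this
    exact this.trans (by gcongr)
  have h2 := (convex_closedBall (0 : Rd d →L[ℝ] Rd d) ‖A‖).norm_image_sub_le_of_norm_fderiv_le
    (fun x _ => hψd x) h1 (mem_closedBall_self (norm_nonneg _))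
    (by simp : A ∈ closedBall (0 : Rd d →L[ℝ] Rd d) ‖A‖)
  rw [h0, sub_zero (ψ A), sub_zero A, Real.norm_eq_abs] at h2
  calc _ ≤ c * ‖A‖ * ‖A‖ := h2
    _ = _ := by ring

/-- The constant of the second order expansion of the determinant at the identity. -/
noncomputable def detConst (d : ℕ) : ℝ := (exists_abs_det_one_add_sub_le d).choose

lemma detConst_nonneg : 0 ≤ detConst d := (exists_abs_det_one_add_sub_le d).choose_spec.1

lemma abs_det_one_add_smul_sub_one_le {A : Rd d →L[ℝ] Rd d} {Λ C s κ : ℝ} (hA : ‖A‖ ≤ Λ)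
    (htr : |traceCLM d A| ≤ C) (hs : |s| * Λ ≤ 1)
    (hκ : |s| * C + detConst d * (|s| * Λ) ^ 2 ≤ κ) :
    |(1 + s • A).det - 1| ≤ κ := by
  have hn : ‖s • A‖ ≤ |s| * Λ := by
    rw [norm_smul, Real.norm_eq_abs]; gcongr
  have h := (exists_abs_det_one_add_sub_le d).choose_spec.2 (s • A) (hn.trans hs)
  have h2 : |traceCLM d (s • A)| ≤ |s| * C := by
    rw [map_smul, smul_eq_mul, abs_mul]; gcongr
  have h3 : (1 + s • A).det - 1 = ((1 + s • A).det - 1 - traceCLM d (s • A)) +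
      traceCLM d (s • A) := by ring
  have h0 := detConst_nonneg (d := d)
  rw [h3]
  calc _ ≤ _ := abs_add_le _ _
    _ ≤ detConst d * (|s| * Λ) ^ 2 + |s| * C := by
        refine add_le_add (h.trans ?_) h2
        change detConst d * _ ≤ _
        gcongr
    _ ≤ κ := by linarith

/-! ### Compression of one step of the scheme -/

/-- The distributional divergence of `u` is bounded by `C`. -/
def HasDivBound (C : ℝ) (u : Rd d → Rd d) : Prop :=
  ∀ φ : Rd d → ℝ, ContDiff ℝ ∞ φ → HasCompactSupport φ → (∀ x, 0 ≤ φ x) →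
    |∫ y, fderiv ℝ φ y (u y)| ≤ C * ∫ y, φ y

/-- If `E` is the set on the left, `id + b F` maps `E` into the image of `A` under `id - a F`. The
area formula on both sides gives `(1 - κ) |E| ≤ |(id + b F)(E)| ≤ |(id - a F)(A)| ≤ (1 + κ) |A|`, so
the implicit step never has to be differentiated. Injectivity of `id + b F` makes its area formula
an equality; that of `id - a F` serves measurability of the image. -/
lemma mul_volume_setOf_implicit_le_of_contDiff {F : Rd d → Rd d} (hF : ContDiff ℝ ∞ F)
    {Λ : ℝ≥0} (hΛ : LipschitzWith Λ F) {C a b κ : ℝ} (ha : 0 ≤ a) (hb : 0 ≤ b)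
    (htr : ∀ x, |traceCLM d (fderiv ℝ F x)| ≤ C) (haΛ : a * Λ ≤ 1 / 2) (hbΛ : b * Λ ≤ 1 / 2)
    (haκ : a * C + detConst d * (a * Λ) ^ 2 ≤ κ) (hbκ : b * C + detConst d * (b * Λ) ^ 2 ≤ κ)
    {A : Set (Rd d)} (hA : IsOpen A) :
    ENNReal.ofReal (1 - κ) * volume {x | ∃ y ∈ A, y - a • F y = x + b • F x} ≤
      ENNReal.ofReal (1 + κ) * volume A := by
  have hder : ∀ (s : ℝ) (x : Rd d), HasFDerivAt (fun y => y + s • F y) (1 + s • fderiv ℝ F x) x :=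
    fun s x => (hasFDerivAt_id x).fun_add
      (((hF.differentiable (by simp)) x).hasFDerivAt.fun_const_smul s)
  have hinj : ∀ s : ℝ, |s| * Λ ≤ 1 / 2 → Function.Injective (fun y => y + s • F y) := by
    intro s hs x y hxy
    have h1 : x - y = s • (F y - F x) := by
      rw [smul_sub]
      have hxy' : x + s • F x = y + s • F y := hxy
      rw [sub_eq_sub_iff_add_eq_add, hxy', add_comm]
    have h2 : ‖x - y‖ ≤ 1 / 2 * ‖x - y‖ := by
      calc ‖x - y‖ = |s| * ‖F y - F x‖ := by rw [h1, norm_smul, Real.norm_eq_abs]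
        _ ≤ |s| * (Λ * ‖y - x‖) := by gcongr; exact hΛ.norm_sub_le y x
        _ = |s| * Λ * ‖x - y‖ := by rw [norm_sub_rev]; ring
        _ ≤ _ := by gcongr
    have h3 : ‖x - y‖ = 0 := le_antisymm (by linarith) (norm_nonneg _)
    exact sub_eq_zero.1 (norm_eq_zero.1 h3)
  have hcont : ∀ s : ℝ, Continuous (fun y => y + s • F y) := fun s =>
    continuous_id.add (hF.continuous.const_smul s)
  have hdet : ∀ s : ℝ, |s| * Λ ≤ 1 / 2 → |s| * C + detConst d * (|s| * Λ) ^ 2 ≤ κ → ∀ x,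
      |(1 + s • fderiv ℝ F x).det - 1| ≤ κ := fun s hs hsκ x =>
    abs_det_one_add_smul_sub_one_le (norm_fderiv_le_of_lipschitz ℝ hΛ) (htr x)
      (hs.trans (by norm_num)) hsκ
  have hna : |(-a)| = a := by rw [abs_neg, abs_of_nonneg ha]
  have hbb : |b| = b := abs_of_nonneg hb
  have hPA : MeasurableSet ((fun y => y + (-a) • F y) '' A) :=
    hA.measurableSet.image_of_continuousOn_injOn (hcont _).continuousOn
      (hinj _ (by rwa [hna])).injOn
  set E : Set (Rd d) := {x | ∃ y ∈ A, y - a • F y = x + b • F x} with hE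
  have hEeq : E = (fun x => x + b • F x) ⁻¹' ((fun y => y + (-a) • F y) '' A) := by
    ext x
    simp [hE, sub_eq_add_neg]
  have hEm : MeasurableSet E := by
    rw [hEeq]
    exact (hcont b).measurable hPA
  calc ENNReal.ofReal (1 - κ) * volume E
      = ∫⁻ _ in E, ENNReal.ofReal (1 - κ) := (setLIntegral_const _ _).symm
    _ ≤ ∫⁻ x in E, ENNReal.ofReal |(1 + b • fderiv ℝ F x).det| := by
        refine lintegral_mono fun x => ENNReal.ofReal_le_ofReal ?_
        have := abs_le.1 (hdet b (by rwa [hbb]) (by rwa [hbb]) x)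
        exact (by linarith : 1 - κ ≤ _).trans (le_abs_self _)
    _ = volume ((fun x => x + b • F x) '' E) :=
        lintegral_abs_det_fderiv_eq_addHaar_image _ hEm
          (fun x _ => (hder b x).hasFDerivWithinAt) (hinj b (by rwa [hbb])).injOn
    _ ≤ volume ((fun y => y + (-a) • F y) '' A) := by
        rw [hEeq]
        exact measure_mono (image_preimage_subset _ _)
    _ ≤ ∫⁻ x in A, ENNReal.ofReal |(1 + (-a) • fderiv ℝ F x).det| :=
        addHaar_image_le_lintegral_abs_det_fderiv _ hA.measurableSet
          (fun x _ => (hder (-a) x).hasFDerivWithinAt)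
    _ ≤ ∫⁻ _ in A, ENNReal.ofReal (1 + κ) := by
        refine lintegral_mono fun x => ENNReal.ofReal_le_ofReal ?_
        have h1 := hdet (-a) (by rwa [hna]) (by rwa [hna]) x
        have h2 := abs_le.1 h1
        have h3 : 0 ≤ κ := (abs_nonneg _).trans h1
        rcases abs_cases ((1 + (-a) • fderiv ℝ F x).det) with h | h <;> linarith
    _ = _ := setLIntegral_const _ _

lemma lipschitzWith_mollify {F : Rd d → Rd d} {Λ : ℝ≥0} (hΛ : LipschitzWith Λ F) (n : ℕ) :
    LipschitzWith Λ (mollify (kernel d n) F) := by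
  refine LipschitzWith.of_dist_le_mul fun x y => ?_
  have hex : ∀ x, Integrable (fun t => kernel d n t • F (x - t)) := fun x =>
    (hasCompactSupport_kernel n).convolutionExists_left
      (ContinuousLinearMap.lsmul ℝ ℝ : ℝ →L[ℝ] Rd d →L[ℝ] Rd d)
      (contDiff_kernel n).continuous hΛ.continuous.locallyIntegrable x
  have hval : ∀ x, mollify (kernel d n) F x = ∫ t, kernel d n t • F (x - t) := fun x => rfl
  rw [dist_eq_norm, hval, hval, ← integral_sub (hex x) (hex y)]
  calc _ ≤ ∫ t, kernel d n t * (Λ * dist x y) := by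
        refine norm_integral_le_of_norm_le ((integrable_kernel n).mul_const _)
          (Filter.Eventually.of_forall fun t => ?_)
        rw [← smul_sub, norm_smul, Real.norm_eq_abs, abs_of_nonneg (kernel_nonneg n t)]
        refine mul_le_mul_of_nonneg_left ?_ (kernel_nonneg n t)
        have := hΛ.dist_le_mul (x - t) (y - t)
        rwa [dist_sub_right, dist_eq_norm] at this
    _ = _ := by
        rw [integral_mul_const]
        have : ∫ y, kernel d n y = 1 := (bump d n).integral_normed
        rw [this, one_mul]

/-- The trace of the rank-one operator `Dψ ⊗ F` is `Dψ(F)`, so the divergence of the mollified field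
is the distributional divergence tested, up to sign, against a translated kernel of mass one. -/
lemma HasDivBound.abs_trace_fderiv_mollify_le {C : ℝ} {F : Rd d → Rd d} (hF : HasDivBound C F)
    (hFl : LocallyIntegrable F volume) (n : ℕ) (x : Rd d) :
    |traceCLM d (fderiv ℝ (mollify (kernel d n) F) x)| ≤ C := by
  have hc := hasCompactSupport_kernel (d := d) n
  have hs := contDiff_kernel (d := d) n
  rw [(hasFDerivAt_mollify hc hs hFl x).fderiv,
    ← ContinuousLinearMap.integral_comp_comm _ (integrable_fderiv_smulRight hc hs hFl x)]
  have h1 := hF _ (contDiff_comp_const_sub hs x) (hasCompactSupport_comp_const_sub hc x)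
    (fun y => kernel_nonneg n _)
  rw [integral_kernel_sub, mul_one] at h1
  simp_rw [fderiv_comp_const_sub hs, integral_neg, abs_neg] at h1
  convert h1 using 4 with y
  exact LinearMap.trace_smulRight (fderiv ℝ (kernel d n) (x - y) : Rd d →ₗ[ℝ] ℝ) (F y)

/-- One step of the `θ`-method for a Lipschitz field with bounded divergence compresses volumes by
a factor close to one. -/
lemma volume_preimage_step_le {F S : Rd d → Rd d} {Λ : ℝ≥0} (hΛ : LipschitzWith Λ F)
    {C a b κ : ℝ} (ha : 0 ≤ a) (hb : 0 ≤ b) (hdiv : HasDivBound C F) (haΛ : a * Λ ≤ 1 / 2)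
    (hbΛ : b * Λ ≤ 1 / 2) (haκ : a * C + detConst d * (a * Λ) ^ 2 ≤ κ)
    (hbκ : b * C + detConst d * (b * Λ) ^ 2 ≤ κ) (hκ : κ ≤ 1 / 2) (hκ0 : 0 ≤ κ)
    (hS : ∀ x, S x - a • F (S x) = x + b • F x) {A : Set (Rd d)} (hA : IsOpen A) :
    volume (S ⁻¹' A) ≤ ENNReal.ofReal (1 + 4 * κ) * volume A := by
  have hFl : LocallyIntegrable F volume := hΛ.continuous.locallyIntegrable
  set Fn : ℕ → Rd d → Rd d := fun n => mollify (kernel d n) F with hFn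
  have hFnL : ∀ n, LipschitzWith Λ (Fn n) := fun n => lipschitzWith_mollify hΛ n
  have hFt : ∀ x, Filter.Tendsto (fun n => Fn n x) Filter.atTop (nhds (F x)) :=
    ContDiffBump.convolution_tendsto_right_of_continuous tendsto_bump_rOut hΛ.continuous
  set E : ℕ → Set (Rd d) := fun n => {x | ∃ y ∈ A, y - a • Fn n y = x + b • Fn n x} with hE
  have hEn : ∀ n, volume (E n) ≤ ENNReal.ofReal (1 + 4 * κ) * volume A := by
    intro n
    have h1 := mul_volume_setOf_implicit_le_of_contDiff
      (contDiff_mollify (hasCompactSupport_kernel n) (contDiff_kernel n) hFl) (hFnL n) ha hb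
      (hdiv.abs_trace_fderiv_mollify_le hFl n) haΛ hbΛ haκ hbκ hA
    have hpos : 0 < 1 - κ := by linarith
    -- `(1 - κ)(1 + 4κ) - (1 + κ) = 2κ(1 - 2κ)`, which is where `κ ≤ 1 / 2` enters.
    have h2 : ENNReal.ofReal (1 + κ) ≤ ENNReal.ofReal (1 - κ) * ENNReal.ofReal (1 + 4 * κ) := by
      rw [← ENNReal.ofReal_mul hpos.le]
      exact ENNReal.ofReal_le_ofReal (by nlinarith)
    have h3 : ENNReal.ofReal (1 - κ) * volume (E n) ≤
        ENNReal.ofReal (1 - κ) * (ENNReal.ofReal (1 + 4 * κ) * volume A) :=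
      h1.trans (by rw [← mul_assoc]; gcongr)
    rwa [ENNReal.mul_le_mul_iff_right (by simpa using hpos) ENNReal.ofReal_ne_top] at h3
  -- For fixed `x` the implicit equation for the mollified field is solved by a fixed point `y n`,
  -- and `y n` tends to `S x` because the residual at `S x` tends to zero. As `A` is open, `x` lies
  -- in `E n` for all large `n`.
  have hsub : S ⁻¹' A ⊆ ⋃ m : ℕ, ⋂ n ≥ m, E n := by
    intro x hx
    have hcontr : ∀ n, ContractingWith (1 / 2) (fun y => x + b • Fn n x + a • Fn n y) := by
      intro n
      refine ⟨by norm_num, LipschitzWith.of_dist_le_mul fun y z => ?_⟩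
      rw [dist_add_left, dist_smul₀, Real.norm_eq_abs, abs_of_nonneg ha]
      calc a * dist (Fn n y) (Fn n z) ≤ a * (Λ * dist y z) := by
            gcongr; exact (hFnL n).dist_le_mul y z
        _ = a * Λ * dist y z := by ring
        _ ≤ 1 / 2 * dist y z := by gcongr
        _ = _ := by simp
    set y : ℕ → Rd d := fun n => ContractingWith.fixedPoint _ (hcontr n)
    have hy : ∀ n, x + b • Fn n x + a • Fn n (y n) = y n := fun n =>
      (hcontr n).fixedPoint_isFixedPt
    have hdist : ∀ n, dist (S x) (y n) ≤
        2 * ‖S x - (x + b • Fn n x + a • Fn n (S x))‖ := by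
      intro n
      have := (hcontr n).dist_fixedPoint_le (S x)
      refine this.trans (le_of_eq ?_)
      rw [← dist_eq_norm (S x)]
      norm_num
      ring
    have hlim : Filter.Tendsto (fun n => 2 * ‖S x - (x + b • Fn n x + a • Fn n (S x))‖)
        Filter.atTop (nhds 0) := by
      have h1 : Filter.Tendsto (fun n => 2 * ‖S x - (x + b • Fn n x + a • Fn n (S x))‖)
          Filter.atTop (nhds (2 * ‖S x - (x + b • F x + a • F (S x))‖)) :=
        ((((((hFt x).const_smul b).const_add x).add ((hFt (S x)).const_smul a)).const_sub
          (S x)).norm).const_mul 2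
      rw [← hS x] at h1
      simpa using h1
    have hyt : Filter.Tendsto y Filter.atTop (nhds (S x)) := by
      rw [tendsto_iff_dist_tendsto_zero]
      refine squeeze_zero (fun _ => dist_nonneg) (fun n => ?_) hlim
      rw [dist_comm]
      exact hdist n
    obtain ⟨m, hm⟩ := Filter.eventually_atTop.1 (hyt.eventually (hA.mem_nhds hx))
    refine mem_iUnion.2 ⟨m, mem_iInter₂.2 fun n hn => ⟨y n, hm n hn, ?_⟩⟩
    nth_rewrite 1 [← hy n]
    rw [add_sub_cancel_right]
  have hmono : Monotone fun m : ℕ => ⋂ n ≥ m, E n := fun m m' hmm' =>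
    iInter₂_mono' fun n hn => ⟨n, le_trans hmm' hn, le_rfl⟩
  calc volume (S ⁻¹' A) ≤ volume (⋃ m : ℕ, ⋂ n ≥ m, E n) := measure_mono hsub
    _ = ⨆ m : ℕ, volume (⋂ n ≥ m, E n) := hmono.measure_iUnion
    _ ≤ _ := iSup_le fun m => (measure_mono (iInter₂_subset m le_rfl)).trans (hEn m)

end ThetaFlow

namespace ThetaFlow

open Metric

variable {d : ℕ}

/-! ### Lipschitz fields with bounded divergence -/

/-- A time dependent field which is, for almost every time, bounded by `C`, Lipschitz with
constant `Λ`, and of distributional divergence bounded by `C'`. -/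
structure IsRegularField (T : ℝ) (c : ℝ → Rd d → Rd d) (C : ℝ) (Λ : ℝ≥0) (C' : ℝ) : Prop where
  aestronglyMeasurable : AEStronglyMeasurable (Function.uncurry c) (slab d T)
  ae_norm_le : ∀ᵐ t ∂volume.restrict (Ioo 0 T), ∀ x, ‖c t x‖ ≤ C
  ae_lipschitzWith : ∀ᵐ t ∂volume.restrict (Ioo 0 T), LipschitzWith Λ (c t)
  ae_hasDivBound : ∀ᵐ t ∂volume.restrict (Ioo 0 T), HasDivBound C' (c t)

lemma ae_enorm_le_of_normLinf_le {F : Type*} [NormedAddCommGroup F] {T : ℝ}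
    {f : ℝ → Rd d → F} {C : ℝ≥0∞} (h : normLinf T f ≤ C) :
    ∀ᵐ t ∂volume.restrict (Ioo 0 T), ∀ᵐ x, ‖f t x‖ₑ ≤ C := by
  have h1 : ∀ᵐ z ∂slab d T, ‖f z.1 z.2‖ₑ ≤ C := by
    rw [normLinf, eLpNorm_exponent_top] at h
    filter_upwards [ae_le_eLpNormEssSup (f := fun z : ℝ × Rd d => ‖f z.1 z.2‖)
      (μ := slab d T)] with z hz
    rw [enorm_norm] at hz
    exact hz.trans h
  exact Measure.ae_ae_of_ae_prod h1

/-- Expand `u` in an orthonormal basis and use the weak gradient identity in each basis direction;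
the sum of `⟨e i, G (e i)⟩` is the trace. -/
lemma HasWeakGradient.hasDivBound {u : Rd d → Rd d} {G : Rd d → Rd d →L[ℝ] Rd d}
    (h : HasWeakGradient u G) {C : ℝ}
    (hG : ∀ᵐ x, |LinearMap.trace ℝ (Rd d) (G x : Rd d →ₗ[ℝ] Rd d)| ≤ C) : HasDivBound C u := by
  intro φ hφ hφc hφ0
  set e := EuclideanSpace.basisFun (Fin d) ℝ
  have hI1 : ∀ i, Integrable (fun y => fderiv ℝ φ y (e i) • u y) := fun i =>
    h.locallyIntegrable.integrable_smul_left_of_hasCompactSupport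
      ((hφ.continuous_fderiv (by simp)).clm_apply continuous_const)
      (hφc.fderiv_apply (𝕜 := ℝ) (e i))
  have hI2 : ∀ i, Integrable (fun y => φ y • G y (e i)) := fun i =>
    (h.locallyIntegrable_grad (e i)).integrable_smul_left_of_hasCompactSupport hφ.continuous hφc
  have h1 : ∫ y, fderiv ℝ φ y (u y) = ∑ i, inner ℝ (e i) (∫ y, fderiv ℝ φ y (e i) • u y) := by
    simp_rw [← integral_inner (hI1 _)]
    rw [← integral_finsetSum _ fun i _ => (hI1 i).const_inner (e i)]
    refine integral_congr_ae (Filter.Eventually.of_forall fun y => ?_)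
    dsimp only
    conv_lhs => rw [← e.sum_repr' (u y), map_sum]
    refine Finset.sum_congr rfl fun i _ => ?_
    rw [map_smul, inner_smul_right, smul_eq_mul, mul_comm]
  have h2 : ∫ y, fderiv ℝ φ y (u y) =
      - ∫ y, φ y * LinearMap.trace ℝ (Rd d) (G y : Rd d →ₗ[ℝ] Rd d) := by
    rw [h1]
    simp_rw [h.integral_eq φ hφ hφc, inner_neg_right, ← integral_inner (hI2 _)]
    rw [Finset.sum_neg_distrib, ← integral_finsetSum _ fun i _ => (hI2 i).const_inner (e i)]
    congr 1
    refine integral_congr_ae (Filter.Eventually.of_forall fun y => ?_)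
    dsimp only
    rw [LinearMap.trace_eq_sum_inner _ e, Finset.mul_sum]
    refine Finset.sum_congr rfl fun i _ => ?_
    rw [inner_smul_right]
    rfl
  rw [h2, abs_neg, ← Real.norm_eq_abs, ← integral_const_mul]
  refine norm_integral_le_of_norm_le
    ((hφ.continuous.integrable_of_hasCompactSupport hφc).const_mul C) ?_
  filter_upwards [hG] with y hy
  rw [norm_mul, Real.norm_eq_abs, Real.norm_eq_abs, abs_of_nonneg (hφ0 y), mul_comm]
  exact mul_le_mul_of_nonneg_right hy (hφ0 y)

lemma IsApproximatingSequence.isRegularField {T : ℝ} {b : ℝ → Rd d → Rd d}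
    {C₀ C₁ C₂ C₃ α β : ℝ} {bε : ℝ → ℝ → Rd d → Rd d} (hC₂ : 0 < C₂)
    (hC₃ : 0 < C₃) (h : IsApproximatingSequence T b C₀ C₁ C₂ C₃ α β bε) {ε : ℝ}
    (hε : ε ∈ Ioc (0 : ℝ) 1) :
    IsRegularField T (bε ε) C₃ (C₁ / ε ^ β).toNNReal C₂ := by
  obtain ⟨hm, hcont, -, hbd, G, hGm, hG, hGb, hGd⟩ := h ε hε
  have hdG : normLinf T (divOfGrad G) ≤ ENNReal.ofReal C₂ := hGd
  refine ⟨hm, ?_, ?_, ?_⟩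
  · filter_upwards [hcont, ae_enorm_le_of_normLinf_le hbd] with t htc htb x
    -- The scheme evaluates the field at points, so the almost everywhere bound must hold
    -- everywhere: by continuity it holds on a closed set, which is dense since it has full measure.
    have hclosed : IsClosed {x | ‖bε ε t x‖ₑ ≤ ENNReal.ofReal C₃} :=
      isClosed_le htc.enorm continuous_const
    have hdense : Dense {x | ‖bε ε t x‖ₑ ≤ ENNReal.ofReal C₃} := Measure.dense_of_ae htb
    have hx : x ∈ {x | ‖bε ε t x‖ₑ ≤ ENNReal.ofReal C₃} := by
      rw [← hclosed.closure_eq, hdense.closure_eq]; trivial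
    have hx' : ‖bε ε t x‖ₑ ≤ ENNReal.ofReal C₃ := hx
    rw [← ofReal_norm] at hx'
    exact (ENNReal.ofReal_le_ofReal_iff hC₃.le).1 hx'
  · filter_upwards [hcont, hG, ae_enorm_le_of_normLinf_le hGb] with t htc htG htb
    exact htG.lipschitzWith htc htb
  · filter_upwards [hG, ae_enorm_le_of_normLinf_le hdG] with t htG htb
    refine htG.hasDivBound ?_
    filter_upwards [htb] with x hx
    rw [← ofReal_norm, ENNReal.ofReal_le_ofReal_iff hC₂.le, Real.norm_eq_abs] at hx
    exact hx

section RegularField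

variable {T : ℝ} {c : ℝ → Rd d → Rd d} {C C' : ℝ} {Λ : ℝ≥0}

/-- Joint measurability yields measurable time slices only for almost every `x`. Such points are
dense, and spatial continuity carries the property to every `x` by a limit. -/
lemma IsRegularField.aestronglyMeasurable_time (hc : IsRegularField T c C Λ C') (x : Rd d) :
    AEStronglyMeasurable (fun s => c s x) (volume.restrict (Ioo 0 T)) := by
  have h1 : ∀ᵐ x : Rd d, AEStronglyMeasurable (fun s => c s x) (volume.restrict (Ioo 0 T)) :=
    (hc.aestronglyMeasurable.prod_swap).prodMk_left
  have h2 : Dense {x : Rd d | AEStronglyMeasurable (fun s => c s x) (volume.restrict (Ioo 0 T))} :=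
    Measure.dense_of_ae h1
  obtain ⟨y, hy, hyx⟩ := mem_closure_iff_seq_limit.1 (h2 x)
  refine aestronglyMeasurable_of_tendsto_ae Filter.atTop (f := fun n s => c s (y n)) hy ?_
  filter_upwards [hc.ae_lipschitzWith] with s hs
  exact (hs.continuous.tendsto x).comp hyx

lemma restrict_Ioc_le_restrict_Ioo {a b : ℝ} (ha : 0 ≤ a) (hb : b ≤ T) :
    (volume : Measure ℝ).restrict (Ioc a b) ≤ volume.restrict (Ioo 0 T) := by
  rw [← restrict_Ioo_eq_restrict_Ioc]
  exact Measure.restrict_mono (Ioo_subset_Ioo ha hb) le_rfl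

lemma IsRegularField.intervalIntegrable (hc : IsRegularField T c C Λ C') (x : Rd d) {a b : ℝ}
    (ha : 0 ≤ a) (hab : a ≤ b) (hb : b ≤ T) : IntervalIntegrable (fun s => c s x) volume a b := by
  rw [intervalIntegrable_iff_integrableOn_Ioc_of_le hab]
  have hle := restrict_Ioc_le_restrict_Ioo (T := T) ha hb
  refine Integrable.of_bound ((hc.aestronglyMeasurable_time x).mono_measure hle) C ?_
  filter_upwards [ae_mono hle hc.ae_norm_le] with s hs using hs x

/-- The average in time of a field. -/
noncomputable def timeAverage (c : ℝ → Rd d → Rd d) (a b : ℝ) (x : Rd d) : Rd d :=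
  ⨍ s in a..b, c s x

lemma timeAverage_eq (c : ℝ → Rd d → Rd d) (a b : ℝ) (x : Rd d) :
    timeAverage c a b x = (b - a)⁻¹ • ∫ s in a..b, c s x :=
  interval_average_eq _ _ _

lemma IsRegularField.lipschitzWith_timeAverage (hc : IsRegularField T c C Λ C') {a b : ℝ}
    (ha : 0 ≤ a) (hab : a < b) (hb : b ≤ T) : LipschitzWith Λ (timeAverage c a b) := by
  refine LipschitzWith.of_dist_le_mul fun x y => ?_
  have hle := restrict_Ioc_le_restrict_Ioo (T := T) ha hb
  have hpos : 0 < b - a := by linarith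
  rw [dist_eq_norm, timeAverage_eq, timeAverage_eq, ← smul_sub,
    ← intervalIntegral.integral_sub (hc.intervalIntegrable x ha hab.le hb)
      (hc.intervalIntegrable y ha hab.le hb), norm_smul, norm_inv, Real.norm_eq_abs,
    abs_of_pos hpos, inv_mul_le_iff₀ hpos]
  have h := intervalIntegral.norm_integral_le_of_norm_le (a := a) (b := b) (μ := volume)
    (f := fun s => c s x - c s y) (g := fun _ => Λ * dist x y) hab.le ?_
    intervalIntegrable_const
  · simpa [mul_left_comm] using h
  · rw [← ae_restrict_iff' measurableSet_Ioc]
    filter_upwards [ae_mono hle hc.ae_lipschitzWith] with s hs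
    rw [← dist_eq_norm]
    exact hs.dist_le_mul x y

/-- The distributional form of the bound is linear in the field, so Fubini carries it through the
time average without differentiating under the integral. -/
lemma IsRegularField.hasDivBound_timeAverage (hc : IsRegularField T c C Λ C') {a b : ℝ}
    (ha : 0 ≤ a) (hab : a < b) (hb : b ≤ T) : HasDivBound C' (timeAverage c a b) := by
  intro φ hφ hφc hφ0
  have hle := restrict_Ioc_le_restrict_Ioo (T := T) ha hb
  have hpos : 0 < b - a := by linarith
  have hDc : Continuous (fderiv ℝ φ) := hφ.continuous_fderiv (by simp)
  have hDi : Integrable (fun y => ‖fderiv ℝ φ y‖) :=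
    (hDc.integrable_of_hasCompactSupport (hφc.fderiv (𝕜 := ℝ))).norm
  have hmc : AEStronglyMeasurable (Function.uncurry c)
      ((volume.restrict (Ioc a b)).prod (volume : Measure (Rd d))) :=
    hc.aestronglyMeasurable.mono_measure (Measure.prod_mono hle le_rfl)
  have hm : AEStronglyMeasurable (Function.uncurry fun s y => fderiv ℝ φ y (c s y))
      ((volume.restrict (Ioc a b)).prod (volume : Measure (Rd d))) :=
    isBoundedBilinearMap_apply.continuous.comp_aestronglyMeasurable
      ((hDc.comp continuous_snd).aestronglyMeasurable.prodMk hmc)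
  have hbound : ∀ᵐ z ∂((volume.restrict (Ioc a b)).prod (volume : Measure (Rd d))),
      ‖c z.1 z.2‖ ≤ C := by
    have h1 : ∀ᵐ t ∂volume.restrict (Ioc a b), ∀ x, ‖c t x‖ ≤ C := ae_mono hle hc.ae_norm_le
    have h2 := Measure.quasiMeasurePreserving_fst (μ := volume.restrict (Ioc a b))
      (ν := (volume : Measure (Rd d))) |>.ae h1
    filter_upwards [h2] with z hz using hz z.2
  have hint : Integrable (Function.uncurry fun s y => fderiv ℝ φ y (c s y))
      ((volume.restrict (Ioc a b)).prod (volume : Measure (Rd d))) := by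
    have h1 : Integrable (fun z : ℝ × Rd d => C * ‖fderiv ℝ φ z.2‖)
        ((volume.restrict (Ioc a b)).prod (volume : Measure (Rd d))) :=
      (integrable_const C).mul_prod hDi
    refine h1.mono' hm ?_
    filter_upwards [hbound] with z hz
    rw [mul_comm]
    exact (ContinuousLinearMap.le_opNorm _ _).trans (by gcongr)
  have h1 : ∫ y, fderiv ℝ φ y (timeAverage c a b y) =
      (b - a)⁻¹ * ∫ s in Ioc a b, ∫ y, fderiv ℝ φ y (c s y) := by
    rw [integral_integral_swap hint, ← integral_const_mul]
    refine integral_congr_ae (Filter.Eventually.of_forall fun y => ?_)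
    dsimp only
    rw [timeAverage_eq, map_smul, smul_eq_mul,
      ← ContinuousLinearMap.intervalIntegral_comp_comm _ (hc.intervalIntegrable y ha hab.le hb),
      intervalIntegral.integral_of_le hab.le]
  rw [h1, abs_mul, abs_inv, abs_of_pos hpos, inv_mul_le_iff₀ hpos]
  have h2 : ‖∫ s in Ioc a b, ∫ y, fderiv ℝ φ y (c s y)‖ ≤
      ∫ _ in Ioc a b, C' * ∫ y, φ y := by
    refine norm_integral_le_of_norm_le (integrable_const _) ?_
    filter_upwards [ae_mono hle hc.ae_hasDivBound] with s hs
    exact hs φ hφ hφc hφ0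
  refine h2.trans (le_of_eq ?_)
  simp [hpos.le]

end RegularField

/-! ### Compression of volumes by a map -/

/-- Outer regularity of Lebesgue measure. The case `L = 0` is separate because a zero factor need
not commute with an infimum of possibly infinite measures. -/
lemma map_le_smul_of_isOpen {Φ : Rd d → Rd d} (hΦ : AEMeasurable Φ) {L : ℝ≥0∞} (hL : L ≠ ⊤)
    (h : ∀ A : Set (Rd d), IsOpen A → volume (Φ ⁻¹' A) ≤ L * volume A) :
    Measure.map Φ volume ≤ L • volume := by
  refine Measure.le_iff.2 fun s hs => ?_
  rw [Measure.map_apply_of_aemeasurable hΦ hs, Measure.smul_apply, smul_eq_mul,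
    s.measure_eq_iInf_isOpen]
  by_cases hL0 : L = 0
  · have := h univ isOpen_univ
    rw [hL0, zero_mul] at this ⊢
    exact (measure_mono (preimage_mono (subset_univ s))).trans this
  simp_rw [ENNReal.mul_iInf_of_ne hL0 hL]
  exact le_iInf₂ fun A hsA => le_iInf fun hA =>
    (measure_mono (preimage_mono hsA)).trans (h A hA)

/-! ### The nodes of the scheme -/

section Step

variable {F : Rd d → Rd d} {Λ : ℝ≥0} {a b : ℝ}

lemma norm_sub_le_two_mul_norm_implicit (hΛ : LipschitzWith Λ F) (ha : 0 ≤ a)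
    (haΛ : a * Λ ≤ 1 / 2) (y z : Rd d) :
    ‖y - z‖ ≤ 2 * ‖(y - a • F y) - (z - a • F z)‖ := by
  have h1 : ‖a • (F y - F z)‖ ≤ 1 / 2 * ‖y - z‖ := by
    calc _ = a * ‖F y - F z‖ := by rw [norm_smul, Real.norm_eq_abs, abs_of_nonneg ha]
      _ ≤ a * (Λ * ‖y - z‖) := by gcongr; exact hΛ.norm_sub_le y z
      _ = a * Λ * ‖y - z‖ := by ring
      _ ≤ _ := by gcongr
  have h2 : y - z = ((y - a • F y) - (z - a • F z)) + a • (F y - F z) := by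
    rw [smul_sub]; abel
  have h3 := norm_add_le ((y - a • F y) - (z - a • F z)) (a • (F y - F z))
  rw [← h2] at h3
  linarith

lemma exists_implicit_eq (hΛ : LipschitzWith Λ F) (ha : 0 ≤ a) (haΛ : a * Λ ≤ 1 / 2)
    (z : Rd d) : ∃ y, y - a • F y = z := by
  have hcontr : ContractingWith (1 / 2) (fun y => z + a • F y) := by
    refine ⟨by norm_num, LipschitzWith.of_dist_le_mul fun y w => ?_⟩
    rw [dist_add_left, dist_smul₀, Real.norm_eq_abs, abs_of_nonneg ha]
    calc a * dist (F y) (F w) ≤ a * (Λ * dist y w) := by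
          gcongr; exact hΛ.dist_le_mul y w
      _ = a * Λ * dist y w := by ring
      _ ≤ 1 / 2 * dist y w := by gcongr
      _ = _ := by simp
  have hy : z + a • F (hcontr.fixedPoint) = hcontr.fixedPoint := hcontr.fixedPoint_isFixedPt
  refine ⟨hcontr.fixedPoint, ?_⟩
  nth_rewrite 1 [← hy]
  rw [add_sub_cancel_right]

/-- As `a F` is a contraction, `id - a F` is bijective with inverse Lipschitz of constant `2`.
Uniqueness identifies the given nodes with iterated compositions of such maps, which makes them
continuous without assuming it. -/
lemma exists_continuous_step (hΛ : LipschitzWith Λ F) (ha : 0 ≤ a) (haΛ : a * Λ ≤ 1 / 2) (b : ℝ) :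
    ∃ S : Rd d → Rd d, Continuous S ∧ (∀ x, S x - a • F (S x) = x + b • F x) ∧
      ∀ x y, y - a • F y = x + b • F x → y = S x := by
  choose S hS using fun x => exists_implicit_eq hΛ ha haΛ (x + b • F x)
  refine ⟨S, ?_, hS, fun x y hy => ?_⟩
  · refine continuous_iff_continuousAt.2 fun x => ?_
    rw [ContinuousAt, tendsto_iff_norm_sub_tendsto_zero]
    have h1 : Continuous fun y => 2 * ‖(y + b • F y) - (x + b • F x)‖ := by
      have := hΛ.continuous
      fun_prop
    have h2 : Filter.Tendsto (fun y => 2 * ‖(y + b • F y) - (x + b • F x)‖) (nhds x) (nhds 0) := by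
      simpa using h1.tendsto x
    refine squeeze_zero (fun _ => norm_nonneg _) (fun y => ?_) h2
    rw [← hS, ← hS]
    exact norm_sub_le_two_mul_norm_implicit hΛ ha haΛ _ _
  · have := norm_sub_le_two_mul_norm_implicit hΛ ha haΛ y (S x)
    rw [hy, hS, sub_self, norm_zero, mul_zero] at this
    exact sub_eq_zero.1 (norm_eq_zero.1 (le_antisymm this (norm_nonneg _)))

end Step

section Scheme

variable {T : ℝ} {c : ℝ → Rd d → Rd d} {C C' : ℝ} {Λ : ℝ≥0} {N : ℕ} {θ : ℝ}
  {Y : ℕ → Rd d → Rd d}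

lemma node_nonneg (hT : 0 < T) (i : ℕ) : 0 ≤ i * (T / N) := by positivity

lemma succ_node_le (hT : 0 < T) {i : ℕ} (hi : i < N) : ((i : ℝ) + 1) * (T / N) ≤ T := by
  have hN : (0 : ℝ) < N := by exact_mod_cast (Nat.zero_le i).trans_lt hi
  have h1 : ((i : ℝ) + 1) ≤ N := by exact_mod_cast hi
  calc ((i : ℝ) + 1) * (T / N) ≤ N * (T / N) := by gcongr
    _ = T := by field_simp

lemma node_lt_succ_node (hT : 0 < T) {i : ℕ} (hi : i < N) :
    i * (T / N) < ((i : ℝ) + 1) * (T / N) := by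
  have hN : (0 : ℝ) < N := by exact_mod_cast (Nat.zero_le i).trans_lt hi
  have : 0 < T / N := by positivity
  nlinarith

lemma IsThetaScheme.sub_eq (hT : 0 < T) (hY : IsThetaScheme T N θ c Y) {i : ℕ} (hi : i < N)
    (x : Rd d) :
    Y (i + 1) x - Y i x =
      (T / N * (1 - θ)) • timeAverage c (i * (T / N)) ((i + 1) * (T / N)) (Y i x) +
      (T / N * θ) • timeAverage c (i * (T / N)) ((i + 1) * (T / N)) (Y (i + 1) x) := by
  have hN : (0 : ℝ) < N := by exact_mod_cast (Nat.zero_le i).trans_lt hi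
  have hh : T / N ≠ 0 := by positivity
  have h := hY.step i hi x
  rw [inv_smul_eq_iff₀ hh] at h
  rw [h, smul_add, smul_smul, smul_smul]
  rfl

/-- The nodes of the scheme are continuous and compress volumes by a bounded factor. -/
lemma IsThetaScheme.continuous_and_volume_preimage_le (hT : 0 < T) (hθ : θ ∈ Icc (0 : ℝ) 1)
    (hc : IsRegularField T c C Λ C') (hC' : 0 ≤ C') (hY : IsThetaScheme T N θ c Y)
    (hΛ : T / N * Λ ≤ 1 / 2)
    {κ : ℝ} (hκ : T / N * C' + detConst d * (T / N * Λ) ^ 2 ≤ κ) (hκ2 : κ ≤ 1 / 2) (i : ℕ)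
    (hi : i ≤ N) :
    Continuous (Y i) ∧ ∀ A : Set (Rd d), IsOpen A →
      volume (Y i ⁻¹' A) ≤ ENNReal.ofReal (1 + 4 * κ) ^ i * volume A := by
  have hd0 := detConst_nonneg (d := d)
  have hh0 : 0 ≤ T / N := by positivity
  have hκ0 : 0 ≤ κ := le_trans (by positivity) hκ
  have hmono : ∀ t ∈ Icc (0 : ℝ) 1, T / N * t * Λ ≤ 1 / 2 ∧
      T / N * t * C' + detConst d * (T / N * t * Λ) ^ 2 ≤ κ := by
    intro t ht
    have h1 : T / N * t ≤ T / N := mul_le_of_le_one_right hh0 ht.2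
    have h2 : 0 ≤ T / N * t := mul_nonneg hh0 ht.1
    refine ⟨le_trans (by gcongr) hΛ, le_trans ?_ hκ⟩
    gcongr
  induction i with
  | zero =>
    have : Y 0 = id := funext hY.init
    rw [this]
    exact ⟨continuous_id, fun A _ => by simp⟩
  | succ i ih =>
    have hi' : i < N := hi
    obtain ⟨hcont, hvol⟩ := ih hi'.le
    set F := timeAverage c (i * (T / N)) ((i + 1) * (T / N)) with hF
    have hFL : LipschitzWith Λ F := hc.lipschitzWith_timeAverage (node_nonneg hT i)
      (node_lt_succ_node hT hi') (succ_node_le hT hi')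
    have hFd : HasDivBound C' F := hc.hasDivBound_timeAverage (node_nonneg hT i)
      (node_lt_succ_node hT hi') (succ_node_le hT hi')
    have hθ' : 1 - θ ∈ Icc (0 : ℝ) 1 := ⟨by linarith [hθ.2], by linarith [hθ.1]⟩
    have ha : 0 ≤ T / N * θ := mul_nonneg hh0 hθ.1
    have hb : 0 ≤ T / N * (1 - θ) := mul_nonneg hh0 hθ'.1
    obtain ⟨S, hSc, hS, hSu⟩ := exists_continuous_step hFL ha (hmono θ hθ).1 (T / N * (1 - θ))
    have hYS : Y (i + 1) = S ∘ Y i := by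
      ext1 x
      refine hSu _ _ ?_
      have := hY.sub_eq hT hi' x
      rw [← hF] at this
      rw [sub_eq_iff_eq_add] at this ⊢
      refine this.trans ?_
      abel
    refine ⟨hYS ▸ hSc.comp hcont, fun A hA => ?_⟩
    rw [hYS, preimage_comp]
    calc _ ≤ ENNReal.ofReal (1 + 4 * κ) ^ i * volume (S ⁻¹' A) := hvol _ (hA.preimage hSc)
      _ ≤ ENNReal.ofReal (1 + 4 * κ) ^ i * (ENNReal.ofReal (1 + 4 * κ) * volume A) := by
          gcongr
          exact volume_preimage_step_le hFL ha hb hFd (hmono θ hθ).1 (hmono _ hθ').1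
            (hmono θ hθ).2 (hmono _ hθ').2 hκ2 hκ0 hS hA
      _ = _ := by rw [pow_succ, mul_assoc]

/-- With `κ = (T / N) M`, at most `N` factors `1 + 4κ ≤ exp (4κ)` multiply to `exp (4 T M)`,
uniformly in `N` and `θ`. -/
lemma IsThetaScheme.map_le (hT : 0 < T) (hN : 0 < N) (hθ : θ ∈ Icc (0 : ℝ) 1)
    (hc : IsRegularField T c C Λ C') (hC' : 0 ≤ C') (hY : IsThetaScheme T N θ c Y)
    (hΛ : T / N * Λ ≤ 1 / 2) {M : ℝ}
    (hM : T / N * C' + detConst d * (T / N * Λ) ^ 2 ≤ T / N * M) (hM2 : T / N * M ≤ 1 / 2) {i : ℕ}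
    (hi : i ≤ N) :
    Measure.map (Y i) volume ≤ ENNReal.ofReal (Real.exp (4 * T * M)) • volume := by
  obtain ⟨h1, h2⟩ := hY.continuous_and_volume_preimage_le hT hθ hc hC' hΛ hM hM2 i hi
  refine map_le_smul_of_isOpen h1.measurable.aemeasurable ENNReal.ofReal_ne_top fun A hA => ?_
  refine (h2 A hA).trans ?_
  gcongr
  have hd0 := detConst_nonneg (d := d)
  have hM0 : 0 ≤ T / N * M := le_trans (by positivity) hM
  rw [← ENNReal.ofReal_pow (by positivity)]
  refine ENNReal.ofReal_le_ofReal ?_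
  calc (1 + 4 * (T / N * M)) ^ i ≤ Real.exp (4 * (T / N * M)) ^ i := by
        gcongr
        rw [add_comm]
        exact Real.add_one_le_exp _
    _ = Real.exp (i * (4 * (T / N * M))) := by rw [← Real.exp_nat_mul]
    _ ≤ _ := by
        refine Real.exp_le_exp.2 ?_
        have hN' : (0 : ℝ) < N := by exact_mod_cast hN
        have hi' : (i : ℝ) ≤ N := by exact_mod_cast hi
        calc (i : ℝ) * (4 * (T / N * M)) ≤ N * (4 * (T / N * M)) := by gcongr
          _ = 4 * T * M := by field_simp

end Scheme

end ThetaFlow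

namespace ThetaFlow

open Metric

variable {d : ℕ}

/-! ### The logarithm along an absolutely continuous curve -/

/-- Replaces the chain rule, as the curve is only absolutely continuous. The set of good times is
closed. From a good time `x` one can advance: `log` lies below its tangent at `δ + ‖w x‖`, and on a
short interval the denominators exceed the one at `x` by a factor less than `1 + η`. -/
lemma log_le_mul_integral_of_integrable {E : Type*} [NormedAddCommGroup E] [NormedSpace ℝ E]
    {f : ℝ → E} (hf : Integrable f) {δ η : ℝ} (hδ : 0 < δ) (hη : 0 < η)
    {t : ℝ} (ht : 0 ≤ t) :
    Real.log (δ + ‖∫ s in (0 : ℝ)..t, f s‖) - Real.log δ ≤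
      (1 + η) * ∫ s in (0 : ℝ)..t, ‖f s‖ / (δ + ‖∫ r in (0 : ℝ)..s, f r‖) := by
  set w : ℝ → E := fun t => ∫ s in (0 : ℝ)..t, f s with hw
  have hwc : Continuous w :=
    intervalIntegral.continuous_primitive (fun a b => hf.intervalIntegrable) 0
  have hden : ∀ s, 0 < δ + ‖w s‖ := fun s => by positivity
  have hdc : Continuous fun s => δ + ‖w s‖ := continuous_const.add hwc.norm
  have hki : Integrable (fun s => ‖f s‖ / (δ + ‖w s‖)) := by
    refine (hf.norm.div_const δ).mono' ?_ (Filter.Eventually.of_forall fun s => ?_)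
    · exact hf.aestronglyMeasurable.norm.div₀ hdc.aestronglyMeasurable
    · rw [Real.norm_eq_abs, abs_of_nonneg (by positivity)]
      gcongr
      simp
  set φ : ℝ → ℝ := fun t => ∫ s in (0 : ℝ)..t, ‖f s‖ / (δ + ‖w s‖) with hφ
  have hφc : Continuous φ :=
    intervalIntegral.continuous_primitive (fun a b => hki.intervalIntegrable) 0
  have hgc : Continuous fun t => Real.log (δ + ‖w t‖) :=
    hdc.log fun s => (hden s).ne'
  set S : Set ℝ := {t | Real.log (δ + ‖w t‖) - Real.log δ ≤ (1 + η) * φ t} with hS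
  have hSc : IsClosed S := isClosed_le (hgc.sub continuous_const) (hφc.const_mul _)
  have hsub : Icc 0 t ⊆ S := by
    refine (hSc.inter isClosed_Icc).Icc_subset_of_forall_exists_gt ?_ ?_
    · simp [hS, hw, hφ]
    · rintro x ⟨hx, hx0, hxt⟩ y hy
      have hxy : x < y := hy
      have hev : ∀ᶠ s in nhds x, δ + ‖w s‖ < (1 + η) * (δ + ‖w x‖) := by
        refine hdc.continuousAt.eventually_lt continuousAt_const ?_
        have := hden x
        nlinarith
      obtain ⟨ε, hε, hball⟩ := Metric.eventually_nhds_iff.1 hev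
      set z := min y (x + ε / 2) with hz
      have hxz : x < z := lt_min hxy (by linarith)
      have hclose : ∀ s ∈ Icc x z, δ + ‖w s‖ < (1 + η) * (δ + ‖w x‖) := by
        intro s hs
        refine hball ?_
        have : z ≤ x + ε / 2 := min_le_right _ _
        rw [Real.dist_eq, abs_of_nonneg (by linarith [hs.1])]
        linarith [hs.2]
      refine ⟨z, ?_, hxz, min_le_left _ _⟩
      have hwz : w z - w x = ∫ s in x..z, f s := by
        rw [hw]
        exact intervalIntegral.integral_interval_sub_left hf.intervalIntegrable
          hf.intervalIntegrable
      have hφz : φ z - φ x = ∫ s in x..z, ‖f s‖ / (δ + ‖w s‖) := by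
        rw [hφ]
        exact intervalIntegral.integral_interval_sub_left hki.intervalIntegrable
          hki.intervalIntegrable
      have h1 : Real.log (δ + ‖w z‖) - Real.log (δ + ‖w x‖) ≤
          (∫ s in x..z, ‖f s‖) / (δ + ‖w x‖) := by
        rw [← Real.log_div (hden z).ne' (hden x).ne']
        refine (Real.log_le_sub_one_of_pos (div_pos (hden z) (hden x))).trans ?_
        rw [div_sub_one (hden x).ne']
        have h2 : ‖w z‖ - ‖w x‖ ≤ ∫ s in x..z, ‖f s‖ := by
          refine (norm_sub_norm_le _ _).trans ?_
          rw [hwz]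
          exact intervalIntegral.norm_integral_le_integral_norm hxz.le
        have := hden x
        gcongr
        linarith
      have h3 : (∫ s in x..z, ‖f s‖) / (δ + ‖w x‖) ≤ (1 + η) * (φ z - φ x) := by
        rw [hφz, ← intervalIntegral.integral_div, ← intervalIntegral.integral_const_mul]
        refine intervalIntegral.integral_mono_on hxz.le
          (hf.norm.div_const _).intervalIntegrable (hki.const_mul _).intervalIntegrable
          fun s hs => ?_
        rw [← mul_div_assoc, div_le_div_iff₀ (hden x) (hden s)]
        have := hclose s hs
        nlinarith [norm_nonneg (f s)]
      have hx' : Real.log (δ + ‖w x‖) - Real.log δ ≤ (1 + η) * φ x := hx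
      change Real.log (δ + ‖w z‖) - Real.log δ ≤ (1 + η) * φ z
      linarith
  exact hsub (right_mem_Icc.2 ht)

/-- The logarithm of the distance from the origin along an absolutely continuous curve, in terms
of the logarithmic derivative. -/
lemma ofReal_log_le_lintegral {E : Type*} [NormedAddCommGroup E] [NormedSpace ℝ E]
    {f w : ℝ → E} {T : ℝ} (hf : IntegrableOn f (Ioo 0 T))
    (hw : ∀ t ∈ Icc 0 T, w t = ∫ s in (0 : ℝ)..t, f s) {δ : ℝ} (hδ : 0 < δ) {t : ℝ}
    (ht : t ∈ Icc 0 T) :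
    ENNReal.ofReal (Real.log (1 + ‖w t‖ / δ)) ≤
      ∫⁻ s in Ioo 0 T, ‖f s‖ₑ / ENNReal.ofReal (δ + ‖w s‖) := by
  set g : ℝ → E := (Ioo 0 T).indicator f with hg
  have hgi : Integrable g := (integrable_indicator_iff measurableSet_Ioo).2 hf
  have hfg : ∀ t ∈ Icc 0 T, w t = ∫ s in (0 : ℝ)..t, g s := by
    intro t ht
    rw [hw t ht, intervalIntegral.integral_of_le ht.1, intervalIntegral.integral_of_le ht.1,
      integral_Ioc_eq_integral_Ioo, integral_Ioc_eq_integral_Ioo]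
    refine setIntegral_congr_fun measurableSet_Ioo fun s hs => ?_
    have hs' : s ∈ Ioo 0 T := ⟨hs.1, hs.2.trans_le ht.2⟩
    exact (indicator_of_mem hs' f).symm
  have hlog : Real.log (1 + ‖w t‖ / δ) ≤
      ∫ s in (0 : ℝ)..t, ‖g s‖ / (δ + ‖∫ r in (0 : ℝ)..s, g r‖) := by
    have h1 : Real.log (1 + ‖w t‖ / δ) =
        Real.log (δ + ‖∫ s in (0 : ℝ)..t, g s‖) - Real.log δ := by
      rw [← hfg t ht, ← Real.log_div (by positivity) hδ.ne', add_div, div_self hδ.ne']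
    rw [h1]
    set I := ∫ s in (0 : ℝ)..t, ‖g s‖ / (δ + ‖∫ r in (0 : ℝ)..s, g r‖)
    -- The integral does not depend on the slack `η`, so letting `η` decrease to `0` removes the
    -- factor `1 + η`.
    have hlim : Filter.Tendsto (fun η : ℝ => (1 + η) * I) (nhdsWithin 0 (Ioi 0)) (nhds I) := by
      have : Filter.Tendsto (fun η : ℝ => (1 + η) * I) (nhds 0) (nhds ((1 + 0) * I)) :=
        ((continuous_const.add continuous_id).mul continuous_const).tendsto 0
      rw [add_zero, one_mul] at this
      exact this.mono_left nhdsWithin_le_nhds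
    refine ge_of_tendsto hlim ?_
    filter_upwards [self_mem_nhdsWithin] with η hη
    exact log_le_mul_integral_of_integrable hgi hδ hη ht.1
  rw [intervalIntegral.integral_of_le ht.1] at hlog
  refine (ENNReal.ofReal_le_ofReal hlog).trans ((Real.ofReal_le_enorm _).trans
    ((enorm_integral_le_lintegral_enorm _).trans ?_))
  rw [← restrict_Ioo_eq_restrict_Ioc]
  refine le_trans (le_of_eq ?_) (lintegral_mono_set (Ioo_subset_Ioo_right ht.2))
  refine setLIntegral_congr_fun measurableSet_Ioo fun s hs => ?_
  have hs' : s ∈ Ioo 0 T := ⟨hs.1, hs.2.trans_le ht.2⟩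
  have hgs : g s = f s := indicator_of_mem hs' f
  rw [← hfg s (Ioo_subset_Icc_self hs'), hgs, Real.enorm_eq_ofReal (by positivity),
    ENNReal.ofReal_div_of_pos (by positivity),
    ofReal_norm]

/-! ### A continuous interpolation of the scheme -/

section Interpolation

variable {T : ℝ} {c : ℝ → Rd d → Rd d} {C C' : ℝ} {Λ : ℝ≥0} {N : ℕ} {θ : ℝ}
  {Y : ℕ → Rd d → Rd d}

lemma sum_indicator_nodes {E : Type*} [AddCommMonoid E] (hT : 0 < T) {i : ℕ} (hi : i < N)
    (f : ℕ → ℝ → E) {s : ℝ} (hs : s ∈ Ico (i * (T / N)) ((i + 1) * (T / N))) :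
    ∑ j ∈ Finset.range N, (Ico (j * (T / N)) (((j : ℝ) + 1) * (T / N))).indicator (f j) s =
      f i s := by
  have hN : (0 : ℝ) < N := by exact_mod_cast (Nat.zero_le i).trans_lt hi
  have hh : 0 < T / N := by positivity
  rw [Finset.sum_eq_single i]
  · exact indicator_of_mem hs _
  · intro j _ hji
    refine indicator_of_notMem (fun hj => hji ?_) _
    have h1 : (j : ℝ) < i + 1 := lt_of_mul_lt_mul_right (hj.1.trans_lt hs.2) hh.le
    have h2 : (i : ℝ) < j + 1 := lt_of_mul_lt_mul_right (hs.1.trans_lt hj.2) hh.le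
    have h1' : j < i + 1 := by exact_mod_cast h1
    have h2' : i < j + 1 := by exact_mod_cast h2
    omega
  · intro h
    exact absurd (Finset.mem_range.2 hi) h

lemma exists_mem_Ico_nodes (hT : 0 < T) (hN : 0 < N) {s : ℝ} (hs : s ∈ Ico 0 T) :
    ∃ i < N, s ∈ Ico (i * (T / N)) (((i : ℝ) + 1) * (T / N)) := by
  have hN' : (0 : ℝ) < N := by exact_mod_cast hN
  have hh : 0 < T / N := by positivity
  have h1 := Nat.floor_le (div_nonneg hs.1 hh.le)
  have h2 := Nat.lt_floor_add_one (s / (T / N))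
  rw [le_div_iff₀ hh] at h1
  rw [div_lt_iff₀ hh] at h2
  refine ⟨⌊s / (T / N)⌋₊, ?_, h1, h2⟩
  have h3 : (⌊s / (T / N)⌋₊ : ℝ) * (T / N) < N * (T / N) := by
    refine h1.trans_lt (hs.2.trans_eq ?_)
    field_simp
  exact_mod_cast lt_of_mul_lt_mul_right h3 hh.le

/-- The velocity of the interpolation of the scheme by the unaveraged field. -/
noncomputable def stepField (T : ℝ) (N : ℕ) (θ : ℝ) (c : ℝ → Rd d → Rd d) (Y : ℕ → Rd d → Rd d)
    (s : ℝ) (x : Rd d) : Rd d :=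
  ∑ i ∈ Finset.range N, (Ico (i * (T / N)) (((i : ℝ) + 1) * (T / N))).indicator
    (fun s => (1 - θ) • c s (Y i x) + θ • c s (Y (i + 1) x)) s

/-- The interpolation of the scheme by the unaveraged field. -/
noncomputable def stepFlow (T : ℝ) (N : ℕ) (θ : ℝ) (c : ℝ → Rd d → Rd d) (Y : ℕ → Rd d → Rd d)
    (t : ℝ) (x : Rd d) : Rd d :=
  x + ∫ s in (0 : ℝ)..t, stepField T N θ c Y s x

lemma stepField_eq (hT : 0 < T) {i : ℕ} (hi : i < N) {s : ℝ}
    (hs : s ∈ Ico (i * (T / N)) (((i : ℝ) + 1) * (T / N))) (x : Rd d) :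
    stepField T N θ c Y s x = (1 - θ) • c s (Y i x) + θ • c s (Y (i + 1) x) :=
  sum_indicator_nodes hT hi (fun i s => (1 - θ) • c s (Y i x) + θ • c s (Y (i + 1) x)) hs

lemma ae_norm_stepField_le (hT : 0 < T) (hN : 0 < N) (hθ : θ ∈ Icc (0 : ℝ) 1)
    (hc : IsRegularField T c C Λ C') :
    ∀ᵐ s ∂volume.restrict (Ioo 0 T), ∀ x, ‖stepField T N θ c Y s x‖ ≤ C := by
  filter_upwards [hc.ae_norm_le, ae_restrict_mem measurableSet_Ioo] with s hs hsT x
  obtain ⟨i, hi, hsi⟩ := exists_mem_Ico_nodes hT hN (Ioo_subset_Ico_self hsT)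
  rw [stepField_eq hT hi hsi]
  have h1 : 0 ≤ 1 - θ := by linarith [hθ.2]
  calc _ ≤ ‖(1 - θ) • c s (Y i x)‖ + ‖θ • c s (Y (i + 1) x)‖ := norm_add_le _ _
    _ = (1 - θ) * ‖c s (Y i x)‖ + θ * ‖c s (Y (i + 1) x)‖ := by
        rw [norm_smul, norm_smul, Real.norm_eq_abs, Real.norm_eq_abs, abs_of_nonneg h1,
          abs_of_nonneg hθ.1]
    _ ≤ (1 - θ) * C + θ * C := by
        have := hθ.1
        gcongr
        · exact hs _
        · exact hs _
    _ = C := by ring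

lemma integrableOn_stepField (hT : 0 < T) (hN : 0 < N) (hθ : θ ∈ Icc (0 : ℝ) 1)
    (hc : IsRegularField T c C Λ C') (x : Rd d) :
    IntegrableOn (fun s => stepField T N θ c Y s x) (Ioo 0 T) := by
  refine Integrable.of_bound ?_ C ?_
  · unfold stepField
    refine Finset.aestronglyMeasurable_fun_sum _ fun i _ => ?_
    exact (((hc.aestronglyMeasurable_time (Y i x)).const_smul (1 - θ)).add
      ((hc.aestronglyMeasurable_time (Y (i + 1) x)).const_smul θ)).indicator measurableSet_Ico
  · filter_upwards [ae_norm_stepField_le (Y := Y) hT hN hθ hc] with s hs using hs x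

lemma intervalIntegrable_of_integrableOn_Ioo {E : Type*} [NormedAddCommGroup E] {f : ℝ → E}
    (hf : IntegrableOn f (Ioo 0 T)) {a b : ℝ} (ha : a ∈ Icc 0 T) (hb : b ∈ Icc 0 T) :
    IntervalIntegrable f volume a b := by
  rw [← integrableOn_Icc_iff_integrableOn_Ioo] at hf
  exact (hf.mono_set (uIcc_subset_Icc ha hb)).intervalIntegrable

lemma norm_stepFlow_sub_le (hT : 0 < T) (hN : 0 < N) (hθ : θ ∈ Icc (0 : ℝ) 1)
    (hc : IsRegularField T c C Λ C') (x : Rd d) {s t : ℝ} (hs : 0 ≤ s) (hst : s ≤ t)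
    (ht : t ≤ T) :
    ‖stepFlow T N θ c Y t x - stepFlow T N θ c Y s x‖ ≤ C * (t - s) := by
  have hi := integrableOn_stepField (Y := Y) hT hN hθ hc x
  have h0 : (0 : ℝ) ∈ Icc 0 T := left_mem_Icc.2 hT.le
  rw [stepFlow, stepFlow, add_sub_add_left_eq_sub, intervalIntegral.integral_interval_sub_left
    (intervalIntegrable_of_integrableOn_Ioo hi h0 ⟨hs.trans hst, ht⟩)
    (intervalIntegrable_of_integrableOn_Ioo hi h0 ⟨hs, hst.trans ht⟩)]
  have h := intervalIntegral.norm_integral_le_of_norm_le (a := s) (b := t) (μ := volume)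
    (f := fun s => stepField T N θ c Y s x) (g := fun _ => C) hst ?_ intervalIntegrable_const
  · simpa [mul_comm] using h
  · rw [← ae_restrict_iff' measurableSet_Ioc]
    filter_upwards [ae_mono (restrict_Ioc_le_restrict_Ioo hs ht)
      (ae_norm_stepField_le (Y := Y) hT hN hθ hc)] with s hs using hs x

/-- The step length times the time average is the integral of the field over the step, so the step
velocity integrates exactly to the increment of the scheme. -/
lemma stepFlow_node (hT : 0 < T) (hN : 0 < N) (hθ : θ ∈ Icc (0 : ℝ) 1)
    (hc : IsRegularField T c C Λ C') (hY : IsThetaScheme T N θ c Y) {i : ℕ} (hi : i ≤ N)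
    (x : Rd d) : stepFlow T N θ c Y (i * (T / N)) x = Y i x := by
  have hint := integrableOn_stepField (Y := Y) hT hN hθ hc x
  induction i with
  | zero => simp [stepFlow, hY.init]
  | succ i ih =>
    have hi' : i < N := hi
    have ih' := ih hi'.le
    have hlt := node_lt_succ_node hT hi'
    have hle := succ_node_le hT hi'
    have h0 := node_nonneg (N := N) hT i
    have hmem0 : (0 : ℝ) ∈ Icc 0 T := left_mem_Icc.2 hT.le
    have hN' : (0 : ℝ) < N := by exact_mod_cast hN
    have hh : T / N ≠ 0 := by positivity
    have hci : ∀ (r : ℝ) (y : Rd d), IntervalIntegrable (fun s => r • c s y) volume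
        (i * (T / N)) (((i : ℝ) + 1) * (T / N)) := fun r y =>
      (hc.intervalIntegrable y h0 hlt.le hle).smul r
    have hY' : Y (i + 1) x = Y i x + ∫ s in (i * (T / N))..((i + 1) * (T / N)),
        stepField T N θ c Y s x := by
      rw [← sub_eq_iff_eq_add', hY.sub_eq hT hi', timeAverage_eq, timeAverage_eq,
        ← sub_mul, add_sub_cancel_left, one_mul, smul_smul, smul_smul, mul_right_comm,
        mul_inv_cancel₀ hh, one_mul, mul_right_comm, mul_inv_cancel₀ hh, one_mul,
        ← intervalIntegral.integral_smul, ← intervalIntegral.integral_smul,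
        ← intervalIntegral.integral_add (hci _ _) (hci _ _),
        intervalIntegral.integral_of_le hlt.le, intervalIntegral.integral_of_le hlt.le,
        integral_Ioc_eq_integral_Ioo, integral_Ioc_eq_integral_Ioo]
      refine setIntegral_congr_fun measurableSet_Ioo fun s hs => ?_
      exact (stepField_eq hT hi' (Ioo_subset_Ico_self hs) x).symm
    rw [hY', ← ih', stepFlow, stepFlow, add_assoc]
    congr 1
    push_cast
    rw [intervalIntegral.integral_add_adjacent_intervals
      (intervalIntegrable_of_integrableOn_Ioo hint hmem0 ⟨h0, hlt.le.trans hle⟩)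
      (intervalIntegrable_of_integrableOn_Ioo hint ⟨h0, hlt.le.trans hle⟩
        ⟨h0.trans hlt.le, hle⟩)]

lemma norm_stepFlow_sub_node_le (hT : 0 < T) (hN : 0 < N) (hθ : θ ∈ Icc (0 : ℝ) 1)
    (hc : IsRegularField T c C Λ C') (hC : 0 ≤ C) (hY : IsThetaScheme T N θ c Y) {i : ℕ}
    (hi : i < N) {t : ℝ} (ht : t ∈ Ico (i * (T / N)) (((i : ℝ) + 1) * (T / N))) (x : Rd d) :
    ‖stepFlow T N θ c Y t x - Y i x‖ ≤ C * (T / N) ∧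
      ‖stepFlow T N θ c Y t x - Y (i + 1) x‖ ≤ C * (T / N) := by
  have h0 := node_nonneg (N := N) hT i
  have hle := succ_node_le hT hi
  constructor
  · rw [← stepFlow_node hT hN hθ hc hY hi.le x]
    refine (norm_stepFlow_sub_le hT hN hθ hc x h0 ht.1 (ht.2.le.trans hle)).trans ?_
    gcongr
    linarith [ht.2]
  · rw [← stepFlow_node hT hN hθ hc hY hi x, norm_sub_rev]
    push_cast
    refine (norm_stepFlow_sub_le hT hN hθ hc x (h0.trans ht.1) ht.2.le hle).trans ?_
    gcongr
    linarith [ht.1]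

/-- On each step the interpolant is a convex combination of the two nodes, each within `C * (T / N)`
of the step flow, whose speed is at most `C`. -/
lemma norm_interpolant_sub_stepFlow_le (hT : 0 < T) (hN : 0 < N) (hθ : θ ∈ Icc (0 : ℝ) 1)
    (hc : IsRegularField T c C Λ C') (hC : 0 ≤ C) (hY : IsThetaScheme T N θ c Y) {t : ℝ}
    (ht : t ∈ Icc 0 T) (x : Rd d) :
    ‖interpolant T N Y t x - stepFlow T N θ c Y t x‖ ≤ C * (T / N) := by
  have hN' : (0 : ℝ) < N := by exact_mod_cast hN
  have hh : 0 < T / N := by positivity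
  by_cases htT : t = T
  · have h1 := stepFlow_node hT hN hθ hc hY le_rfl x
    rw [show (N : ℝ) * (T / N) = T by field_simp] at h1
    rw [interpolant, if_pos htT, htT, h1, sub_self, norm_zero]
    positivity
  · obtain ⟨i, hi, hti⟩ := exists_mem_Ico_nodes hT hN ⟨ht.1, lt_of_le_of_ne ht.2 htT⟩
    obtain ⟨h1, h2⟩ := norm_stepFlow_sub_node_le hT hN hθ hc hC hY hi hti x
    rw [interpolant, if_neg htT, sum_indicator_nodes hT hi (fun i s =>
      Y i x + ((s - i * (T / N)) / (T / N)) • (Y (i + 1) x - Y i x)) hti]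
    set r := (t - i * (T / N)) / (T / N) with hr
    have hr0 : 0 ≤ r := div_nonneg (by linarith [hti.1]) hh.le
    have hr1 : 0 ≤ 1 - r := by
      rw [sub_nonneg, hr, div_le_one hh]
      linarith [hti.2]
    have h3 : Y i x + r • (Y (i + 1) x - Y i x) - stepFlow T N θ c Y t x =
        -((1 - r) • (stepFlow T N θ c Y t x - Y i x) +
          r • (stepFlow T N θ c Y t x - Y (i + 1) x)) := by
      module
    rw [h3, norm_neg]
    calc _ ≤ ‖(1 - r) • (stepFlow T N θ c Y t x - Y i x)‖ +
          ‖r • (stepFlow T N θ c Y t x - Y (i + 1) x)‖ := norm_add_le _ _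
      _ ≤ (1 - r) * (C * (T / N)) + r * (C * (T / N)) := by
          rw [norm_smul, norm_smul, Real.norm_eq_abs, Real.norm_eq_abs, abs_of_nonneg hr1,
            abs_of_nonneg hr0]
          gcongr
      _ = _ := by ring

end Interpolation

end ThetaFlow

namespace ThetaFlow

open Metric

variable {d : ℕ}

/-! ### Joint measurability -/

/-- Null sets of the product are tested slice by slice. This is what makes `b` composed with a flow
measurable and independent of the representative of `b`. -/
lemma quasiMeasurePreserving_skew {T : ℝ} {Φ : ℝ × Rd d → Rd d} (hΦ : Measurable Φ)
    (h : ∀ᵐ s ∂volume.restrict (Ioo 0 T), Measure.map (fun x => Φ (s, x)) volume ≪ volume) :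
    Measure.QuasiMeasurePreserving (fun z : ℝ × Rd d => (z.1, Φ z)) (slab d T) (slab d T) := by
  have hm : Measurable fun z : ℝ × Rd d => (z.1, Φ z) := measurable_fst.prodMk hΦ
  refine ⟨hm, Measure.AbsolutelyContinuous.mk fun A hA h0 => ?_⟩
  rw [Measure.map_apply hm hA, slab, Measure.measure_prod_null (hm hA)]
  rw [slab, Measure.measure_prod_null hA] at h0
  filter_upwards [h0, h] with s hs hs'
  have h1 := hs' hs
  have hms : Measurable fun x => Φ (s, x) := hΦ.comp measurable_prodMk_left
  rwa [Measure.map_apply hms (measurable_prodMk_left hA)] at h1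

lemma aestronglyMeasurable_comp_skew {T : ℝ} {f : ℝ → Rd d → Rd d}
    (hf : AEStronglyMeasurable (Function.uncurry f) (slab d T)) {Φ : ℝ × Rd d → Rd d}
    (hΦ : Measurable Φ)
    (h : ∀ᵐ s ∂volume.restrict (Ioo 0 T), Measure.map (fun x => Φ (s, x)) volume ≪ volume) :
    AEStronglyMeasurable (fun z : ℝ × Rd d => f z.1 (Φ z)) (slab d T) :=
  hf.comp_quasiMeasurePreserving (quasiMeasurePreserving_skew hΦ h)

/-- Almost every trajectory is continuous in time. Measurable versions at countably many times
therefore determine the flow off one null set; setting it to zero there leaves a function continuous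
in time and measurable in space, hence jointly measurable. -/
lemma IsRegularLagrangianFlow.exists_measurable {T : ℝ} (hT : 0 < T) {b : ℝ → Rd d → Rd d}
    {X : ℝ → Rd d → Rd d} (h : IsRegularLagrangianFlow T b X) :
    ∃ X' : ℝ × Rd d → Rd d, Measurable X' ∧
      ∀ᵐ x, ∀ t ∈ Icc 0 T, X' (t, x) = X t x := by
  -- Times are clamped to `[0,T]`, so that continuity in time holds on the whole line.
  set q : ℝ → ℝ := fun t => projIcc 0 T hT.le t with hq
  have hqc : Continuous q := continuous_subtype_val.comp continuous_projIcc
  have hqmem : ∀ t, q t ∈ Icc 0 T := fun t => (projIcc 0 T hT.le t).2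
  have hqid : ∀ t ∈ Icc 0 T, q t = t := fun t ht => by
    rw [hq]; simp only [projIcc_of_mem hT.le ht]
  have hae : ∀ᵐ x : Rd d, (IntervalIntegrable (fun s => b s (X s x)) volume 0 T ∧
      ∀ t ∈ Icc 0 T, X t x = x + ∫ s in (0 : ℝ)..t, b s (X s x)) ∧
      ∀ r : ℚ, X (q r) x = (h.aemeasurable (q r) (hqmem r)).mk _ x :=
    h.integral_eq.and (ae_all_iff.2 fun r => (h.aemeasurable (q r) (hqmem r)).ae_eq_mk)
  set P : Set (Rd d) := {x | (IntervalIntegrable (fun s => b s (X s x)) volume 0 T ∧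
      ∀ t ∈ Icc 0 T, X t x = x + ∫ s in (0 : ℝ)..t, b s (X s x)) ∧
      ∀ r : ℚ, X (q r) x = (h.aemeasurable (q r) (hqmem r)).mk _ x} with hP
  obtain ⟨E, hEP, hEm, hE⟩ : ∃ E ⊆ P, MeasurableSet E ∧ ∀ᵐ x, x ∈ E := by
    refine ⟨(toMeasurable volume Pᶜ)ᶜ, ?_, (measurableSet_toMeasurable _ _).compl, ?_⟩
    · exact compl_subset_comm.1 (subset_toMeasurable _ _)
    · have h0 : volume Pᶜ = 0 := ae_iff.1 hae
      rw [← measure_toMeasurable] at h0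
      exact compl_mem_ae_iff.2 h0
  set u : ℝ → Rd d → Rd d := fun t => E.indicator fun x => X (q t) x with hu
  have hcont : ∀ x, Continuous fun t => u t x := by
    intro x
    by_cases hx : x ∈ E
    · have h1 : (fun t => u t x) = fun t => x + ∫ s in (0 : ℝ)..(q t), b s (X s x) := by
        ext1 t
        rw [hu]
        exact (indicator_of_mem hx _).trans ((hEP hx).1.2 _ (hqmem t))
      have h2 : ContinuousOn (fun t => ∫ s in (0 : ℝ)..t, b s (X s x)) (Icc 0 T) := by
        have hi := (hEP hx).1.1
        have := intervalIntegral.continuousOn_primitive_interval' hi left_mem_uIcc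
        rwa [uIcc_of_le hT.le] at this
      rw [h1]
      exact continuous_const.add (h2.comp_continuous hqc hqmem)
    · have h1 : (fun t => u t x) = fun _ => 0 := by
        ext1 t
        exact indicator_of_notMem hx _
      rw [h1]
      exact continuous_const
  have hmeas : ∀ t, Measurable (u t) := by
    intro t
    have hrat : ∀ r : ℚ, Measurable (u r) := by
      intro r
      have : u r = E.indicator ((h.aemeasurable (q r) (hqmem r)).mk _) := by
        rw [hu]
        exact indicator_congr fun x hx => (hEP hx).2 r
      rw [this]
      exact (h.aemeasurable (q r) (hqmem r)).measurable_mk.indicator hEm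
    obtain ⟨y, hy, hyt⟩ := mem_closure_iff_seq_limit.1
      (Rat.isDenseEmbedding_coe_real.dense t)
    choose r hr using hy
    refine measurable_of_tendsto_metrizable (f := fun n => u (r n)) (fun n => hrat _) ?_
    rw [tendsto_pi_nhds]
    intro x
    have := ((hcont x).tendsto t).comp hyt
    refine this.congr fun n => ?_
    simp [← hr n]
  refine ⟨Function.uncurry u, measurable_uncurry_of_continuous_of_measurable hcont hmeas, ?_⟩
  filter_upwards [hE] with x hx t ht
  change E.indicator (fun x => X (q t) x) x = X t x
  rw [indicator_of_mem hx, hqid t ht]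

section Measurability

variable {T : ℝ} {c : ℝ → Rd d → Rd d} {C C' : ℝ} {Λ : ℝ≥0} {N : ℕ} {θ : ℝ}
  {Y : ℕ → Rd d → Rd d}

lemma stepField_eq_zero {s : ℝ} (hT : 0 < T) (hs : s ∉ Ico 0 T) (x : Rd d) :
    stepField T N θ c Y s x = 0 := by
  refine Finset.sum_eq_zero fun i hi => indicator_of_notMem (fun h => hs ?_) _
  exact ⟨(node_nonneg hT i).trans h.1, h.2.trans_le (succ_node_le hT (Finset.mem_range.1 hi))⟩

lemma integrable_stepField (hT : 0 < T) (hN : 0 < N) (hθ : θ ∈ Icc (0 : ℝ) 1)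
    (hc : IsRegularField T c C Λ C') (x : Rd d) :
    Integrable (fun s => stepField T N θ c Y s x) := by
  rw [← integrableOn_iff_integrable_of_support_subset (s := Ico 0 T),
    integrableOn_Ico_iff_integrableOn_Ioo]
  · exact integrableOn_stepField hT hN hθ hc x
  · intro s hs
    by_contra hn
    exact hs (stepField_eq_zero hT hn x)

/-- The step flow is continuous in time, and by dominated convergence also in space, because the
nodes and almost every `c s` are continuous. -/
lemma measurable_stepFlow (hT : 0 < T) (hN : 0 < N) (hθ : θ ∈ Icc (0 : ℝ) 1)
    (hc : IsRegularField T c C Λ C') (hC : 0 ≤ C) (hY : ∀ i ≤ N, Continuous (Y i)) :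
    Measurable (Function.uncurry (stepFlow T N θ c Y)) := by
  have hint := integrable_stepField (Y := Y) hT hN hθ hc
  refine measurable_uncurry_of_continuous_of_measurable (fun x => ?_) (fun t => ?_)
  · exact continuous_const.add
      (intervalIntegral.continuous_primitive (fun a b => (hint x).intervalIntegrable) 0)
  · refine Continuous.measurable (continuous_id.add ?_)
    have hae : ∀ᵐ s : ℝ, (∀ x, ‖stepField T N θ c Y s x‖ ≤ C) ∧
        Continuous fun x => stepField T N θ c Y s x := by
      have h1 := (ae_restrict_iff' measurableSet_Ioo).1
        ((ae_norm_stepField_le (Y := Y) hT hN hθ hc).and hc.ae_lipschitzWith)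
      -- The bounds on the field hold on the open interval, whereas the step velocity may be nonzero
      -- at time `0` as well.
      have h0 : ∀ᵐ s : ℝ, s ≠ 0 := by simp [ae_iff]
      filter_upwards [h1, h0] with s hs hs0
      by_cases hsT : s ∈ Ico 0 T
      · obtain ⟨h2, h3⟩ := hs ⟨lt_of_le_of_ne hsT.1 hs0.symm, hsT.2⟩
        obtain ⟨i, hi, hsi⟩ := exists_mem_Ico_nodes hT hN hsT
        refine ⟨h2, ?_⟩
        simp_rw [stepField_eq hT hi hsi]
        exact ((h3.continuous.comp (hY i hi.le)).const_smul (1 - θ)).add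
          ((h3.continuous.comp (hY (i + 1) hi)).const_smul θ)
      · simp_rw [stepField_eq_zero hT hsT]
        exact ⟨fun x => by simpa using hC, continuous_const⟩
    refine intervalIntegral.continuous_of_dominated_interval (bound := fun _ => C)
      (fun x => (hint x).aestronglyMeasurable.restrict) (fun x => ?_) intervalIntegrable_const ?_
    · filter_upwards [hae] with s hs _ using hs.1 x
    · filter_upwards [hae] with s hs _ using hs.2

lemma aestronglyMeasurable_stepField (hc : IsRegularField T c C Λ C')
    (hY : ∀ i ≤ N, Continuous (Y i)) {L : ℝ≥0∞}
    (hL : ∀ i ≤ N, Measure.map (Y i) volume ≤ L • volume) :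
    AEStronglyMeasurable (fun z : ℝ × Rd d => stepField T N θ c Y z.1 z.2) (slab d T) := by
  have h1 : ∀ i ≤ N, AEStronglyMeasurable (fun z : ℝ × Rd d => c z.1 (Y i z.2)) (slab d T) :=
    fun i hi => aestronglyMeasurable_comp_skew hc.aestronglyMeasurable
      ((hY i hi).measurable.comp measurable_snd)
      (Filter.Eventually.of_forall fun s => Measure.absolutelyContinuous_of_le_smul (hL i hi))
  unfold stepField
  refine Finset.aestronglyMeasurable_fun_sum _ fun i hi => ?_
  have hi' := Finset.mem_range.1 hi
  exact (((h1 i hi'.le).const_smul (1 - θ)).add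
    ((h1 (i + 1) hi').const_smul θ)).indicator (s := Prod.fst ⁻¹'
      (Ico (i * (T / N)) (((i : ℝ) + 1) * (T / N)))) (measurable_fst measurableSet_Ico)

end Measurability

/-! ### The estimate at a fixed time -/

lemma ae_comp_of_map_le {Φ : Rd d → Rd d} (hΦ : AEMeasurable Φ) {L : ℝ≥0∞}
    (hL : Measure.map Φ volume ≤ L • volume) {P : Rd d → Prop} (hP : ∀ᵐ y, P y) :
    ∀ᵐ x, P (Φ x) :=
  ae_of_ae_map hΦ ((Measure.absolutelyContinuous_of_le_smul hL).ae_le hP)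

/-- The denominator contains the distance from the step flow `w`, the numerator that from a node
`y`; their discrepancy `H` is paid for by `δ`. -/
lemma enorm_sub_div_le {ρ δ H : ℝ} (hδ : 0 < δ) {y z w : Rd d} (hw : ‖w - y‖ ≤ H)
    (hρ : ρ = δ + ‖w - z‖) :
    ‖y - z‖ₑ / ENNReal.ofReal ρ ≤ ENNReal.ofReal (1 + H / δ) := by
  have hH : 0 ≤ H := (norm_nonneg _).trans hw
  have hρ0 : 0 < ρ := by rw [hρ]; positivity
  refine ENNReal.div_le_of_le_mul ?_
  rw [← ENNReal.ofReal_mul (by positivity), ← ofReal_norm]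
  refine ENNReal.ofReal_le_ofReal ?_
  have h1 : ‖y - z‖ ≤ ‖w - z‖ + H := by
    have : y - z = (w - z) - (w - y) := by abel
    rw [this]
    exact (norm_sub_le _ _).trans (by gcongr)
  have h2 : (1 + H / δ) * ρ = ‖w - z‖ + H + (δ + H / δ * ‖w - z‖) := by
    rw [hρ]; field_simp; ring
  rw [h2]
  have : 0 ≤ δ + H / δ * ‖w - z‖ := by positivity
  linarith

/-- Insert `v (Φ x)`. The difference `u - v` at `Φ x` is integrated by the change of variables `Φ`;
that of `v` at `Φ x` and `Ξ x` is bounded by maximal functions. The exceptional null set of the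
latter bound pulls back to null sets, since both maps compress volumes. -/
lemma setLIntegral_enorm_sub_div_le (hd : 0 < d) {p : ℝ} (hp : 1 < p) {u v : Rd d → Rd d}
    {Gv : Rd d → Rd d →L[ℝ] Rd d} (hu : AEStronglyMeasurable u volume)
    (hv : AEStronglyMeasurable v volume) (hG : HasWeakGradient v Gv)
    (hGm : AEStronglyMeasurable Gv volume) {Φ Ξ w : Rd d → Rd d} (hΦ : AEMeasurable Φ)
    (hΞ : AEMeasurable Ξ) {L L' : ℝ≥0∞} (hL' : Measure.map Φ volume ≤ L' • volume)
    (hL : Measure.map Ξ volume ≤ L • volume) {δ H : ℝ} (hδ : 0 < δ)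
    (hw : ∀ x, ‖w x - Φ x‖ ≤ H) (s : Set (Rd d)) :
    ∫⁻ x in s, ‖u (Φ x) - v (Ξ x)‖ₑ / ENNReal.ofReal (δ + ‖w x - Ξ x‖) ≤
      (ENNReal.ofReal δ)⁻¹ * L' * (∫⁻ y, ‖u y - v y‖ₑ) +
      ENNReal.ofReal (1 + H / δ) * sobolevConst d *
        (maximalConst d p L' (volume s) + maximalConst d p L (volume s)) *
        (∫⁻ y, ‖Gv y‖ₑ ^ p) ^ (1 / p) := by
  set g := hGm.enorm.mk (fun y => ‖Gv y‖ₑ) with hgdef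
  have hgm : Measurable g := hGm.enorm.measurable_mk
  have hge : ∀ᵐ y, ‖Gv y‖ₑ = g y := hGm.enorm.ae_eq_mk
  have hDm' : AEMeasurable (fun y => ‖u y - v y‖ₑ) := (hu.sub hv).enorm
  set D := hDm'.mk (fun y => ‖u y - v y‖ₑ) with hDdef
  have hDm : Measurable D := hDm'.measurable_mk
  have hDe : ∀ᵐ y, ‖u y - v y‖ₑ = D y := hDm'.ae_eq_mk
  obtain ⟨S, hS, hSle⟩ := hG.exists_enorm_sub_le_maximal hgm (hge.mono fun y hy => hy.le)
  set K := ENNReal.ofReal (1 + H / δ) * sobolevConst d with hK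
  have hKt : K ≠ ⊤ := ENNReal.mul_ne_top ENNReal.ofReal_ne_top sobolevConst_ne_top
  have hgp : ∫⁻ y, ‖Gv y‖ₑ ^ p = ∫⁻ y, g y ^ p :=
    lintegral_congr_ae (hge.mono fun y hy => by simp only [hy])
  have hMm := measurable_maximal hgm
  have hpt : ∀ᵐ x, ‖u (Φ x) - v (Ξ x)‖ₑ / ENNReal.ofReal (δ + ‖w x - Ξ x‖) ≤
      (ENNReal.ofReal δ)⁻¹ * D (Φ x) + (K * maximal g (Φ x) + K * maximal g (Ξ x)) := by
    filter_upwards [ae_comp_of_map_le hΦ hL' hS, ae_comp_of_map_le hΦ hL' hDe,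
      ae_comp_of_map_le hΞ hL hS] with x h1 h2 h3
    have h4 : ‖u (Φ x) - v (Ξ x)‖ₑ ≤ D (Φ x) + sobolevConst d * ‖Φ x - Ξ x‖ₑ *
        (maximal g (Φ x) + maximal g (Ξ x)) := by
      have : u (Φ x) - v (Ξ x) = (u (Φ x) - v (Φ x)) + (v (Φ x) - v (Ξ x)) := by abel
      rw [this, ← h2]
      exact (enorm_add_le _ _).trans (by gcongr; exact hSle _ h1 _ h3)
    have h5 : (ENNReal.ofReal (δ + ‖w x - Ξ x‖))⁻¹ ≤ (ENNReal.ofReal δ)⁻¹ := by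
      gcongr
      simp
    have h6 := enorm_sub_div_le hδ (hw x) (rfl : δ + ‖w x - Ξ x‖ = _)
    calc _ ≤ (D (Φ x) + sobolevConst d * ‖Φ x - Ξ x‖ₑ *
        (maximal g (Φ x) + maximal g (Ξ x))) / ENNReal.ofReal (δ + ‖w x - Ξ x‖) := by
          gcongr
      _ = (ENNReal.ofReal (δ + ‖w x - Ξ x‖))⁻¹ * D (Φ x) +
          (‖Φ x - Ξ x‖ₑ / ENNReal.ofReal (δ + ‖w x - Ξ x‖)) * sobolevConst d *
          (maximal g (Φ x) + maximal g (Ξ x)) := by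
          simp only [div_eq_mul_inv]; ring
      _ ≤ (ENNReal.ofReal δ)⁻¹ * D (Φ x) + ENNReal.ofReal (1 + H / δ) * sobolevConst d *
          (maximal g (Φ x) + maximal g (Ξ x)) := by gcongr
      _ = _ := by rw [hK]; ring
  have hDΦm : AEMeasurable (fun x => D (Φ x)) := hDm.comp_aemeasurable hΦ
  have hMΦm : AEMeasurable (fun x => maximal g (Φ x)) := hMm.comp_aemeasurable hΦ
  have hDΦ : ∫⁻ x in s, D (Φ x) ≤ L' * ∫⁻ y, ‖u y - v y‖ₑ := by
    calc _ ≤ ∫⁻ x, D (Φ x) := setLIntegral_le_lintegral _ _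
      _ = ∫⁻ y, D y ∂(Measure.map Φ volume) := (lintegral_map' hDm.aemeasurable hΦ).symm
      _ ≤ ∫⁻ y, D y ∂(L' • volume) := lintegral_mono' hL' le_rfl
      _ = L' * ∫⁻ y, D y := by rw [lintegral_smul_measure, smul_eq_mul]
      _ = _ := by rw [lintegral_congr_ae hDe]
  have hδt : (ENNReal.ofReal δ)⁻¹ ≠ ⊤ := by simpa using hδ
  calc _ ≤ ∫⁻ x in s, ((ENNReal.ofReal δ)⁻¹ * D (Φ x) +
        (K * maximal g (Φ x) + K * maximal g (Ξ x))) :=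
        lintegral_mono_ae (ae_restrict_of_ae hpt)
    _ = (ENNReal.ofReal δ)⁻¹ * (∫⁻ x in s, D (Φ x)) +
        (K * (∫⁻ x in s, maximal g (Φ x)) + K * ∫⁻ x in s, maximal g (Ξ x)) := by
        rw [lintegral_add_left' (hDΦm.const_mul _).restrict,
          lintegral_add_left' (hMΦm.const_mul _).restrict,
          lintegral_const_mul' _ _ hδt, lintegral_const_mul' _ _ hKt, lintegral_const_mul' _ _ hKt]
    _ ≤ (ENNReal.ofReal δ)⁻¹ * (L' * ∫⁻ y, ‖u y - v y‖ₑ) +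
        (K * (maximalConst d p L' (volume s) * (∫⁻ y, g y ^ p) ^ (1 / p)) +
          K * (maximalConst d p L (volume s) * (∫⁻ y, g y ^ p) ^ (1 / p))) := by
        gcongr
        · exact setLIntegral_maximal_comp_le hd hgm hp hΦ hL' s
        · exact setLIntegral_maximal_comp_le hd hgm hp hΞ hL s
    _ = _ := by rw [hgp]; ring

/-! ### The estimate of the logarithmic functional -/

/-- Bound the logarithm along almost every trajectory, exchange time and space, and estimate at
fixed time. Both compression constants are parameters, since the estimate is applied with two
different values of `L`. -/
lemma lintegral_log_stepFlow_le (hd : 0 < d) {T : ℝ} (hT : 0 < T) {p : ℝ} (hp : 1 < p)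
    {b : ℝ → Rd d → Rd d} {G : ℝ → Rd d → Rd d →L[ℝ] Rd d}
    (hbm : AEStronglyMeasurable (Function.uncurry b) (slab d T))
    (hGm : AEStronglyMeasurable (Function.uncurry G) (slab d T))
    (hG : ∀ᵐ t ∂volume.restrict (Ioo 0 T), HasWeakGradient (b t) (G t))
    {X : ℝ → Rd d → Rd d} (hX : IsRegularLagrangianFlow T b X) {L L' : ℝ≥0∞}
    (hLX : ∀ t ∈ Ioo 0 T, Measure.map (X t) volume ≤ L • volume)
    {c : ℝ → Rd d → Rd d} {C C' : ℝ} {Λ : ℝ≥0} (hc : IsRegularField T c C Λ C') (hC : 0 ≤ C)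
    {N : ℕ} (hN : 0 < N) {θ : ℝ} (hθ : θ ∈ Icc (0 : ℝ) 1) {Y : ℕ → Rd d → Rd d}
    (hY : IsThetaScheme T N θ c Y) (hYc : ∀ i ≤ N, Continuous (Y i))
    (hLY : ∀ i ≤ N, Measure.map (Y i) volume ≤ L' • volume) {δ : ℝ} (hδ : 0 < δ)
    {t : ℝ} (ht : t ∈ Icc 0 T) (hLt : L ≠ ⊤) (hL't : L' ≠ ⊤) {B : Set (Rd d)}
    (hB : volume B ≠ ⊤) :
    ∫⁻ x in B, ENNReal.ofReal (Real.log (1 + ‖stepFlow T N θ c Y t x - X t x‖ / δ)) ≤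
      2 * ((ENNReal.ofReal δ)⁻¹ * L' * (∫⁻ s in Ioo 0 T, ∫⁻ y, ‖c s y - b s y‖ₑ) +
      ENNReal.ofReal (1 + C * (T / N) / δ) * sobolevConst d *
        (maximalConst d p L' (volume B) + maximalConst d p L (volume B)) *
        ∫⁻ s in Ioo 0 T, (∫⁻ y, ‖G s y‖ₑ ^ p) ^ (1 / p)) := by
  set K := ENNReal.ofReal (1 + C * (T / N) / δ) * sobolevConst d *
        (maximalConst d p L' (volume B) + maximalConst d p L (volume B)) with hK
  set V := stepField T N θ c Y
  set W := stepFlow T N θ c Y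
  set J : ℝ → Rd d → ℝ≥0∞ := fun s x =>
    ‖V s x - b s (X s x)‖ₑ / ENNReal.ofReal (δ + ‖W s x - X s x‖) with hJ
  have hlog : ∀ᵐ x, ENNReal.ofReal (Real.log (1 + ‖W t x - X t x‖ / δ)) ≤
      ∫⁻ s in Ioo 0 T, J s x := by
    filter_upwards [hX.integral_eq] with x hx
    have hVi := integrableOn_stepField (Y := Y) hT hN hθ hc x
    have hbi : IntegrableOn (fun s => b s (X s x)) (Ioo 0 T) :=
      (intervalIntegrable_iff_integrableOn_Ioo_of_le hT.le).1 hx.1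
    refine ofReal_log_le_lintegral (hVi.sub hbi) (w := fun t => W t x - X t x)
      (fun t ht => ?_) hδ ht
    have h0 : (0 : ℝ) ∈ Icc 0 T := left_mem_Icc.2 hT.le
    have h1 := intervalIntegral.integral_sub (intervalIntegrable_of_integrableOn_Ioo hVi h0 ht)
      (intervalIntegrable_of_integrableOn_Ioo hbi h0 ht)
    rw [hx.2 t ht]
    refine Eq.trans ?_ h1.symm
    exact add_sub_add_left_eq_sub _ _ _
  -- The definition of the flow gives measurability only at each fixed time, so Tonelli's theorem
  -- requires the jointly measurable version of the flow.
  have hJm : AEMeasurable (fun z : ℝ × Rd d => J z.1 z.2) (slab d T) := by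
    obtain ⟨X', hX'm, hX'⟩ := hX.exists_measurable hT
    have hac : ∀ᵐ s ∂volume.restrict (Ioo 0 T),
        Measure.map (fun x => X' (s, x)) volume ≪ volume := by
      filter_upwards [ae_restrict_mem measurableSet_Ioo] with s hs
      have : Measure.map (fun x => X' (s, x)) volume = Measure.map (X s) volume :=
        Measure.map_congr (hX'.mono fun x hx => hx s (Ioo_subset_Icc_self hs))
      rw [this]
      exact Measure.absolutelyContinuous_of_le_smul (hLX s hs)
    have h1 := aestronglyMeasurable_comp_skew hbm hX'm hac
    have hVm : AEStronglyMeasurable (fun z : ℝ × Rd d => V z.1 z.2) (slab d T) :=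
      aestronglyMeasurable_stepField hc hYc hLY
    have hWm : Measurable (fun z : ℝ × Rd d => W z.1 z.2) :=
      measurable_stepFlow hT hN hθ hc hC hYc
    have h2 : AEMeasurable (fun z : ℝ × Rd d => ‖V z.1 z.2 - b z.1 (X' z)‖ₑ /
        ENNReal.ofReal (δ + ‖W z.1 z.2 - X' z‖)) (slab d T) :=
      (hVm.sub h1).enorm.div
        ((measurable_const.add (hWm.sub hX'm).norm).ennreal_ofReal.aemeasurable)
    refine h2.congr ?_
    have h3 : ∀ᵐ z ∂slab d T, z.1 ∈ Ioo 0 T := by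
      have := Measure.quasiMeasurePreserving_fst (μ := volume.restrict (Ioo 0 T))
        (ν := (volume : Measure (Rd d))) |>.ae (ae_restrict_mem measurableSet_Ioo)
      exact this
    have h4 : ∀ᵐ z ∂slab d T, ∀ t ∈ Icc 0 T, X' (t, z.2) = X t z.2 := by
      have := Measure.quasiMeasurePreserving_snd (μ := volume.restrict (Ioo 0 T))
        (ν := (volume : Measure (Rd d))) |>.ae hX'
      exact this
    filter_upwards [h3, h4] with z hz1 hz2
    have h5 : X' z = X z.1 z.2 := hz2 z.1 (Ioo_subset_Icc_self hz1)
    simp only [hJ, h5]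
  have hDm : AEMeasurable (fun s => ∫⁻ y, ‖c s y - b s y‖ₑ) (volume.restrict (Ioo 0 T)) :=
    ((hc.aestronglyMeasurable.sub hbm).enorm).lintegral_prod_right'
  have hfix : ∀ᵐ s ∂volume.restrict (Ioo 0 T), ∫⁻ x in B, J s x ≤
      2 * ((ENNReal.ofReal δ)⁻¹ * L' * (∫⁻ y, ‖c s y - b s y‖ₑ) +
        K * (∫⁻ y, ‖G s y‖ₑ ^ p) ^ (1 / p)) := by
    have hbs : ∀ᵐ s ∂volume.restrict (Ioo 0 T), AEStronglyMeasurable (b s) volume :=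
      hbm.prodMk_left
    have hGs : ∀ᵐ s ∂volume.restrict (Ioo 0 T), AEStronglyMeasurable (G s) volume :=
      hGm.prodMk_left
    filter_upwards [hG, hbs, hGs, hc.ae_lipschitzWith, ae_restrict_mem measurableSet_Ioo]
      with s h1 h2 h3 h4 hsT
    obtain ⟨i, hi, hsi⟩ := exists_mem_Ico_nodes hT hN (Ioo_subset_Ico_self hsT)
    have hnode := norm_stepFlow_sub_node_le hT hN hθ hc hC hY hi hsi
    have hXs := hX.aemeasurable s (Ioo_subset_Icc_self hsT)
    have hcs : AEStronglyMeasurable (c s) volume := h4.continuous.aestronglyMeasurable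
    have e1 := setLIntegral_enorm_sub_div_le hd hp hcs h2 h1 h3
      (hYc i hi.le).measurable.aemeasurable hXs (hLY i hi.le) (hLX s hsT) hδ
      (fun x => (hnode x).1) B
    have e2 := setLIntegral_enorm_sub_div_le hd hp hcs h2 h1 h3
      (hYc (i + 1) hi).measurable.aemeasurable hXs (hLY (i + 1) hi) (hLX s hsT) hδ
      (fun x => (hnode x).2) B
    have hbX : AEStronglyMeasurable (fun x => b s (X s x)) volume :=
      (h2.mono_ac (Measure.absolutelyContinuous_of_le_smul (hLX s hsT))).comp_aemeasurable hXs
    have hWs : Measurable (W s) :=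
      (measurable_stepFlow hT hN hθ hc hC hYc).comp measurable_prodMk_left
    have hmeas : AEMeasurable (fun x => ‖c s (Y i x) - b s (X s x)‖ₑ /
        ENNReal.ofReal (δ + ‖W s x - X s x‖)) volume :=
      (((h4.continuous.comp (hYc i hi.le)).aestronglyMeasurable.sub hbX).enorm).div
        ((hWs.aemeasurable.sub hXs).norm.const_add δ).ennreal_ofReal
    -- The weights `1 - θ` and `θ` are bounded by one; estimating both nodes in full is the source
    -- of the factor `2`.
    have hsplit : ∀ x, J s x ≤ ‖c s (Y i x) - b s (X s x)‖ₑ /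
        ENNReal.ofReal (δ + ‖W s x - X s x‖) + ‖c s (Y (i + 1) x) - b s (X s x)‖ₑ /
        ENNReal.ofReal (δ + ‖W s x - X s x‖) := by
      intro x
      rw [hJ, ← ENNReal.add_div]
      dsimp only
      gcongr
      have hV : V s x - b s (X s x) = (1 - θ) • (c s (Y i x) - b s (X s x)) +
          θ • (c s (Y (i + 1) x) - b s (X s x)) := by
        rw [show V s x = _ from stepField_eq hT hi hsi x]
        module
      have hsm : ∀ r ∈ Icc (0 : ℝ) 1, ∀ y : Rd d, ‖r • y‖ₑ ≤ ‖y‖ₑ := by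
        intro r hr y
        rw [enorm_smul]
        refine mul_le_of_le_one_left zero_le ?_
        rw [Real.enorm_eq_ofReal hr.1]
        exact ENNReal.ofReal_le_one.2 hr.2
      rw [hV]
      refine (enorm_add_le _ _).trans (add_le_add (hsm _ ⟨?_, ?_⟩ _) (hsm _ hθ _))
      · linarith [hθ.2]
      · linarith [hθ.1]
    calc ∫⁻ x in B, J s x ≤ _ := lintegral_mono hsplit
      _ ≤ _ := by
        rw [lintegral_add_left' hmeas.restrict, two_mul]
        exact add_le_add e1 e2
  have hδt : (ENNReal.ofReal δ)⁻¹ ≠ ⊤ := by simpa using hδ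
  have hKt : K ≠ ⊤ :=
    ENNReal.mul_ne_top (ENNReal.mul_ne_top ENNReal.ofReal_ne_top sobolevConst_ne_top)
      (ENNReal.add_ne_top.2 ⟨maximalConst_ne_top hp hL't hB, maximalConst_ne_top hp hLt hB⟩)
  calc _ ≤ ∫⁻ x in B, ∫⁻ s in Ioo 0 T, J s x := lintegral_mono_ae (ae_restrict_of_ae hlog)
    _ = ∫⁻ s in Ioo 0 T, ∫⁻ x in B, J s x := by
        refine lintegral_lintegral_swap ?_
        exact hJm.prod_swap.mono_measure (Measure.prod_mono Measure.restrict_le_self le_rfl)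
    _ ≤ ∫⁻ s in Ioo 0 T, 2 * ((ENNReal.ofReal δ)⁻¹ * L' * (∫⁻ y, ‖c s y - b s y‖ₑ) +
        K * (∫⁻ y, ‖G s y‖ₑ ^ p) ^ (1 / p)) := lintegral_mono_ae hfix
    _ = _ := by
        rw [lintegral_const_mul' _ _ (by simp), lintegral_add_left' (hDm.const_mul _),
          lintegral_const_mul' _ _ (ENNReal.mul_ne_top hδt hL't),
          lintegral_const_mul' _ _ hKt]

end ThetaFlow

namespace ThetaFlow

open Metric

variable {d : ℕ}

/-! ### Choice of the mollification scale and explicit constants -/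

/-- The admissible time steps. -/
noncomputable def maxStep (d : ℕ) (C₁ C₂ : ℝ) : ℝ :=
  min 1 (min (1 / (4 * C₁ ^ 2)) (1 / (2 * (C₂ + detConst d * C₁ ^ 2))))

lemma maxStep_pos {C₁ C₂ : ℝ} (hC₁ : 0 < C₁) (hC₂ : 0 < C₂) : 0 < maxStep d C₁ C₂ := by
  have := detConst_nonneg (d := d)
  refine lt_min one_pos (lt_min (by positivity) (by positivity))

/-- A bound for the compression of volumes by the scheme up to time `T`. -/
noncomputable def flowCompression (d : ℕ) (T C₁ C₂ : ℝ) : ℝ≥0∞ :=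
  ENNReal.ofReal (Real.exp (4 * T * (C₂ + detConst d * C₁ ^ 2)))

lemma flowCompression_ne_top {T C₁ C₂ : ℝ} : flowCompression d T C₁ C₂ ≠ ⊤ :=
  ENNReal.ofReal_ne_top

section Setting

variable {T : ℝ} {b : ℝ → Rd d → Rd d} {G : ℝ → Rd d → Rd d →L[ℝ] Rd d} {X : ℝ → Rd d → Rd d}
  {C₀ C₁ C₂ C₃ α β : ℝ} {bε : ℝ → ℝ → Rd d → Rd d} {N : ℕ} {θ : ℝ} {Y : ℕ → Rd d → Rd d}

lemma rpow_mem_Ioc {h : ℝ} (hh : 0 < h) (hh1 : h ≤ 1) (hβ : 0 < β) :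
    h ^ (1 / (2 * β)) ∈ Ioc (0 : ℝ) 1 :=
  ⟨Real.rpow_pos_of_pos hh _, Real.rpow_le_one hh.le hh1 (by positivity)⟩

lemma IsApproximatingSequence.lintegral_enorm_sub_le
    (hb : IsApproximatingSequence T b C₀ C₁ C₂ C₃ α β bε) (hβ : 0 < β) {h : ℝ} (hh : 0 < h)
    (hh1 : h ≤ 1) :
    ∫⁻ s in Ioo 0 T, ∫⁻ y, ‖bε (h ^ (1 / (2 * β))) s y - b s y‖ₑ ≤
      ENNReal.ofReal (C₀ * h ^ (α / (2 * β))) := by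
  obtain ⟨-, -, h1, -⟩ := hb _ (rpow_mem_Ioc hh hh1 hβ)
  rw [← Real.rpow_mul hh.le, one_div_mul_eq_div] at h1
  refine le_trans (le_of_eq ?_) h1
  simp only [normL1Lp, eLpNorm_one_eq_lintegral_enorm, enorm_norm]

/-- With `ε = h ^ (1 / (2β))` the Lipschitz constant is `C₁ / √h`. So `h Λ = C₁ √h` is small, while
`(h Λ)² = C₁² h` has the order of the divergence term. The three entries of `maxStep` ensure `ε ≤
1`, `h Λ ≤ 1 / 2` and `κ ≤ 1 / 2`. -/
lemma IsThetaScheme.continuous_and_map_le (hT : 0 < T) (hC₁ : 0 < C₁) (hC₂ : 0 < C₂)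
    (hβ : 0 < β) (hC₃ : 0 < C₃) (hb : IsApproximatingSequence T b C₀ C₁ C₂ C₃ α β bε)
    (hN : 0 < N) (hh : T / N ≤ maxStep d C₁ C₂) (hθ : θ ∈ Icc (0 : ℝ) 1)
    (hY : IsThetaScheme T N θ (bε ((T / N) ^ (1 / (2 * β)))) Y) {i : ℕ} (hi : i ≤ N) :
    Continuous (Y i) ∧ Measure.map (Y i) volume ≤ flowCompression d T C₁ C₂ • volume := by
  set h := T / N with hdef
  have hN' : (0 : ℝ) < N := by exact_mod_cast hN
  have hpos : 0 < h := by positivity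
  have hd0 := detConst_nonneg (d := d)
  have hh1 : h ≤ 1 := hh.trans (min_le_left _ _)
  have hh2 : h ≤ 1 / (4 * C₁ ^ 2) := hh.trans ((min_le_right _ _).trans (min_le_left _ _))
  have hh3 : h ≤ 1 / (2 * (C₂ + detConst d * C₁ ^ 2)) :=
    hh.trans ((min_le_right _ _).trans (min_le_right _ _))
  have hc := hb.isRegularField hC₂ hC₃ (rpow_mem_Ioc hpos hh1 hβ)
  have hs : (h ^ (1 / (2 * β))) ^ β = √h := by
    rw [← Real.rpow_mul hpos.le, Real.sqrt_eq_rpow]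
    congr 1
    field_simp
  rw [hs] at hc
  have hsq : √h * √h = h := Real.mul_self_sqrt hpos.le
  have hsp : 0 < √h := Real.sqrt_pos.2 hpos
  have hΛ : h * ((C₁ / √h).toNNReal : ℝ) = C₁ * √h := by
    rw [Real.coe_toNNReal _ (by positivity)]
    nth_rewrite 1 [← hsq]
    field_simp
  have hΛ2 : h * ((C₁ / √h).toNNReal : ℝ) ≤ 1 / 2 := by
    rw [hΛ]
    refine abs_le_of_sq_le_sq' ?_ (by norm_num) |>.2
    rw [mul_pow, sq (√h), hsq]
    rw [le_div_iff₀ (by positivity)] at hh2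
    linarith
  have hM : h * C₂ + detConst d * (h * ((C₁ / √h).toNNReal : ℝ)) ^ 2 ≤
      h * (C₂ + detConst d * C₁ ^ 2) := by
    rw [hΛ, mul_pow, sq (√h), hsq]
    exact le_of_eq (by ring)
  have hM2 : h * (C₂ + detConst d * C₁ ^ 2) ≤ 1 / 2 := by
    rw [le_div_iff₀ (by positivity)] at hh3
    linarith
  exact ⟨(hY.continuous_and_volume_preimage_le hT hθ hc hC₂.le hΛ2 hM hM2 i hi).1,
    hY.map_le hT hN hθ hc hC₂.le hΛ2 hM hM2 hi⟩

/-- The constant in the estimate of the logarithmic functional, for a flow with compression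
constant `L`. -/
noncomputable def logConst (d : ℕ) (p r T D C₀ C₁ C₂ C₃ : ℝ) (L : ℝ≥0∞) : ℝ :=
  2 * ((flowCompression d T C₁ C₂).toReal * C₀ +
    (1 + C₃) * (sobolevConst d *
      (maximalConst d p (flowCompression d T C₁ C₂) (volume (ball (0 : Rd d) r)) +
        maximalConst d p L (volume (ball (0 : Rd d) r)))).toReal * max D 0)

lemma logConst_nonneg {p r D : ℝ} (hC₀ : 0 < C₀) (hC₃ : 0 < C₃) {L : ℝ≥0∞} :
    0 ≤ logConst d p r T D C₀ C₁ C₂ C₃ L := by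
  unfold logConst
  positivity

lemma lintegral_log_stepFlow_le_ofReal (hd : 0 < d) (hT : 0 < T) (hC₀ : 0 < C₀) (hC₁ : 0 < C₁)
    (hC₂ : 0 < C₂) (hC₃ : 0 < C₃) (hβ : 0 < β) {p : ℝ≥0∞} (hp : 1 < p) (hpt : p < ⊤) {D r : ℝ}
    (hbG : MemL1W1p T p b G) (hD : normL1Lp T p G ≤ ENNReal.ofReal D)
    (hX : IsRegularLagrangianFlow T b X) {L : ℝ≥0∞} (hL : L ≠ ⊤)
    (hLX : ∀ t ∈ Ioo 0 T, Measure.map (X t) volume ≤ L • volume)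
    (hb : IsApproximatingSequence T b C₀ C₁ C₂ C₃ α β bε) (hN : 0 < N)
    (hh : T / N ≤ maxStep d C₁ C₂) (hθ : θ ∈ Icc (0 : ℝ) 1)
    (hY : IsThetaScheme T N θ (bε ((T / N) ^ (1 / (2 * β)))) Y) {δ : ℝ} (hδ : 0 < δ) {t : ℝ}
    (ht : t ∈ Icc 0 T) :
    ∫⁻ x in ball (0 : Rd d) r, ENNReal.ofReal (Real.log
        (1 + ‖stepFlow T N θ (bε ((T / N) ^ (1 / (2 * β)))) Y t x - X t x‖ / δ)) ≤
      ENNReal.ofReal (logConst d p.toReal r T D C₀ C₁ C₂ C₃ L *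
        ((T / N) ^ (α / (2 * β)) / δ + (1 + T / N / δ))) := by
  set h := T / N with hdef
  have hN' : (0 : ℝ) < N := by exact_mod_cast hN
  have hpos : 0 < h := by positivity
  have hh1 : h ≤ 1 := hh.trans (min_le_left _ _)
  have hp0 : p ≠ 0 := (zero_lt_one.trans hp).ne'
  have hp1 : 1 < p.toReal := by
    rw [← ENNReal.toReal_one]
    exact (ENNReal.toReal_lt_toReal ENNReal.one_ne_top hpt.ne).2 hp
  have hc := hb.isRegularField hC₂ hC₃ (rpow_mem_Ioc hpos hh1 hβ)
  have hYs := fun i (hi : i ≤ N) => hY.continuous_and_map_le hT hC₁ hC₂ hβ hC₃ hb hN hh hθ hi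
  set L' := flowCompression d T C₁ C₂
  set K := sobolevConst d * (maximalConst d p.toReal L' (volume (ball (0 : Rd d) r)) +
    maximalConst d p.toReal L (volume (ball (0 : Rd d) r))) with hK
  have hBt : volume (ball (0 : Rd d) r) ≠ ⊤ := measure_ball_lt_top.ne
  have hL't : L' ≠ ⊤ := flowCompression_ne_top
  have hKt : K ≠ ⊤ := ENNReal.mul_ne_top sobolevConst_ne_top (ENNReal.add_ne_top.2
    ⟨maximalConst_ne_top hp1 hL't hBt, maximalConst_ne_top hp1 hL hBt⟩)
  have hkey := lintegral_log_stepFlow_le hd hT hp1 hbG.aestronglyMeasurable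
    hbG.aestronglyMeasurable_grad hbG.hasWeakGradient hX hLX hc hC₃.le hN hθ hY
    (fun i hi => (hYs i hi).1) (fun i hi => (hYs i hi).2) hδ ht hL hL't hBt
  -- `D` may be negative, whereas the real constant must be nonnegative; hence `max D 0`.
  have hD' : ∫⁻ s in Ioo 0 T, (∫⁻ y, ‖G s y‖ₑ ^ p.toReal) ^ (1 / p.toReal) ≤
      ENNReal.ofReal (max D 0) := by
    refine le_trans (le_of_eq ?_) (hD.trans (ENNReal.ofReal_le_ofReal (le_max_left _ _)))
    simp only [normL1Lp, eLpNorm_eq_lintegral_rpow_enorm_toReal hp0 hpt.ne, enorm_norm]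
  have hb' := hb.lintegral_enorm_sub_le hβ hpos hh1
  have ha : 0 < h ^ (α / (2 * β)) := Real.rpow_pos_of_pos hpos _
  refine hkey.trans ?_
  calc _ ≤ 2 * ((ENNReal.ofReal δ)⁻¹ * L' * ENNReal.ofReal (C₀ * h ^ (α / (2 * β))) +
        ENNReal.ofReal (1 + C₃ * h / δ) * K * ENNReal.ofReal (max D 0)) := by
        rw [hK, ← mul_assoc (ENNReal.ofReal (1 + C₃ * h / δ))]
        gcongr
    _ = ENNReal.ofReal (2 * (δ⁻¹ * L'.toReal * (C₀ * h ^ (α / (2 * β))) +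
        (1 + C₃ * h / δ) * K.toReal * max D 0)) := by
        have h1 : 0 ≤ C₀ * h ^ (α / (2 * β)) := by positivity
        have h2 : 0 ≤ 1 + C₃ * h / δ := by positivity
        generalize C₀ * h ^ (α / (2 * β)) = u at h1 ⊢
        generalize 1 + C₃ * h / δ = v at h2 ⊢
        rw [ENNReal.ofReal_mul (p := 2) (by norm_num),
          ENNReal.ofReal_add (p := _ * _) (by positivity) (by positivity),
          ENNReal.ofReal_mul (p := δ⁻¹ * L'.toReal) (by positivity),
          ENNReal.ofReal_mul (p := δ⁻¹) (by positivity),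
          ENNReal.ofReal_mul (p := v * K.toReal) (by positivity),
          ENNReal.ofReal_mul (p := v) h2,
          ENNReal.ofReal_toReal hL't, ENNReal.ofReal_toReal hKt, ENNReal.ofReal_inv_of_pos hδ,
          ENNReal.ofReal_ofNat]
    _ ≤ _ := by
        refine ENNReal.ofReal_le_ofReal ?_
        rw [logConst, ← hK, mul_assoc 2]
        have hL0 : 0 ≤ L'.toReal := ENNReal.toReal_nonneg
        have hKm : 0 ≤ K.toReal * max D 0 := by positivity
        have hu : 0 < h ^ (α / (2 * β)) / δ := by positivity
        have hv : 0 < h / δ := by positivity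
        set A := L'.toReal * C₀
        have hA : 0 ≤ A := by positivity
        have e1 : δ⁻¹ * L'.toReal * (C₀ * h ^ (α / (2 * β))) =
            A * (h ^ (α / (2 * β)) / δ) := by
          simp only [A]; field_simp
        rw [e1, mul_div_assoc, mul_assoc, mul_assoc (1 + C₃)]
        set u := h ^ (α / (2 * β)) / δ
        set v := h / δ
        set m := K.toReal * max D 0
        have e2 : (A + (1 + C₃) * m) * (u + (1 + v)) =
            A * u + (1 + C₃ * v) * m + (A * (1 + v) + m * u + C₃ * m * u + C₃ * m + m * v) := by
          ring
        rw [e2]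
        have : 0 ≤ A * (1 + v) + m * u + C₃ * m * u + C₃ * m + m * v := by positivity
        linarith

/-! ### The compression constant of a regular Lagrangian flow -/

/-- The nodes of the explicit Euler method. -/
noncomputable def eulerNodes (T : ℝ) (N : ℕ) (c : ℝ → Rd d → Rd d) : ℕ → Rd d → Rd d
  | 0, x => x
  | i + 1, x => eulerNodes T N c i x +
      (T / N) • (⨍ s in (i * (T / N))..((i + 1) * (T / N)), c s (eulerNodes T N c i x))

/-- The compression bound for `X` needs schemes with arbitrarily large `N`, while the theorem
supplies a single one. For `θ = 0` the recursion is explicit and always available. -/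
lemma isThetaScheme_eulerNodes (hT : 0 < T) (hN : 0 < N) (c : ℝ → Rd d → Rd d) :
    IsThetaScheme T N 0 c (eulerNodes T N c) := by
  have hN' : (0 : ℝ) < N := by exact_mod_cast hN
  have hh : T / N ≠ 0 := by positivity
  refine ⟨fun x => rfl, fun i _ x => ?_⟩
  rw [eulerNodes, add_sub_cancel_left, inv_smul_smul₀ hh]
  simp

/-- The Chebyshev bound for the set where the flows differ by `η`, with `δ` a power of the step: the
denominator diverges, so the size of `K`, and with it `L`, becomes irrelevant. -/
lemma tendsto_log_bound (hT : 0 < T) {η γ : ℝ} (hη : 0 < η) (hγ : 0 < γ) (K : ℝ) :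
    Filter.Tendsto (fun N : ℕ => K / Real.log (1 + η / (T / N) ^ γ)) Filter.atTop (nhds 0) := by
  have h1 : Filter.Tendsto (fun N : ℕ => T / (N : ℝ)) Filter.atTop (nhds 0) :=
    tendsto_const_div_atTop_nhds_zero_nat T
  have h2 : Filter.Tendsto (fun N : ℕ => (T / (N : ℝ)) ^ γ) Filter.atTop (nhds 0) := by
    have := h1.rpow_const (p := γ) (Or.inr hγ.le)
    rwa [Real.zero_rpow hγ.ne'] at this
  have h3 : Filter.Tendsto (fun N : ℕ => (T / (N : ℝ)) ^ γ) Filter.atTop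
      (nhdsWithin 0 (Ioi 0)) := by
    refine tendsto_nhdsWithin_iff.2 ⟨h2, ?_⟩
    filter_upwards [Filter.eventually_gt_atTop 0] with N hN
    have hN' : (0 : ℝ) < N := by exact_mod_cast hN
    exact Real.rpow_pos_of_pos (by positivity) _
  have h4 : Filter.Tendsto (fun N : ℕ => 1 + η / (T / (N : ℝ)) ^ γ) Filter.atTop Filter.atTop := by
    refine Filter.tendsto_atTop_add_const_left _ _ ?_
    exact (h3.inv_tendsto_nhdsGT_zero).const_mul_atTop hη
  exact (Real.tendsto_log_atTop.comp h4).const_div_atTop K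

/-- A set on which the flow stays well inside an open set is not larger than the open set, up to
the compression constant of the scheme. -/
lemma volume_setOf_ball_subset_le (hd : 0 < d) (hT : 0 < T) (hC₀ : 0 < C₀) (hC₁ : 0 < C₁)
    (hC₂ : 0 < C₂) (hC₃ : 0 < C₃) (hα : 0 < α) (hβ : 0 < β) {p : ℝ≥0∞} (hp : 1 < p) (hpt : p < ⊤)
    {D : ℝ}
    (hbG : MemL1W1p T p b G) (hD : normL1Lp T p G ≤ ENNReal.ofReal D)
    (hX : IsRegularLagrangianFlow T b X) {L : ℝ≥0∞} (hL : L ≠ ⊤)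
    (hLX : ∀ t ∈ Ioo 0 T, Measure.map (X t) volume ≤ L • volume)
    (hb : IsApproximatingSequence T b C₀ C₁ C₂ C₃ α β bε) {t : ℝ} (ht : t ∈ Ioo 0 T)
    {A : Set (Rd d)} (hA : IsOpen A) {r η : ℝ} (hη : 0 < η) :
    volume {x | x ∈ ball (0 : Rd d) r ∧ ball (X t x) η ⊆ A} ≤
      flowCompression d T C₁ C₂ * volume A := by
  -- This exponent makes both `h ^ (α / (2β)) / δ` and `h / δ` at most `1` for `δ = h ^ γ`, so the
  -- right-hand side of the estimate is at most `3 K`.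
  set γ := min (α / (2 * β)) 1 with hγ
  have hγ0 : 0 < γ := lt_min (by positivity) one_pos
  set K := logConst d p.toReal r T D C₀ C₁ C₂ C₃ L with hK
  have hK0 : 0 ≤ K := logConst_nonneg hC₀ hC₃
  have hη2 : 0 < η / 2 := by positivity
  have hlim : Filter.Tendsto (fun N : ℕ => flowCompression d T C₁ C₂ * volume A +
      ENNReal.ofReal (3 * K / Real.log (1 + (η / 2) / (T / N) ^ γ))) Filter.atTop
      (nhds (flowCompression d T C₁ C₂ * volume A + ENNReal.ofReal 0)) :=
    tendsto_const_nhds.add (ENNReal.tendsto_ofReal (tendsto_log_bound hT hη2 hγ0 (3 * K)))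
  rw [ENNReal.ofReal_zero, add_zero] at hlim
  have h1 : Filter.Tendsto (fun N : ℕ => T / (N : ℝ)) Filter.atTop (nhds 0) :=
    tendsto_const_div_atTop_nhds_zero_nat T
  refine ge_of_tendsto hlim ?_
  filter_upwards [Filter.eventually_gt_atTop 0,
    h1.eventually_le_const (maxStep_pos (d := d) hC₁ hC₂),
    h1.eventually_le_const (show 0 < η / (2 * C₃) by positivity)] with N hN hh hhη
  set c := bε ((T / N) ^ (1 / (2 * β))) with hcdef
  set Y := eulerNodes T N c
  have hY : IsThetaScheme T N 0 c Y := isThetaScheme_eulerNodes hT hN c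
  have hN' : (0 : ℝ) < N := by exact_mod_cast hN
  set h := T / N with hdef
  have hpos : 0 < h := by positivity
  have hh1 : h ≤ 1 := hh.trans (min_le_left _ _)
  have hθ : (0 : ℝ) ∈ Icc (0 : ℝ) 1 := ⟨le_rfl, zero_le_one⟩
  have hYs := fun i (hi : i ≤ N) => hY.continuous_and_map_le hT hC₁ hC₂ hβ hC₃ hb hN hh hθ hi
  have hc := hb.isRegularField hC₂ hC₃ (rpow_mem_Ioc hpos hh1 hβ)
  have ht' : t ∈ Icc 0 T := Ioo_subset_Icc_self ht
  set δ := h ^ γ with hδ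
  have hδ0 : 0 < δ := Real.rpow_pos_of_pos hpos _
  set W := stepFlow T N 0 c Y with hW
  have hest := lintegral_log_stepFlow_le_ofReal (r := r) hd hT hC₀ hC₁ hC₂ hC₃ hβ hp hpt hbG hD hX
    hL hLX hb hN hh hθ hY hδ0 ht'
  have hest3 : K * (h ^ (α / (2 * β)) / δ + (1 + h / δ)) ≤ 3 * K := by
    have e1 : h ^ (α / (2 * β)) / δ ≤ 1 := by
      rw [div_le_one hδ0]
      exact Real.rpow_le_rpow_of_exponent_ge hpos hh1 (min_le_left _ _)
    have e2 : h / δ ≤ 1 := by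
      rw [div_le_one hδ0]
      nth_rewrite 1 [← Real.rpow_one h]
      exact Real.rpow_le_rpow_of_exponent_ge hpos hh1 (min_le_right _ _)
    nlinarith
  have hest' : ∫⁻ x in ball (0 : Rd d) r, ENNReal.ofReal (Real.log (1 + ‖W t x - X t x‖ / δ)) ≤
      ENNReal.ofReal (3 * K) := hest.trans (ENNReal.ofReal_le_ofReal hest3)
  obtain ⟨i, hi, hti⟩ := exists_mem_Ico_nodes hT hN ⟨ht.1.le, ht.2⟩
  have hnode := fun x => (norm_stepFlow_sub_node_le hT hN hθ hc hC₃.le hY hi hti x).1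
  set l := Real.log (1 + (η / 2) / δ) with hl
  have hl0 : 0 < l := Real.log_pos (by linarith [div_pos hη2 hδ0])
  set Bad : Set (Rd d) := {x | ENNReal.ofReal l ≤
    ENNReal.ofReal (Real.log (1 + ‖W t x - X t x‖ / δ))}
  have hWm : Measurable (W t) :=
    (measurable_stepFlow hT hN hθ hc hC₃.le (fun i hi => (hYs i hi).1)).comp
      measurable_prodMk_left
  have hfm : AEMeasurable (fun x => ENNReal.ofReal (Real.log (1 + ‖W t x - X t x‖ / δ)))
      (volume.restrict (ball (0 : Rd d) r)) :=
    ((((hWm.aemeasurable.sub (hX.aemeasurable t ht')).norm.div_const δ).const_add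
      1).log.ennreal_ofReal).restrict
  have hBad : volume (Bad ∩ ball 0 r) ≤ ENNReal.ofReal (3 * K / l) := by
    have e1 := (mul_meas_ge_le_lintegral₀ hfm (ENNReal.ofReal l)).trans hest'
    rw [mul_comm, ← ENNReal.le_div_iff_mul_le (by simp [hl0]) (by simp),
      ← ENNReal.ofReal_div_of_pos hl0] at e1
    exact (Measure.le_restrict_apply _ _).trans e1
  -- If the node misses the ball of radius `η`, then the step flow is at distance at least `η / 2`
  -- from `X`, because it is within `C₃ h ≤ η / 2` of the node.
  have hsub : {x | x ∈ ball (0 : Rd d) r ∧ ball (X t x) η ⊆ A} ⊆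
      Y i ⁻¹' A ∪ (Bad ∩ ball 0 r) := by
    rintro x ⟨hxr, hxA⟩
    by_cases hYx : Y i x ∈ ball (X t x) η
    · exact Or.inl (hxA hYx)
    · refine Or.inr ⟨?_, hxr⟩
      have e1 : η ≤ ‖Y i x - X t x‖ := by
        simpa [dist_eq_norm] using hYx
      have e2 : ‖Y i x - X t x‖ ≤ ‖W t x - X t x‖ + C₃ * h := by
        have : Y i x - X t x = (W t x - X t x) - (W t x - Y i x) := by abel
        rw [this]
        exact (norm_sub_le _ _).trans (by gcongr; exact hnode x)
      have e3 : C₃ * h ≤ η / 2 := by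
        rw [le_div_iff₀ (by positivity)] at hhη
        linarith
      have e4 : η / 2 ≤ ‖W t x - X t x‖ := by linarith
      refine ENNReal.ofReal_le_ofReal (Real.log_le_log (by positivity) ?_)
      gcongr
  calc _ ≤ volume (Y i ⁻¹' A) + volume (Bad ∩ ball 0 r) :=
        (measure_mono hsub).trans (measure_union_le _ _)
    _ ≤ _ := by
        gcongr
        rw [← Measure.map_apply (hYs i hi.le).1.measurable hA.measurableSet]
        exact (hYs i hi.le).2 A

/-- The preimage of an open set is exhausted by the points of bounded norm whose image keeps a
definite distance from the complement, and each such set obeys the bound of the scheme. The `L` from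
the definition of the flow occurs only inside the proof. -/
lemma IsRegularLagrangianFlow.map_le (hd : 0 < d) (hT : 0 < T) (hC₀ : 0 < C₀) (hC₁ : 0 < C₁)
    (hC₂ : 0 < C₂) (hC₃ : 0 < C₃) (hα : 0 < α) (hβ : 0 < β) {p : ℝ≥0∞} (hp : 1 < p) (hpt : p < ⊤)
    {D : ℝ} (hbG : MemL1W1p T p b G) (hD : normL1Lp T p G ≤ ENNReal.ofReal D)
    (hX : IsRegularLagrangianFlow T b X)
    (hb : IsApproximatingSequence T b C₀ C₁ C₂ C₃ α β bε) {t : ℝ} (ht : t ∈ Ioo 0 T) :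
    Measure.map (X t) volume ≤ flowCompression d T C₁ C₂ • volume := by
  obtain ⟨L, hL⟩ := hX.compress
  have hLX : ∀ t ∈ Ioo 0 T, Measure.map (X t) volume ≤ (L : ℝ≥0∞) • volume := fun t ht =>
    map_le_smul_of_isOpen (hX.aemeasurable t (Ioo_subset_Icc_self ht)) ENNReal.coe_ne_top
      (hL t ht)
  refine map_le_smul_of_isOpen (hX.aemeasurable t (Ioo_subset_Icc_self ht))
    flowCompression_ne_top fun A hA => ?_
  set S : ℕ → Set (Rd d) := fun n =>
    {x | x ∈ ball (0 : Rd d) n ∧ ball (X t x) (1 / ((n : ℝ) + 1)) ⊆ A} with hS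
  have hmono : Monotone S := by
    rintro m n hmn x ⟨hx1, hx2⟩
    have hmn' : (m : ℝ) ≤ n := by exact_mod_cast hmn
    exact ⟨ball_subset_ball hmn' hx1, (ball_subset_ball (by gcongr)).trans hx2⟩
  have hsub : X t ⁻¹' A ⊆ ⋃ n, S n := by
    intro x hx
    obtain ⟨η, hη, hηA⟩ := Metric.isOpen_iff.1 hA _ hx
    obtain ⟨n, hn⟩ := exists_nat_one_div_lt hη
    obtain ⟨m, hm⟩ := exists_nat_gt ‖x‖
    refine mem_iUnion.2 ⟨max m n, ?_, ?_⟩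
    · rw [mem_ball_zero_iff]
      exact hm.trans_le (by exact_mod_cast le_max_left m n)
    · refine (ball_subset_ball ?_).trans hηA
      refine le_trans ?_ hn.le
      have : (n : ℝ) ≤ (max m n : ℕ) := by exact_mod_cast le_max_right m n
      gcongr
  calc volume (X t ⁻¹' A) ≤ volume (⋃ n, S n) := measure_mono hsub
    _ = ⨆ n, volume (S n) := hmono.measure_iUnion
    _ ≤ _ := iSup_le fun n => volume_setOf_ball_subset_le hd hT hC₀ hC₁ hC₂ hC₃ hα hβ hp hpt hbG
        hD hX ENNReal.coe_ne_top hLX hb ht hA (by positivity)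

/-! ### From the step flow to the interpolant, and the theorem -/

lemma continuous_interpolant (hY : ∀ i ≤ N, Continuous (Y i)) (t : ℝ) :
    Continuous (interpolant T N Y t) := by
  unfold interpolant
  by_cases ht : t = T
  · simp only [ht, if_true]
    exact hY N le_rfl
  · simp only [ht, if_false]
    refine continuous_finsetSum _ fun i hi => ?_
    have hi' := Finset.mem_range.1 hi
    by_cases hti : t ∈ Ico (i * (T / N)) (((i : ℝ) + 1) * (T / N))
    · simp only [indicator_of_mem hti]
      exact (hY i hi'.le).add (((hY (i + 1) hi').sub (hY i hi'.le)).const_smul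
        ((t - i * (T / N)) / (T / N)))
    · simp only [indicator_of_notMem hti]
      exact continuous_const

/-- Since `1 + a + e ≤ (1 + a)(1 + e)`, replacing the step flow by the interpolant costs an additive
`C₃ h / δ`. -/
lemma log_one_add_le {a a' e : ℝ} (ha : 0 ≤ a) (ha' : 0 ≤ a') (h : a' ≤ a + e) (he : 0 ≤ e) :
    Real.log (1 + a') ≤ Real.log (1 + a) + e := by
  calc Real.log (1 + a') ≤ Real.log ((1 + a) * (1 + e)) := by
        refine Real.log_le_log (by linarith) ?_
        nlinarith
    _ = Real.log (1 + a) + Real.log (1 + e) := Real.log_mul (by linarith) (by linarith)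
    _ ≤ _ := by
        have := Real.log_le_sub_one_of_pos (show 0 < 1 + e by linarith)
        linarith

end Setting

end ThetaFlow

theorem mainTheorem3 (d : ℕ) (hd : 0 < d) (C₁ C₂ : ℝ) (hC₁ : 0 < C₁) (hC₂ : 0 < C₂) :
    ∃ h₀ : ℝ, 0 < h₀ ∧
    ∀ (p : ℝ≥0∞) (r T B D C₀ C₃ α β : ℝ), 1 < p → p < ⊤ → 0 < r → 0 < T →
      0 < C₀ → 0 < C₃ → 0 < α → 0 < β →
    ∃ K : ℝ, 0 < K ∧
    ∀ (b : ℝ → ThetaFlow.Rd d → ThetaFlow.Rd d)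
      (G : ℝ → ThetaFlow.Rd d → ThetaFlow.Rd d →L[ℝ] ThetaFlow.Rd d)
      (X : ℝ → ThetaFlow.Rd d → ThetaFlow.Rd d)
      (bε : ℝ → ℝ → ThetaFlow.Rd d → ThetaFlow.Rd d),
      ThetaFlow.MemL1W1p T p b G →
      ThetaFlow.normLinf T b ≤ ENNReal.ofReal B →
      ThetaFlow.normL1Lp T p G ≤ ENNReal.ofReal D →
      ThetaFlow.IsDivFree T G →
      ThetaFlow.IsRegularLagrangianFlow T b X →
      ThetaFlow.IsApproximatingSequence T b C₀ C₁ C₂ C₃ α β bε →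
    ∀ (θ δ : ℝ) (N : ℕ) (h : ℝ) (Y : ℕ → ThetaFlow.Rd d → ThetaFlow.Rd d),
      θ ∈ Icc (0 : ℝ) 1 → 0 < δ → 0 < N → h = T / N → h ≤ h₀ →
      ThetaFlow.IsThetaScheme T N θ (bε (h ^ (1 / (2 * β)))) Y →
    ∀ t ∈ Icc (0 : ℝ) T,
      IntegrableOn
        (fun x => Real.log (1 + ‖ThetaFlow.interpolant T N Y t x - X t x‖ / δ))
        (Metric.ball 0 r) volume ∧
      ThetaFlow.logFunctional δ r (ThetaFlow.interpolant T N Y) X t ≤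
        K * (h ^ (α / (2 * β)) / δ + (1 + h / δ)) := by
  refine ⟨ThetaFlow.maxStep d C₁ C₂, ThetaFlow.maxStep_pos hC₁ hC₂, ?_⟩
  intro p r T B D C₀ C₃ α β hp hpt hr hT hC₀ hC₃ hα hβ
  set K₀ := ThetaFlow.logConst d p.toReal r T D C₀ C₁ C₂ C₃ (ThetaFlow.flowCompression d T C₁ C₂)
  have hK₀ : 0 ≤ K₀ := ThetaFlow.logConst_nonneg hC₀ hC₃
  set v := (volume (Metric.ball (0 : ThetaFlow.Rd d) r)).toReal with hv
  have hv0 : 0 ≤ v := ENNReal.toReal_nonneg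
  -- `K₀` comes from the step flow and `C₃ * v` from integrating the interpolation error over the
  -- ball; the `1` makes the constant positive.
  refine ⟨K₀ + C₃ * v + 1, by positivity, ?_⟩
  intro b G X bε hbG _ hD _ hX hb θ δ N h Y hθ hδ hN hh hh₀ hY t ht
  subst hh
  have hN' : (0 : ℝ) < N := by exact_mod_cast hN
  have hpos : 0 < T / N := by positivity
  have hh1 : T / N ≤ 1 := hh₀.trans (min_le_left _ _)
  set c := bε ((T / N) ^ (1 / (2 * β)))
  set Z := ThetaFlow.interpolant T N Y
  set W := ThetaFlow.stepFlow T N θ c Y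
  have hc := hb.isRegularField hC₂ hC₃ (ThetaFlow.rpow_mem_Ioc hpos hh1 hβ)
  have hYs := fun i (hi : i ≤ N) =>
    hY.continuous_and_map_le hT hC₁ hC₂ hβ hC₃ hb hN hh₀ hθ hi
  -- Second use of the estimate, now with the compression constant of the scheme for `X` too, so
  -- `K₀` is independent of `L`.
  have hest := ThetaFlow.lintegral_log_stepFlow_le_ofReal (r := r) hd hT hC₀ hC₁ hC₂ hC₃ hβ hp hpt
    hbG hD hX ThetaFlow.flowCompression_ne_top
    (fun s hs => hX.map_le hd hT hC₀ hC₁ hC₂ hC₃ hα hβ hp hpt hbG hD hb hs) hb hN hh₀ hθ hY hδ ht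
  have hZW : ∀ x, Real.log (1 + ‖Z t x - X t x‖ / δ) ≤
      Real.log (1 + ‖W t x - X t x‖ / δ) + C₃ * (T / N) / δ := by
    intro x
    refine ThetaFlow.log_one_add_le (by positivity) (by positivity) ?_ (by positivity)
    rw [← add_div]
    gcongr
    have h1 : Z t x - X t x = (W t x - X t x) + (Z t x - W t x) := by abel
    rw [h1]
    refine (norm_add_le _ _).trans ?_
    gcongr
    exact ThetaFlow.norm_interpolant_sub_stepFlow_le hT hN hθ hc hC₃.le hY ht x
  have hnn : ∀ x, 0 ≤ Real.log (1 + ‖Z t x - X t x‖ / δ) := fun x =>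
    Real.log_nonneg (le_add_of_nonneg_right (by positivity))
  set R := (T / N) ^ (α / (2 * β)) / δ + (1 + T / N / δ) with hR
  have hu : 0 < (T / N) ^ (α / (2 * β)) / δ := div_pos (Real.rpow_pos_of_pos hpos _) hδ
  have hR0 : 0 < R := by positivity
  have hRh : T / N / δ ≤ R := by rw [hR]; linarith
  have hbound : ∫⁻ x in Metric.ball 0 r,
      ENNReal.ofReal (Real.log (1 + ‖Z t x - X t x‖ / δ)) ≤
      ENNReal.ofReal ((K₀ + C₃ * v + 1) * R) := by
    calc _ ≤ ∫⁻ x in Metric.ball 0 r, (ENNReal.ofReal (Real.log (1 + ‖W t x - X t x‖ / δ)) +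
          ENNReal.ofReal (C₃ * (T / N) / δ)) :=
          lintegral_mono fun x => (ENNReal.ofReal_le_ofReal (hZW x)).trans ENNReal.ofReal_add_le
      _ = (∫⁻ x in Metric.ball 0 r, ENNReal.ofReal (Real.log (1 + ‖W t x - X t x‖ / δ))) +
          ENNReal.ofReal (C₃ * (T / N) / δ) * ENNReal.ofReal v := by
          rw [lintegral_add_right _ measurable_const, setLIntegral_const, hv,
            ENNReal.ofReal_toReal measure_ball_lt_top.ne]
      _ ≤ ENNReal.ofReal (K₀ * R) + ENNReal.ofReal (C₃ * (T / N) / δ * v) := by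
          rw [ENNReal.ofReal_mul (q := v) (by positivity)]
          gcongr
      _ ≤ _ := by
          rw [← ENNReal.ofReal_add (by positivity) (by positivity)]
          refine ENNReal.ofReal_le_ofReal ?_
          have h2 : C₃ * (T / N) / δ * v ≤ C₃ * v * R := by
            calc C₃ * (T / N) / δ * v = C₃ * v * (T / N / δ) := by ring
              _ ≤ _ := by gcongr
          nlinarith
  have hmeas : AEStronglyMeasurable (fun x => Real.log (1 + ‖Z t x - X t x‖ / δ))
      (volume.restrict (Metric.ball 0 r)) := by
    have hZm : Measurable (Z t) :=
      (ThetaFlow.continuous_interpolant (fun i hi => (hYs i hi).1) t).measurable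
    exact ((((hZm.aemeasurable.sub (hX.aemeasurable t ht)).norm.div_const δ).const_add
      1).log.aestronglyMeasurable).restrict
  constructor
  · refine ⟨hmeas, ?_⟩
    rw [hasFiniteIntegral_iff_ofReal (Filter.Eventually.of_forall hnn)]
    exact hbound.trans_lt ENNReal.ofReal_lt_top
  · rw [ThetaFlow.logFunctional, integral_eq_lintegral_of_nonneg_ae
      (Filter.Eventually.of_forall hnn) hmeas]
    exact ENNReal.toReal_le_of_le_ofReal (by positivity) hbound
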